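/- Conventions. Let $S^1=\{z\in\mathbb C:|z|=1\}$, and for a real function $f$ on $S^1$ let $\hat f_k=\frac1{2\pi}\int_0^{2\pi}e^{-ik\theta}f(e^{i\theta})\,d\theta$, $k\in\mathbb Z$. For $s\ge 0$ let $H^s(S^1)$ be the space of $f\in L^2(S^1)$ with $\sum_{k\in\mathbb Z}(1+k^2)^s|\hat f_k|^2<\infty$. For $s>\frac32$ let $\mathcal D^s(S^1)$ be the group of orientation preserving $C^1$-diffeomorphisms $\gamma$ of $S^1$ that have a lift $\tilde\gamma:\mathbb R\to\mathbb R$, $\gamma(e^{i\theta})=e^{i\tilde\gamma(\theta)}$, with $\tilde\gamma-\mathrm{id}\in H^s(S^1)$. Let $\mathcal H_1$ be the complex Hilbert space obtained by completing $C^\infty(S^1,\mathbb R)/\{\text{constants}\}$ with respect to the scalar product $\langle f,g\rangle=\sum_{k\ge1}k\,\overline{\hat f_k}\,\hat g_k$, where the imaginary unit acts as $J:\hat f_k\mapsto i\hat f_k$ for $k\ge 1$ and $\hat f_k\mapsto -i\hat f_k$ for $k\le-1$. Every real $f\in H^{1/2}(S^1)$ has a class $[f]\in\mathcal H_1$ (with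 coefficients $\hat f_k$, $k\ge1$). Let $\Gamma_+(\mathcal H_1)=\bigoplus_{n\ge0}\mathrm{Sym}\,\mathcal H_1^{\otimes n}$ be the symmetric Fock space with vacuum $\Omega$, and let $W(\xi)$, $\xi\in\mathcal H_1$, be the unitary Weyl operators on it, determined by $W(0)=1$, $W(\xi)W(\eta)=e^{-\frac i2\mathrm{Im}\langle\xi,\eta\rangle}W(\xi+\eta)$ and $W(\xi)\Omega=e^{-\|\xi\|^2/4}\sum_n\frac1{\sqrt{n!}}\left(\xi/\sqrt2\right)^{\otimes n}$. Proposition 5.2. Let $\gamma\in\mathcal D^s(S^1)$ with $s>2$. For every $f\in C^\infty(S^1,\mathbb R)$ the functions $f$ and $f\circ\gamma^{-1}$ are in $H^{1/2}(S^1)$, and the map $[f]\mapsto[f\circ\gamma^{-1}]$ extends to a bounded real linear operator $V(\gamma)$ on $\mathcal H_1$ with bounded inverse that preserves $\mathrm{Im}\langle\cdot,\cdot\rangle$. There is a unitary operator $U(\gamma)$ on $\Gamma_+(\mathcal H_1)$ that implements the corresponding automorphism of the CCR algebra, $$U(\gamma)\,W(\xi)\,U(\gamma)^*=W(V(\gamma)\xi)\quad\text{for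 all }\xi\in\mathcal H_1 ,$$ in particular $$\mathrm{Ad}\,U(\gamma)(W([f]))=W([f\circ\gamma^{-1}])\quad\text{for all }f\in C^\infty(S^1,\mathbb R).$$ -/

import Mathlib

open scoped Manifold ContDiff InnerProductSpace

noncomputable section

namespace CircleFock

/-! ### The symmetric Fock space over `ℓ²(ι)` -/

/-- The Hilbert space `ℓ²(ι)`; the inner product is linear in the second variable. -/
abbrev L2 (ι : Type) : Type := lp (fun _ : ι => ℂ) 2

/-- The full Fock space `⨁ₙ ℓ²(ι)^{⊗ n} = ⨁ₙ ℓ²(ιⁿ)` (Hilbert space direct sum). -/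
abbrev FullFock (ι : Type) : Type := L2 (Σ n : ℕ, Fin n → ι)

/-- The closed subspace `⨁ₙ Sym ℓ²(ι)^{⊗ n}` of the full Fock space: the sequences of `n`-particle
wave functions `ψₙ ∈ ℓ²(ιⁿ)` that are invariant under permutations of the `n` particles. -/
def symmSubspace (ι : Type) : Submodule ℂ (FullFock ι) where
  carrier := {ψ | ∀ (n : ℕ) (σ : Equiv.Perm (Fin n)) (i : Fin n → ι), ψ ⟨n, i ∘ σ⟩ = ψ ⟨n, i⟩}
  add_mem' := by
    intro a b ha hb n σ i
    simp [ha n σ i, hb n σ i]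
  zero_mem' := by
    intro n σ i
    simp
  smul_mem' := by
    intro c a ha n σ i
    simp [ha n σ i]

theorem continuous_coord {ι : Type} (i : ι) : Continuous fun ψ : L2 ι => ψ i := by
  classical
  have h : (fun ψ : L2 ι => ψ i) = fun ψ : L2 ι => ⟪lp.single 2 i (1 : ℂ), ψ⟫_ℂ := by
    ext ψ
    rw [lp.inner_single_left]
    simp
  rw [h]
  fun_prop

theorem isClosed_symmSubspace (ι : Type) : IsClosed (symmSubspace ι : Set (FullFock ι)) := by
  have h : (symmSubspace ι : Set (FullFock ι)) = ⋂ (n : ℕ) (σ : Equiv.Perm (Fin n)) (i : Fin n → ι),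
      {ψ : FullFock ι | ψ ⟨n, i ∘ σ⟩ = ψ ⟨n, i⟩} := by
    ext ψ
    simp only [Set.mem_iInter, Set.mem_ofPred_eq]
    rfl
  rw [h]
  refine isClosed_iInter fun n => isClosed_iInter fun σ => isClosed_iInter fun i => ?_
  exact isClosed_eq (continuous_coord (ι := Σ n : ℕ, Fin n → ι) _)
    (continuous_coord (ι := Σ n : ℕ, Fin n → ι) _)

/-- The symmetric (bosonic) Fock space `Γ₊(ℓ²(ι)) = ⨁ₙ Sym ℓ²(ι)^{⊗ n}` as a Hilbert space. -/
def FockSpace (ι : Type) : Type := symmSubspace ι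

instance instNormedAddCommGroupFockSpace (ι : Type) : NormedAddCommGroup (FockSpace ι) :=
  inferInstanceAs (NormedAddCommGroup (symmSubspace ι))

instance instInnerProductSpaceFockSpace (ι : Type) : InnerProductSpace ℂ (FockSpace ι) :=
  inferInstanceAs (InnerProductSpace ℂ (symmSubspace ι))

instance instCompleteSpaceFockSpace (ι : Type) : CompleteSpace (FockSpace ι) :=
  (isClosed_symmSubspace ι).completeSpace_coe

/-- The sequence of wave functions of a Fock space vector: `ψ.toFull ⟨n, i⟩ = ψₙ(i₁, …, iₙ)`. -/
def FockSpace.toFull {ι : Type} (ψ : FockSpace ι) : FullFock ι :=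
  Subtype.val (p := fun φ => φ ∈ symmSubspace ι) ψ

theorem FockSpace.inner_def {ι : Type} (φ ψ : FockSpace ι) :
    ⟪φ, ψ⟫_ℂ = ⟪φ.toFull, ψ.toFull⟫_ℂ := rfl

theorem FockSpace.toFull_symm {ι : Type} (ψ : FockSpace ι) (n : ℕ) (σ : Equiv.Perm (Fin n))
    (i : Fin n → ι) : ψ.toFull ⟨n, i ∘ σ⟩ = ψ.toFull ⟨n, i⟩ :=
  Subtype.property (p := fun φ => φ ∈ symmSubspace ι) ψ n σ i

theorem FockSpace.toFull_injective {ι : Type} :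
    Function.Injective (FockSpace.toFull : FockSpace ι → FullFock ι) :=
  fun _ _ h => Subtype.ext h

/-- Sums over `ιⁿ` of product functions are products of sums. -/
theorem hasSum_prod_fin {ι : Type} (a : ι → ℂ) (ha : Summable fun i => ‖a i‖) (n : ℕ) :
    HasSum (fun i : Fin n → ι => ∏ j, a (i j)) ((∑' i, a i) ^ n) ∧
      Summable fun i : Fin n → ι => ‖∏ j, a (i j)‖ := by
  induction n with
  | zero =>
    refine ⟨?_, ?_⟩
    · simp
    · exact (hasSum_unique _).summable
  | succ n ih =>
    obtain ⟨h1, h2⟩ := ih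
    set b : (Fin n → ι) → ℂ := fun i => ∏ j, a (i j) with hb
    have hs : Summable fun p : ι × (Fin n → ι) => a p.1 * b p.2 :=
      summable_mul_of_summable_norm (f := a) (g := b) ha h2
    have hn : Summable fun p : ι × (Fin n → ι) => ‖a p.1 * b p.2‖ :=
      Summable.mul_norm (f := a) (g := b) ha h2
    have hv : HasSum (fun p : ι × (Fin n → ι) => a p.1 * b p.2) ((∑' i, a i) ^ (n + 1)) := by
      rw [pow_succ', ← h1.tsum_eq, tsum_mul_tsum_of_summable_norm (f := a) (g := b) ha h2]
      exact hs.hasSum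
    have he : ∀ p : ι × (Fin n → ι),
        ∏ j, a (Fin.consEquiv (fun _ : Fin (n + 1) => ι) p j) = a p.1 * b p.2 := by
      intro p
      simp [Fin.consEquiv, Fin.prod_univ_succ, hb]
    refine ⟨?_, ?_⟩
    · rw [← (Fin.consEquiv (fun _ : Fin (n + 1) => ι)).hasSum_iff]
      convert hv using 1
      ext p
      exact he p
    · rw [← (Fin.consEquiv (fun _ : Fin (n + 1) => ι)).summable_iff]
      convert hn using 1
      ext p
      exact congrArg norm (he p)

/-- The exponential series over `⨆ₙ ιⁿ`. -/
theorem hasSum_exp {ι : Type} (a : ι → ℂ) (ha : Summable fun i => ‖a i‖) :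
    HasSum (fun p : Σ n : ℕ, Fin n → ι => (∏ j, a (p.2 j)) / (p.1.factorial : ℂ))
      (Complex.exp (∑' i, a i)) := by
  have hfib : ∀ n : ℕ, HasSum (fun i : Fin n → ι => (∏ j, a (i j)) / (n.factorial : ℂ))
      ((∑' i, a i) ^ n / (n.factorial : ℂ)) := fun n =>
    (hasSum_prod_fin a ha n).1.div_const _
  have hnorm : Summable fun p : Σ n : ℕ, Fin n → ι =>
      ‖(∏ j, a (p.2 j)) / (p.1.factorial : ℂ)‖ := by
    rw [summable_sigma_of_nonneg (fun _ => norm_nonneg _)]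
    refine ⟨fun n => ?_, ?_⟩
    · simp only [norm_div]
      exact (hasSum_prod_fin a ha n).2.div_const _
    · have hb : Summable fun i => ‖((‖a i‖ : ℝ) : ℂ)‖ := by simpa using ha
      have h3 : ∀ n : ℕ, ∑' i : Fin n → ι, ‖(∏ j, a (i j)) / (n.factorial : ℂ)‖
          = (∑' i, ‖a i‖) ^ n / (n.factorial : ℝ) := by
        intro n
        have h4 := (hasSum_prod_fin (fun i => ((‖a i‖ : ℝ) : ℂ)) hb n).1.div_const
          (n.factorial : ℂ)
        have h5 : HasSum (fun i : Fin n → ι => ‖(∏ j, a (i j)) / (n.factorial : ℂ)‖)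
            ((∑' i, ‖a i‖) ^ n / (n.factorial : ℝ)) := by
          rw [← Complex.hasSum_ofReal]
          have h6 : (((∑' i, ‖a i‖) ^ n / (n.factorial : ℝ) : ℝ) : ℂ)
              = (∑' i, ((‖a i‖ : ℝ) : ℂ)) ^ n / (n.factorial : ℂ) := by
            rw [← Complex.ofReal_tsum]
            push_cast
            rfl
          rw [h6]
          have h7 : (fun i : Fin n → ι => ((‖(∏ j, a (i j)) / (n.factorial : ℂ)‖ : ℝ) : ℂ))
              = fun i => (∏ j, ((‖a (i j)‖ : ℝ) : ℂ)) / (n.factorial : ℂ) := by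
            ext i
            simp
          rw [h7]
          exact h4
        exact h5.tsum_eq
      simp only [h3]
      exact Real.summable_pow_div_factorial _
  have hs := hnorm.of_norm
  have h6 := hs.hasSum
  have h7 := h6.sigma hfib
  have h8 : HasSum (fun n : ℕ => (∑' i, a i) ^ n / (n.factorial : ℂ))
      (Complex.exp (∑' i, a i)) := by
    rw [Complex.exp_eq_exp_ℂ]
    exact NormedSpace.expSeries_div_hasSum_exp _
  rwa [h7.unique h8] at h6

theorem memℓp_expVec {ι : Type} (f : L2 ι) :
    Memℓp (fun p : Σ n : ℕ, Fin n → ι =>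
      (∏ j, f (p.2 j)) / ((√(p.1.factorial : ℝ) : ℝ) : ℂ)) 2 := by
  have h0 : Summable fun i => ‖((‖f i‖ ^ 2 : ℝ) : ℂ)‖ := by
    have := (memℓp_gen_iff (p := 2) (by norm_num)).1 (lp.memℓp f)
    simpa using this
  have h := (hasSum_exp (fun i => ((‖f i‖ ^ 2 : ℝ) : ℂ)) h0).summable.norm
  refine memℓp_gen ?_
  refine h.congr ?_
  rintro ⟨n, i⟩
  simp [div_pow, Finset.prod_pow, abs_of_nonneg (Real.sqrt_nonneg _)]

/-- The exponential (coherent) vector `∑ₙ f^{⊗ n} / √(n!)` in the symmetric Fock space. -/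
def expVec {ι : Type} (f : L2 ι) : FockSpace ι :=
  show symmSubspace ι from
  ⟨⟨fun p => (∏ j, f (p.2 j)) / ((√(p.1.factorial : ℝ) : ℝ) : ℂ), memℓp_expVec f⟩, by
    intro n σ i
    show (∏ j, f (i (σ j))) / _ = (∏ j, f (i j)) / _
    rw [Equiv.prod_comp σ (fun j => f (i j))]⟩

theorem expVec_apply {ι : Type} (f : L2 ι) (n : ℕ) (i : Fin n → ι) :
    (expVec f).toFull ⟨n, i⟩ = (∏ j, f (i j)) / ((√(n.factorial : ℝ) : ℝ) : ℂ) := rfl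

/-- The Fock vacuum `Ω = 1 ⊕ 0 ⊕ 0 ⊕ ⋯`. -/
def vacuum (ι : Type) : FockSpace ι := expVec 0

theorem vacuum_apply {ι : Type} (n : ℕ) (i : Fin n → ι) :
    (vacuum ι).toFull ⟨n, i⟩ = if n = 0 then 1 else 0 := by
  rw [vacuum, expVec_apply]
  cases n <;> simp

theorem inner_expVec {ι : Type} (f g : L2 ι) :
    ⟪expVec f, expVec g⟫_ℂ = Complex.exp ⟪f, g⟫_ℂ := by
  rw [FockSpace.inner_def, lp.inner_eq_tsum, lp.inner_eq_tsum]
  have h : Summable fun i => ‖⟪f i, g i⟫_ℂ‖ := (lp.summable_inner (𝕜 := ℂ) f g).norm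
  rw [← (hasSum_exp _ h).tsum_eq]
  congr 1
  ext ⟨n, i⟩
  rw [expVec_apply, expVec_apply]
  have h2 : ((√(n.factorial : ℝ) : ℝ) : ℂ) * ((√(n.factorial : ℝ) : ℝ) : ℂ) = n.factorial := by
    rw [← Complex.ofReal_mul, Real.mul_self_sqrt (by positivity)]
    simp
  simp only [RCLike.inner_apply, map_div₀, map_prod, Complex.conj_ofReal]
  rw [div_mul_div_comm, h2, Finset.prod_mul_distrib]



theorem coeff_eq_zero_of_hasSum_zero (b : ℕ → ℂ)
    (h : ∀ t : ℂ, HasSum (fun n => t ^ n * b n) 0) (n : ℕ) : b n = 0 := by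
  let p : FormalMultilinearSeries ℂ ℂ ℂ := fun n =>
    ContinuousMultilinearMap.mkPiRing ℂ (Fin n) (b n)
  have hc : ∀ n, p.coeff n = b n := by
    intro n
    simp [p, FormalMultilinearSeries.coeff]
  have hp : HasFPowerSeriesAt (0 : ℂ → ℂ) p 0 := by
    rw [hasFPowerSeriesAt_iff]
    refine Filter.Eventually.of_forall fun z => ?_
    simpa [hc] using h z
  rw [← hc n, hp.eq_zero]
  simp [FormalMultilinearSeries.coeff]

/-- A homogeneous polynomial with symmetric coefficients that vanishes identically has zero
coefficients. -/
theorem symm_coeff_eq_zero {S : Type} [Fintype S] [DecidableEq S] (n : ℕ) (c : (Fin n → S) → ℂ)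
    (hc : ∀ (σ : Equiv.Perm (Fin n)) k, c (k ∘ σ) = c k)
    (h : ∀ z : S → ℂ, ∑ k : Fin n → S, c k * ∏ j, z (k j) = 0) (k : Fin n → S) : c k = 0 := by
  let F : ContinuousMultilinearMap ℂ (fun _ : Fin n => S → ℂ) ℂ :=
    ∑ k : Fin n → S, c k • (ContinuousMultilinearMap.mkPiAlgebra ℂ (Fin n) ℂ).compContinuousLinearMap
      (fun j => ContinuousLinearMap.proj (R := ℂ) (φ := fun _ : S => ℂ) (k j))
  have hF : ∀ v, F v = ∑ k : Fin n → S, c k * ∏ j, v j (k j) := by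
    intro v
    simp [F]
  have h0 : (fun x : S → ℂ => F (fun _ => x)) = fun _ => 0 := by
    ext x
    rw [hF, h]
  have h1 := ContinuousMultilinearMap.iteratedFDeriv_comp_diagonal (𝕜 := ℂ) F 0
    (fun j => Pi.single (k j) (1 : ℂ))
  rw [h0] at h1
  have h2 : ∀ σ : Equiv.Perm (Fin n), F (fun j => Pi.single (k (σ j)) (1 : ℂ)) = c k := by
    intro σ
    rw [hF, Finset.sum_eq_single (k ∘ σ)]
    · simp [hc]
    · intro l _ hl
      have : ∃ j, l j ≠ k (σ j) := by
        by_contra hcon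
        push Not at hcon
        exact hl (funext hcon)
      obtain ⟨j, hj⟩ := this
      have : ∏ j, (Pi.single (k (σ j)) (1 : ℂ) : S → ℂ) (l j) = 0 :=
        Finset.prod_eq_zero (Finset.mem_univ j) (by simp [hj])
      rw [this, mul_zero]
    · simp
  have h3 : (0 : ℂ) = (n.factorial : ℂ) * c k := by
    have h4 : iteratedFDeriv ℂ n (fun _ : S → ℂ => (0 : ℂ)) 0
        (fun j => Pi.single (k j) (1 : ℂ)) = 0 := by
      rw [iteratedFDeriv_fun_zero]
      rfl
    rw [h4] at h1
    rw [h1, Finset.sum_congr rfl fun σ _ => h2 σ]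
    simp [Fintype.card_perm]
  have h5 : (n.factorial : ℂ) ≠ 0 := by exact_mod_cast n.factorial_ne_zero
  exact (mul_eq_zero.1 h3.symm).resolve_left h5

/-- The exponential vectors are total in the symmetric Fock space. -/
theorem dense_span_expVec (ι : Type) :
    Dense (Submodule.span ℂ (Set.range (expVec : L2 ι → FockSpace ι)) : Set (FockSpace ι)) := by
  classical
  rw [Submodule.dense_iff_topologicalClosure_eq_top, Submodule.topologicalClosure_eq_top_iff,
    Submodule.eq_bot_iff]
  intro ψ hψ
  have hψ' : ∀ f : L2 ι, ⟪expVec f, ψ⟫_ℂ = 0 := fun f =>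
    hψ _ (Submodule.subset_span ⟨f, rfl⟩)
  apply FockSpace.toFull_injective
  apply lp.ext
  funext ⟨n, i⟩
  set S := Finset.univ.image i with hS
  let ext : (S → ℂ) → L2 ι := fun z => ∑ x : S, lp.single 2 (x : ι) (z x)
  have ext_mem : ∀ z (x : S), ext z x = z x := by
    intro z x
    simp only [ext, lp.coeFn_sum, Finset.sum_apply, lp.single_apply]
    rw [Finset.sum_eq_single x]
    · simp
    · intro y _ hy
      exact Pi.single_eq_of_ne (fun h => hy (Subtype.ext h.symm)) _
    · simp
  have ext_not : ∀ z (x : ι), x ∉ S → ext z x = 0 := by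
    intro z x hx
    simp only [ext, lp.coeFn_sum, Finset.sum_apply, lp.single_apply]
    refine Finset.sum_eq_zero fun y _ => ?_
    exact Pi.single_eq_of_ne (fun h => hx (by rw [h]; exact y.2)) _
  have key : ∀ z : S → ℂ, ∑ k : Fin n → S,
      (starRingEnd ℂ) (ψ.toFull ⟨n, fun j => k j⟩) * ∏ j, z (k j) = 0 := by
    intro z
    let b : ℕ → ℂ := fun m => (∑ k : Fin m → S,
      (starRingEnd ℂ) (ψ.toFull ⟨m, fun j => k j⟩) * ∏ j, z (k j))
        / ((√(m.factorial : ℝ) : ℝ) : ℂ)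
    have hb : ∀ t : ℂ, HasSum (fun m => t ^ m * b m) 0 := by
      intro t
      have h1 : ⟪ψ, expVec (t • ext z)⟫_ℂ = 0 := by
        rw [← inner_conj_symm, hψ', map_zero]
      rw [FockSpace.inner_def] at h1
      have h2 := lp.hasSum_inner (𝕜 := ℂ) ψ.toFull (expVec (t • ext z)).toFull
      rw [h1] at h2
      refine h2.sigma fun m => ?_
      let e : (Fin m → S) → (Fin m → ι) := fun k j => k j
      have he : Function.Injective e := by
        intro k l hkl
        funext j
        exact Subtype.ext (congrFun hkl j)
      rw [← he.hasSum_iff]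
      · convert hasSum_fintype _ using 1
        simp only [b, Function.comp_apply, expVec_apply, e, lp.coeFn_smul, Pi.smul_apply, ext_mem,
          smul_eq_mul, Finset.prod_mul_distrib, Finset.prod_const, Finset.card_univ,
          Fintype.card_fin, RCLike.inner_apply]
        rw [Finset.sum_div, Finset.mul_sum]
        refine Finset.sum_congr rfl fun k _ => ?_
        ring
      · intro l hl
        have : ∃ j, l j ∉ S := by
          by_contra hcon
          push Not at hcon
          exact hl ⟨fun j => ⟨l j, hcon j⟩, rfl⟩
        obtain ⟨j, hj⟩ := this
        have hz : ∏ j, (t • ext z) (l j) = 0 :=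
          Finset.prod_eq_zero (Finset.mem_univ j) (by simp [ext_not z _ hj])
        rw [expVec_apply, hz]
        simp
    have hbn := coeff_eq_zero_of_hasSum_zero b hb n
    have hne : ((√(n.factorial : ℝ) : ℝ) : ℂ) ≠ 0 := by
      have : 0 < (n.factorial : ℝ) := by exact_mod_cast n.factorial_pos
      exact_mod_cast (Real.sqrt_pos.2 this).ne'
    exact (div_eq_zero_iff.1 hbn).resolve_right hne
  have hfin := symm_coeff_eq_zero n
    (fun k : Fin n → S => (starRingEnd ℂ) (ψ.toFull ⟨n, fun j => k j⟩))
    (fun σ k => congrArg _ (ψ.toFull_symm n σ (fun j => k j))) key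
    (fun j => ⟨i j, Finset.mem_image_of_mem i (Finset.mem_univ j)⟩)
  have hres : ψ.toFull ⟨n, i⟩ = 0 := by simpa using hfin
  exact hres

/-! ### Weyl operators -/

/-- Two families of vectors with the same Gram matrix are related by an isometry. -/
theorem exists_isometry {X E F : Type} [NormedAddCommGroup E] [InnerProductSpace ℂ E]
    [NormedAddCommGroup F] [InnerProductSpace ℂ F] [CompleteSpace F] (u : X → E) (v : X → F)
    (huv : ∀ x y, ⟪v x, v y⟫_ℂ = ⟪u x, u y⟫_ℂ)
    (hu : Dense (Submodule.span ℂ (Set.range u) : Set E)) :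
    ∃ T : E →L[ℂ] F, (∀ x, T (u x) = v x) ∧ ∀ ξ, ‖T ξ‖ = ‖ξ‖ := by
  let f : (X →₀ ℂ) →ₗ[ℂ] F := Finsupp.linearCombination ℂ v
  let e : (X →₀ ℂ) →ₗ[ℂ] E := Finsupp.linearCombination ℂ u
  have hin : ∀ x, ⟪f x, f x⟫_ℂ = ⟪e x, e x⟫_ℂ := by
    intro x
    simp only [f, e, Finsupp.linearCombination_apply, Finsupp.sum, sum_inner, inner_sum,
      inner_smul_left, inner_smul_right, huv]
  have hn : ∀ x, ‖f x‖ = ‖e x‖ := by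
    intro x
    rw [@norm_eq_sqrt_re_inner ℂ, @norm_eq_sqrt_re_inner ℂ, hin]
  have hd : DenseRange e := by
    have : Set.range e = (Submodule.span ℂ (Set.range u) : Set E) := by
      rw [← Finsupp.range_linearCombination]
      rfl
    rw [DenseRange, this]
    exact hu
  have hT : ∀ x, f.extendOfNorm e (e x) = f x :=
    LinearMap.extendOfNorm_eq hd ⟨1, fun x => by rw [hn, one_mul]⟩
  refine ⟨f.extendOfNorm e, fun x => ?_, fun ξ => ?_⟩
  · simpa [f, e] using hT (Finsupp.single x 1)
  · refine hd.induction_on (p := fun ξ => ‖f.extendOfNorm e ξ‖ = ‖ξ‖) ξ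
      (isClosed_eq (by fun_prop) (by fun_prop)) fun x => ?_
    rw [hT, hn]

/-- `W` is the Fock representation of the Weyl (CCR) relations over `ℓ²(ι)`: a family of unitary
operators on the symmetric Fock space with `W(0) = 1`,
`W(f) W(g) = exp(-i Im⟨f, g⟩ / 2) W(f + g)` and
`W(f) Ω = exp(-‖f‖² / 4) ∑ₙ (f / √2)^{⊗ n} / √(n!)`. -/
structure IsFockWeyl {ι : Type} (W : L2 ι → (FockSpace ι →L[ℂ] FockSpace ι)) : Prop where
  mem_unitary : ∀ f, W f ∈ unitary (FockSpace ι →L[ℂ] FockSpace ι)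
  map_zero : W 0 = 1
  map_mul : ∀ f g, W f * W g
    = Complex.exp (-(Complex.I * ((⟪f, g⟫_ℂ).im : ℂ) / 2)) • W (f + g)
  map_vacuum : ∀ f, W f (vacuum ι)
    = Complex.exp (-((‖f‖ : ℂ) ^ 2 / 4)) • expVec (((1 / √2 : ℝ) : ℂ) • f)

theorem ext_of_expVec {ι : Type} {S T : FockSpace ι →L[ℂ] FockSpace ι}
    (h : ∀ x, S (expVec x) = T (expVec x)) : S = T := by
  apply ContinuousLinearMap.ext_on (dense_span_expVec ι)
  rintro _ ⟨x, rfl⟩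
  exact h x

theorem sqrt_two_inv_sq : (((1 / √2 : ℝ) : ℂ)) * ((1 / √2 : ℝ) : ℂ) = 1 / 2 := by
  rw [← Complex.ofReal_mul]
  have : (1 / √2 : ℝ) * (1 / √2) = 1 / 2 := by
    rw [div_mul_div_comm, Real.mul_self_sqrt (by norm_num), one_mul]
  rw [this]
  norm_num

/-- The Fock representation of the Weyl relations exists and is unique. -/
theorem existsUnique_isFockWeyl (ι : Type) :
    ∃! W : L2 ι → (FockSpace ι →L[ℂ] FockSpace ι), IsFockWeyl W := by
  set r : ℂ := ((1 / √2 : ℝ) : ℂ) with hr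
  have hrr : r * r = 1 / 2 := sqrt_two_inv_sq
  have hrc : (starRingEnd ℂ) r = r := by rw [hr, Complex.conj_ofReal]
  have hr0 : r ≠ 0 := by
    intro h
    rw [h] at hrr
    norm_num at hrr
  have hex : ∀ f : L2 ι, ∃ T : FockSpace ι →L[ℂ] FockSpace ι,
      (∀ x, T (expVec x) = Complex.exp (-((‖f‖ : ℂ) ^ 2 / 4) - r * ⟪f, x⟫_ℂ) •
        expVec (x + r • f)) ∧ ∀ ξ, ‖T ξ‖ = ‖ξ‖ := by
    intro f
    refine exists_isometry expVec _ (fun x y => ?_) (dense_span_expVec ι)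
    rw [inner_smul_left, inner_smul_right, inner_expVec, inner_expVec, ← Complex.exp_conj,
      ← Complex.exp_add, ← Complex.exp_add]
    congr 1
    simp only [inner_add_left, inner_add_right, inner_smul_left, inner_smul_right, map_sub,
      map_neg, map_div₀, map_pow, Complex.conj_ofReal, map_mul, hrc, inner_conj_symm,
      inner_self_eq_norm_sq_to_K]
    have h4 : (starRingEnd ℂ) (4 : ℂ) = 4 := Complex.conj_ofNat 4
    rw [h4]
    have h5 : ((‖f‖ : ℝ) : ℂ) = ((RCLike.ofReal ‖f‖ : ℂ)) := rfl
    rw [h5]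
    linear_combination ((RCLike.ofReal ‖f‖ : ℂ)) ^ 2 * hrr
  choose W hW hWn using hex
  have hmul : ∀ f g, W f * W g
      = Complex.exp (-(Complex.I * ((⟪f, g⟫_ℂ).im : ℂ) / 2)) • W (f + g) := by
    intro f g
    apply ext_of_expVec
    intro x
    rw [mul_apply_eq_comp, hW, map_smul, hW, smul_apply, hW,
      smul_smul, smul_smul, ← Complex.exp_add, ← Complex.exp_add]
    have h1 : x + r • g + r • f = x + r • (f + g) := by
      rw [smul_add]
      abel
    rw [h1]
    congr 2
    have h2 : (‖f + g‖ : ℂ) ^ 2 = (‖f‖ : ℂ) ^ 2 + 2 * ((⟪f, g⟫_ℂ).re : ℂ) + (‖g‖ : ℂ) ^ 2 := by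
      have := @norm_add_sq ℂ _ _ _ _ f g
      exact_mod_cast this
    have h3 := Complex.re_add_im ⟪f, g⟫_ℂ
    rw [h2]
    simp only [inner_add_left, inner_add_right, inner_smul_right]
    linear_combination (-⟪f, g⟫_ℂ) * hrr + (1 / 2 : ℂ) * h3
  have hzero : W 0 = 1 := by
    apply ext_of_expVec
    intro x
    rw [hW]
    simp
  have hinv : ∀ f, W f * W (-f) = 1 := by
    intro f
    rw [hmul, add_neg_cancel, hzero]
    have : (⟪f, -f⟫_ℂ).im = 0 := by
      rw [inner_neg_right, Complex.neg_im, neg_eq_zero]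
      exact inner_self_im (𝕜 := ℂ) f
    rw [this]
    simp
  have hstar : ∀ f, star (W f) * W f = 1 := fun f =>
    (ContinuousLinearMap.norm_map_iff_adjoint_comp_self (W f)).1 (hWn f)
  have hstar' : ∀ f, star (W f) = W (-f) := by
    intro f
    calc star (W f) = star (W f) * (W f * W (-f)) := by rw [hinv, mul_one]
      _ = W (-f) := by rw [← mul_assoc, hstar, one_mul]
  have hIs : IsFockWeyl W := by
    refine ⟨fun f => ?_, hzero, hmul, fun f => ?_⟩
    · rw [Unitary.mem_iff]
      exact ⟨hstar f, by rw [hstar', hinv]⟩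
    · rw [vacuum, hW]
      simp [hr]
  refine ⟨W, hIs, fun W' hW' => ?_⟩
  have hcoh : ∀ (V : L2 ι → (FockSpace ι →L[ℂ] FockSpace ι)), IsFockWeyl V → ∀ f x, V f (expVec x)
      = (Complex.exp ((‖r⁻¹ • x‖ : ℂ) ^ 2 / 4) *
          Complex.exp (-(Complex.I * ((⟪f, r⁻¹ • x⟫_ℂ).im : ℂ) / 2)) *
          Complex.exp (-((‖f + r⁻¹ • x‖ : ℂ) ^ 2 / 4))) • expVec (r • (f + r⁻¹ • x)) := by
    intro V hV f x
    have h1 : expVec x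
        = Complex.exp ((‖r⁻¹ • x‖ : ℂ) ^ 2 / 4) • V (r⁻¹ • x) (vacuum ι) := by
      rw [hV.map_vacuum, smul_smul, ← Complex.exp_add, add_neg_cancel, Complex.exp_zero, one_smul,
        ← hr, smul_smul, mul_inv_cancel₀ hr0, one_smul]
    rw [h1, map_smul, ← mul_apply_eq_comp, hV.map_mul, smul_apply,
      hV.map_vacuum, smul_smul, smul_smul, mul_assoc]
  funext f
  apply ext_of_expVec
  intro x
  rw [hcoh W' hW', hcoh W hIs]

/-- The Weyl operators `W(f)`, `f ∈ ℓ²(ι)`, on the symmetric Fock space. -/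
def weyl {ι : Type} : L2 ι → (FockSpace ι →L[ℂ] FockSpace ι) := (existsUnique_isFockWeyl ι).choose

theorem isFockWeyl_weyl {ι : Type} : IsFockWeyl (weyl (ι := ι)) :=
  (existsUnique_isFockWeyl ι).choose_spec.1

/-! ### Sobolev classes and Sobolev diffeomorphisms of the circle -/

/-- The `k`-th Fourier coefficient `(1/2π) ∫₀^{2π} e^{-ikθ} f(θ) dθ` of a `2π`-periodic real
function. -/
def fourierCoef (f : ℝ → ℝ) (k : ℤ) : ℂ :=
  (1 / (2 * Real.pi) : ℂ) * ∫ θ in (0 : ℝ)..(2 * Real.pi), Complex.exp (-(Complex.I * k * θ)) * f θ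

/-- `f` is a `2π`-periodic real function of Sobolev class `Hˢ(S¹)`: it is square integrable over a
period and `∑ₖ (1 + k²)ˢ |f̂ₖ|² < ∞`. -/
structure MemSobolev (s : ℝ) (f : ℝ → ℝ) : Prop where
  periodic : Function.Periodic f (2 * Real.pi)
  memLp : MeasureTheory.MemLp f 2
    (MeasureTheory.volume.restrict (Set.Ioc (0 : ℝ) (2 * Real.pi)))
  summable : Summable fun k : ℤ => (1 + (k : ℝ) ^ 2) ^ s * ‖fourierCoef f k‖ ^ 2

/-- A function on the circle as a `2π`-periodic function of the angle. -/
def angular (f : Circle → ℝ) (θ : ℝ) : ℝ := f (Circle.exp θ)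

/-- The Sobolev diffeomorphisms `𝒟ˢ(S¹)` of the circle: the orientation preserving `C¹`
diffeomorphisms `γ` of the circle with a lift `g : ℝ → ℝ`, that is, `γ(e^{iθ}) = e^{i g(θ)}`, such
that `g - id` is of class `Hˢ(S¹)`. A lift of an orientation preserving `C¹` diffeomorphism is a
`C¹` function with `g' > 0` and `g(θ + 2π) = g(θ) + 2π`. -/
def SobolevDiffeo (s : ℝ) : Set (Circle ≃ₘ^1⟮𝓡 1, 𝓡 1⟯ Circle) :=
  {γ | ∃ g : ℝ → ℝ, ContDiff ℝ 1 g ∧ (∀ θ, 0 < deriv g θ) ∧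
    (∀ θ, g (θ + 2 * Real.pi) = g θ + 2 * Real.pi) ∧
    (∀ θ, γ (Circle.exp θ) = Circle.exp (g θ)) ∧
    MemSobolev s (fun θ => g θ - θ)}

/-! ### The one-particle space -/

/-- The one-particle space `H₁`, in the orthonormal basis `e_k / √k`, `k ≥ 1`. It is the completion
of the space of smooth real functions on the circle modulo constants in the norm
`‖[f]‖² = ∑_{k ≥ 1} k |f̂ₖ|²`, with the complex structure `J` that multiplies `f̂ₖ` by `i` for
`k ≥ 1` (and by `-i` for `k ≤ -1`). A real function is determined modulo constants by its
coefficients with `k ≥ 1`, on which `J` is the multiplication by `i`. -/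
abbrev OneParticle : Type := L2 ℕ+

theorem memℓp_oneParticle {f : Circle → ℝ} (hf : MemSobolev (1 / 2) (angular f)) :
    Memℓp (fun k : ℕ+ => ((√(k : ℝ) : ℝ) : ℂ) * fourierCoef (angular f) ((k : ℕ) : ℤ)) 2 := by
  refine memℓp_gen ?_
  have hinj : Function.Injective fun k : ℕ+ => ((k : ℕ) : ℤ) := by
    intro a b h
    have h' : (a : ℕ) = (b : ℕ) := Int.ofNat_inj.1 h
    exact PNat.coe_injective h'
  refine Summable.of_nonneg_of_le (fun k => by positivity) (fun k => ?_)
    (hf.summable.comp_injective hinj)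
  have h1 : ‖((√(k : ℝ) : ℝ) : ℂ) * fourierCoef (angular f) ((k : ℕ) : ℤ)‖ ^ (2 : ENNReal).toReal
      = (k : ℝ) * ‖fourierCoef (angular f) ((k : ℕ) : ℤ)‖ ^ 2 := by
    rw [ENNReal.toReal_ofNat, Real.rpow_ofNat, norm_mul, mul_pow, Complex.norm_real,
      Real.norm_eq_abs, sq_abs, Real.sq_sqrt (by positivity)]
  rw [h1]
  have h2 : (k : ℝ) ≤ (1 + ((((k : ℕ) : ℤ) : ℝ)) ^ 2) ^ (1 / 2 : ℝ) := by
    rw [← Real.sqrt_eq_rpow]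
    apply Real.le_sqrt_of_sq_le
    push_cast
    linarith
  exact mul_le_mul_of_nonneg_right h2 (by positivity)

/-- The class `[f] ∈ H₁` of a real function `f` on the circle of Sobolev class `H^{1/2}`. -/
def oneParticleClass (f : Circle → ℝ) (hf : MemSobolev (1 / 2) (angular f)) : OneParticle :=
  ⟨fun k : ℕ+ => ((√(k : ℝ) : ℝ) : ℂ) * fourierCoef (angular f) ((k : ℕ) : ℤ),
    memℓp_oneParticle hf⟩

/-- The scalar product `⟨[f], [g]⟩ = ∑_{k ≥ 1} k (f̂ₖ)^* ĝₖ`. -/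
theorem hasSum_inner_oneParticleClass {f g : Circle → ℝ} (hf : MemSobolev (1 / 2) (angular f))
    (hg : MemSobolev (1 / 2) (angular g)) :
    HasSum (fun k : ℕ+ => (k : ℂ) * ((starRingEnd ℂ) (fourierCoef (angular f) ((k : ℕ) : ℤ)) *
      fourierCoef (angular g) ((k : ℕ) : ℤ)))
      ⟪oneParticleClass f hf, oneParticleClass g hg⟫_ℂ := by
  have e : (fun k : ℕ+ => (k : ℂ) * ((starRingEnd ℂ) (fourierCoef (angular f) ((k : ℕ) : ℤ)) *
      fourierCoef (angular g) ((k : ℕ) : ℤ)))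
      = fun k : ℕ+ => ⟪oneParticleClass f hf k, oneParticleClass g hg k⟫_ℂ := by
    funext k
    have h : ((√(k : ℝ) : ℝ) : ℂ) * ((√(k : ℝ) : ℝ) : ℂ) = (k : ℂ) := by
      rw [← Complex.ofReal_mul, Real.mul_self_sqrt (by positivity)]
      simp
    simp only [oneParticleClass, RCLike.inner_apply, map_mul, Complex.conj_ofReal]
    linear_combination (-((starRingEnd ℂ) (fourierCoef (angular f) ((k : ℕ) : ℤ)) *
      fourierCoef (angular g) ((k : ℕ) : ℤ))) * h
  rw [e]
  exact lp.hasSum_inner (𝕜 := ℂ) (oneParticleClass f hf) (oneParticleClass g hg)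

/-- The real trigonometric polynomial with coefficients `dₖ`, `k ∈ S`, at the positive modes. -/
def trigPoly (S : Finset ℕ+) (d : ℕ+ → ℂ) (z : Circle) : ℝ :=
  ∑ k ∈ S, 2 * (d k * (z : ℂ) ^ (k : ℕ)).re

theorem contMDiff_trigPoly (S : Finset ℕ+) (d : ℕ+ → ℂ) :
    ContMDiff (𝓡 1) 𝓘(ℝ, ℝ) ∞ (trigPoly S d) := by
  have : Fact (Module.finrank ℝ ℂ = 1 + 1) := ⟨Complex.finrank_real_complex⟩
  have h1 : ContMDiff (𝓡 1) 𝓘(ℝ, ℂ) ∞ (fun z : Circle => (z : ℂ)) := contMDiff_coe_sphere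
  have h2 : ContDiff ℝ ∞ (fun w : ℂ => ∑ k ∈ S, 2 * (d k * w ^ (k : ℕ)).re) := by
    refine ContDiff.sum fun k _ => contDiff_const.mul ?_
    exact Complex.reCLM.contDiff.comp (contDiff_const.mul (contDiff_id.pow _))
  exact h2.contMDiff.comp h1

theorem integral_exp_int (m : ℤ) :
    ∫ θ in (0 : ℝ)..(2 * Real.pi), Complex.exp (Complex.I * m * θ)
      = if m = 0 then (2 * Real.pi : ℂ) else 0 := by
  split_ifs with h
  · simp [h]
  · have hm : Complex.I * (m : ℂ) ≠ 0 := mul_ne_zero Complex.I_ne_zero (by exact_mod_cast h)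
    rw [integral_exp_mul_complex hm]
    have : Complex.exp (Complex.I * m * ((2 * Real.pi : ℝ) : ℂ)) = 1 := by
      rw [Complex.exp_eq_one_iff]
      exact ⟨m, by push_cast; ring⟩
    rw [this]
    simp

theorem fourierCoef_trigPoly (S : Finset ℕ+) (d : ℕ+ → ℂ) (j : ℤ) :
    fourierCoef (angular (trigPoly S d)) j = ∑ k ∈ S,
      ((if ((k : ℕ) : ℤ) - j = 0 then d k else 0)
        + if -((k : ℕ) : ℤ) - j = 0 then (starRingEnd ℂ) (d k) else 0) := by
  have h1 : ∀ θ : ℝ, Complex.exp (-(Complex.I * j * θ)) * (angular (trigPoly S d) θ : ℂ)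
      = ∑ k ∈ S, (d k * Complex.exp (Complex.I * ((((k : ℕ) : ℤ) - j : ℤ) : ℂ) * θ)
        + (starRingEnd ℂ) (d k) *
          Complex.exp (Complex.I * ((-((k : ℕ) : ℤ) - j : ℤ) : ℂ) * θ)) := by
    intro θ
    rw [angular, trigPoly, Complex.ofReal_sum, Finset.mul_sum]
    refine Finset.sum_congr rfl fun k _ => ?_
    have h2 : ((2 * (d k * (Circle.exp θ : ℂ) ^ (k : ℕ)).re : ℝ) : ℂ)
        = d k * Complex.exp (Complex.I * (k : ℕ) * θ)
          + (starRingEnd ℂ) (d k) * Complex.exp (-(Complex.I * (k : ℕ) * θ)) := by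
      have h3 : (Circle.exp θ : ℂ) ^ (k : ℕ) = Complex.exp (Complex.I * (k : ℕ) * θ) := by
        rw [Circle.coe_exp, ← Complex.exp_nat_mul]
        congr 1
        ring
      have h4 : Complex.exp (-(Complex.I * (k : ℕ) * θ))
          = (starRingEnd ℂ) (Complex.exp (Complex.I * (k : ℕ) * θ)) := by
        rw [← Complex.exp_conj]
        simp
      rw [h3, h4, ← map_mul, Complex.add_conj]
    rw [h2, mul_add, mul_left_comm, ← Complex.exp_add, mul_left_comm, ← Complex.exp_add]
    have e1 : -(Complex.I * j * θ) + Complex.I * (k : ℕ) * θ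
        = Complex.I * ((((k : ℕ) : ℤ) - j : ℤ) : ℂ) * θ := by
      push_cast
      ring
    have e2 : -(Complex.I * j * θ) + -(Complex.I * (k : ℕ) * θ)
        = Complex.I * ((-((k : ℕ) : ℤ) - j : ℤ) : ℂ) * θ := by
      push_cast
      ring
    rw [e1, e2]
  have hI : ∀ (c : ℂ) (m : ℤ), IntervalIntegrable
      (fun θ : ℝ => c * Complex.exp (Complex.I * m * θ)) MeasureTheory.volume 0
        (2 * Real.pi) := fun c m => Continuous.intervalIntegrable (by fun_prop) _ _
  have hpi : (Real.pi : ℂ) ≠ 0 := by exact_mod_cast Real.pi_ne_zero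
  rw [fourierCoef]
  simp only [h1]
  rw [intervalIntegral.integral_finsetSum fun k _ => (hI _ _).add (hI _ _), Finset.mul_sum]
  refine Finset.sum_congr rfl fun k _ => ?_
  rw [intervalIntegral.integral_add (hI _ _) (hI _ _), intervalIntegral.integral_const_mul,
    intervalIntegral.integral_const_mul, integral_exp_int, integral_exp_int]
  split_ifs <;> field_simp <;> simp

theorem memSobolev_trigPoly (S : Finset ℕ+) (d : ℕ+ → ℂ) (s : ℝ) :
    MemSobolev s (angular (trigPoly S d)) := by
  have hcont : Continuous (angular (trigPoly S d)) :=
    (contMDiff_trigPoly S d).continuous.comp Circle.exp.continuous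
  refine ⟨fun θ => ?_, ?_, ?_⟩
  · rw [angular, angular, Circle.exp_add, Circle.exp_two_pi, mul_one]
  · obtain ⟨C, hC⟩ := isCompact_Icc.exists_bound_of_continuousOn
      (hcont.continuousOn (s := Set.Icc (0 : ℝ) (2 * Real.pi)))
    refine MeasureTheory.MemLp.of_bound hcont.aestronglyMeasurable C ?_
    refine (MeasureTheory.ae_restrict_mem measurableSet_Ioc).mono fun θ hθ => ?_
    exact hC θ (Set.Ioc_subset_Icc_self hθ)
  · refine summable_of_ne_finset_zero (s := S.image (fun k : ℕ+ => ((k : ℕ) : ℤ)) ∪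
      S.image (fun k : ℕ+ => -((k : ℕ) : ℤ))) fun j hj => ?_
    rw [Finset.mem_union, not_or] at hj
    have : fourierCoef (angular (trigPoly S d)) j = 0 := by
      rw [fourierCoef_trigPoly]
      refine Finset.sum_eq_zero fun k hk => ?_
      rw [if_neg, if_neg, add_zero]
      · intro h
        exact hj.2 (Finset.mem_image.2 ⟨k, hk, by linarith⟩)
      · intro h
        exact hj.1 (Finset.mem_image.2 ⟨k, hk, by linarith⟩)
    rw [this]
    simp

/-- The classes of smooth functions are dense in `H₁`. -/
theorem dense_oneParticleClass :
    Dense {ξ : OneParticle | ∃ (f : Circle → ℝ) (hf : MemSobolev (1 / 2) (angular f)),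
      ContMDiff (𝓡 1) 𝓘(ℝ, ℝ) ∞ f ∧ oneParticleClass f hf = ξ} := by
  intro ξ
  refine mem_closure_of_tendsto (lp.hasSum_single (by norm_num) ξ)
    (Filter.Eventually.of_forall fun S => ?_)
  let d : ℕ+ → ℂ := fun k => ((√(k : ℝ) : ℝ) : ℂ)⁻¹ * ξ k
  refine ⟨trigPoly S d, memSobolev_trigPoly S d _, contMDiff_trigPoly S d, ?_⟩
  apply lp.ext
  funext k
  have h0 : ((√(k : ℝ) : ℝ) : ℂ) ≠ 0 := by
    have : (0 : ℝ) < k := by exact_mod_cast k.pos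
    exact_mod_cast (Real.sqrt_pos.2 this).ne'
  have h1 : fourierCoef (angular (trigPoly S d)) ((k : ℕ) : ℤ) = if k ∈ S then d k else 0 := by
    rw [fourierCoef_trigPoly, ← Finset.sum_ite_eq' S k d]
    refine Finset.sum_congr rfl fun l _ => ?_
    have hl := l.pos
    have hk := k.pos
    have h2 : ¬ (-((l : ℕ) : ℤ) - ((k : ℕ) : ℤ) = 0) := by omega
    have h3 : (((l : ℕ) : ℤ) - ((k : ℕ) : ℤ) = 0) ↔ l = k := by
      rw [← PNat.coe_inj]
      omega
    simp only [h2, h3, if_false, add_zero]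
  simp only [oneParticleClass, h1, lp.coeFn_sum, Finset.sum_apply, lp.single_apply, Pi.single_apply]
  rw [Finset.sum_ite_eq]
  split_ifs
  · simp only [d]
    rw [← mul_assoc, mul_inv_cancel₀ h0, one_mul]
  · simp

end CircleFock

end

open CircleFock

/-! Let `g` be a lift of γ and let T be the operator [f] ↦ [f ∘ g], so that V(γ) = T⁻¹. The
imaginary part of the scalar product is, up to a constant, the integral ∫ u dv over the circle. It
is therefore invariant under reparametrization, and T is symplectic. On the orthonormal basis, T is
given by the vectors aₖ = [e^{ikg}]/√k and bₖ = [e^{-ikg}]/√k, the latter forming its antilinear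
part. Invariance of the form yields ⟨aⱼ, aₖ⟩ = δⱼₖ + ⟨bₖ, bⱼ⟩, so ∑ ‖bₖ‖² < ∞ gives at once that T
is bounded and that its antilinear part is Hilbert-Schmidt.

Shale's theorem (`exists_unitary_of_symplectic`) then gives the implementer. Write V = A + B with A
linear and B antilinear. Then A is invertible, and θ = B A⁻¹ is symmetric, Hilbert-Schmidt and of
norm less than 1. The components of exp(θ a*a*/2) Ω are sums over pairings, and their norms are
summed by an induction on the degree (`sum_norm_sq_wick_le`). If Ψ is this vector normalized, then
⟨Ψ, W(Vξ)Ψ⟩ = ⟨Ω, W(ξ)Ω⟩ (`inner_weyl_gaussian`). Hence W(ξ)Ω ↦ W(Vξ)Ψ extends to an isometry, and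
irreducibility of the Weyl operators makes it unitary. Both the expectation and the irreducibility
are obtained from Liouville's theorem, applied to an entire h with h(-b) = conj h(b).

It remains to bound ∑ (l/k) |∫ e^{i(lθ + k g(θ))} dθ|² over l, k ≥ 1. As l and k are positive, the
phase has no stationary point, and one integration by parts should gain a factor k g''/(l + k g')².
To keep the amplitude independent of l and k, the denominator is expanded in a geometric series
about l + kM, where M is an upper bound of g'. Each term is summed over k by Bessel's inequality for
the functions e^{ikg}, which are orthogonal for the weight g'. The weight left over is at most 1/(M
l²), and the total is controlled by ∫ (g'')². Approximation by trigonometric polynomials extends the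
bound from C² to H². -/

noncomputable section

namespace CircleFock

/-! ### Weyl operators on exponential vectors -/

/-- The number `1 / √2`. -/
def rootHalf : ℂ := ((1 / √2 : ℝ) : ℂ)

theorem rootHalf_mul_self : rootHalf * rootHalf = 1 / 2 := sqrt_two_inv_sq

theorem conj_rootHalf : (starRingEnd ℂ) rootHalf = rootHalf := Complex.conj_ofReal _

theorem rootHalf_ne_zero : rootHalf ≠ 0 := by
  intro h
  have := rootHalf_mul_self
  rw [h] at this
  norm_num at this

theorem weyl_vacuum {ι : Type} (f : L2 ι) : weyl f (vacuum ι)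
    = Complex.exp (-((‖f‖ : ℂ) ^ 2 / 4)) • expVec (rootHalf • f) :=
  isFockWeyl_weyl.map_vacuum f

/-- Exponential vectors are multiples of coherent vectors, so the Weyl relation and the action on
the vacuum determine this. The phase and the cross term of ‖f + y‖² combine to ⟨f, y⟩, so the result
depends analytically on `x`. -/
theorem weyl_expVec {ι : Type} (f x : L2 ι) : weyl f (expVec x)
    = Complex.exp (-((‖f‖ : ℂ) ^ 2 / 4) - rootHalf * ⟪f, x⟫_ℂ) • expVec (x + rootHalf • f) := by
  obtain ⟨y, rfl⟩ : ∃ y, x = rootHalf • y :=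
    ⟨rootHalf⁻¹ • x, by rw [smul_smul, mul_inv_cancel₀ rootHalf_ne_zero, one_smul]⟩
  have h1 : expVec (rootHalf • y)
      = Complex.exp ((‖y‖ : ℂ) ^ 2 / 4) • weyl y (vacuum ι) := by
    rw [weyl_vacuum, smul_smul, ← Complex.exp_add, add_neg_cancel,
      Complex.exp_zero, one_smul]
  rw [h1, map_smul, ← mul_apply_eq_comp, isFockWeyl_weyl.map_mul, smul_apply,
    weyl_vacuum, smul_smul, smul_smul, ← Complex.exp_add, ← Complex.exp_add,
    ← smul_add, add_comm y f]
  congr 2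
  have h2 : (‖f + y‖ : ℂ) ^ 2 = (‖f‖ : ℂ) ^ 2 + 2 * ((⟪f, y⟫_ℂ).re : ℂ) + (‖y‖ : ℂ) ^ 2 := by
    have := @norm_add_sq ℂ _ _ _ _ f y
    exact_mod_cast this
  have h3 := Complex.re_add_im ⟪f, y⟫_ℂ
  rw [h2, inner_smul_right]
  linear_combination ⟪f, y⟫_ℂ * rootHalf_mul_self - (1 / 2 : ℂ) * h3

theorem star_weyl {ι : Type} (f : L2 ι) : star (weyl f) = weyl (-f) := by
  have hinv : weyl f * weyl (-f) = 1 := by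
    rw [isFockWeyl_weyl.map_mul, add_neg_cancel, isFockWeyl_weyl.map_zero]
    have : (⟪f, -f⟫_ℂ).im = 0 := by
      rw [inner_neg_right, Complex.neg_im, neg_eq_zero]
      exact inner_self_im (𝕜 := ℂ) f
    rw [this]
    simp
  calc star (weyl f) = star (weyl f) * (weyl f * weyl (-f)) := by rw [hinv, mul_one]
    _ = weyl (-f) := by
      rw [← mul_assoc, (Unitary.mem_iff.1 (isFockWeyl_weyl.mem_unitary f)).1, one_mul]

theorem inner_weyl_right {ι : Type} (f : L2 ι) (φ ψ : FockSpace ι) :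
    ⟪φ, weyl f ψ⟫_ℂ = ⟪weyl (-f) φ, ψ⟫_ℂ := by
  rw [← star_weyl, ContinuousLinearMap.star_eq_adjoint, ContinuousLinearMap.adjoint_inner_left]

theorem norm_weyl_apply {ι : Type} (f : L2 ι) (ψ : FockSpace ι) : ‖weyl f ψ‖ = ‖ψ‖ :=
  (ContinuousLinearMap.norm_map_iff_adjoint_comp_self (weyl f)).2
    (Unitary.mem_iff.1 (isFockWeyl_weyl.mem_unitary f)).1 ψ

/-- The exponential vectors are multiples of the coherent vectors `W(f) Ω`. -/
theorem expVec_eq_weyl {ι : Type} (x : L2 ι) : expVec x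
    = Complex.exp ((‖rootHalf⁻¹ • x‖ : ℂ) ^ 2 / 4) • weyl (rootHalf⁻¹ • x) (vacuum ι) := by
  rw [weyl_vacuum, smul_smul, ← Complex.exp_add, add_neg_cancel, Complex.exp_zero, one_smul,
    smul_smul, mul_inv_cancel₀ rootHalf_ne_zero, one_smul]

theorem dense_span_weyl_vacuum (ι : Type) :
    Dense (Submodule.span ℂ (Set.range fun f : L2 ι => weyl f (vacuum ι)) : Set (FockSpace ι)) := by
  refine (dense_span_expVec ι).mono ?_
  refine Submodule.span_le.2 ?_
  rintro _ ⟨x, rfl⟩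
  rw [expVec_eq_weyl]
  exact Submodule.smul_mem _ _ (Submodule.subset_span ⟨_, rfl⟩)

/-! ### Entire functions -/

/-- A locally bounded family of Fock space vectors whose inner products with the exponential
vectors are entire is weakly entire. -/
theorem differentiable_inner_of_expVec {ι : Type} {v : ℂ → FockSpace ι} {C : ℂ → ℝ}
    (hC : Continuous C) (hv : ∀ b, ‖v b‖ ≤ C b)
    (h : ∀ x, Differentiable ℂ fun b => ⟪expVec x, v b⟫_ℂ) (φ : FockSpace ι) :
    Differentiable ℂ fun b => ⟪φ, v b⟫_ℂ := by
  have hspan : ∀ φ ∈ Submodule.span ℂ (Set.range (expVec : L2 ι → FockSpace ι)),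
      Differentiable ℂ fun b => ⟪φ, v b⟫_ℂ := by
    intro φ hφ
    induction hφ using Submodule.span_induction with
    | mem x hx =>
      obtain ⟨y, rfl⟩ := hx
      exact h y
    | zero => simp
    | add x y _ _ hx hy =>
      simp only [inner_add_left]
      exact hx.add hy
    | smul c x _ hx =>
      simp only [inner_smul_left]
      exact hx.const_mul _
  -- The bound `C` makes convergence of the vectors `u n` to φ into locally uniform convergence of
  -- the functions, and this preserves holomorphy.
  obtain ⟨u, hu, hlim⟩ := mem_closure_iff_seq_limit.1 (dense_span_expVec ι φ)
  rw [← differentiableOn_univ]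
  refine TendstoLocallyUniformlyOn.differentiableOn (φ := Filter.atTop)
    (F := fun n b => ⟪u n, v b⟫_ℂ) ?_
    (Filter.Eventually.of_forall fun n => (hspan _ (hu n)).differentiableOn) isOpen_univ
  rw [tendstoLocallyUniformlyOn_iff_forall_isCompact isOpen_univ]
  intro K _ hK
  obtain ⟨D, hD⟩ := hK.exists_bound_of_continuousOn hC.continuousOn
  rw [Metric.tendstoUniformlyOn_iff]
  intro ε hε
  have hlim' : Filter.Tendsto (fun n => ‖φ - u n‖ * (|D| + 1)) Filter.atTop (nhds 0) := by
    have := ((tendsto_const_nhds (x := φ)).sub hlim).norm.mul_const (|D| + 1)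
    simpa using this
  filter_upwards [hlim'.eventually (gt_mem_nhds hε)] with n hn b hb
  rw [dist_eq_norm, ← inner_sub_left]
  refine (norm_inner_le_norm _ _).trans_lt (lt_of_le_of_lt ?_ hn)
  refine mul_le_mul_of_nonneg_left ?_ (norm_nonneg _)
  have h1 := hD b hb
  have h2 := hv b
  have h3 := le_abs_self (C b)
  have h4 := le_abs_self D
  rw [Real.norm_eq_abs] at h1
  linarith

/-- A real valued entire function is constant. -/
theorem eq_of_differentiable_of_im_eq_zero {h : ℂ → ℂ} (hd : Differentiable ℂ h)
    (him : ∀ b, (h b).im = 0) (a b : ℂ) : h a = h b := by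
  -- Liouville's theorem applies to e^{ih}, which has modulus one; then h' = 0 because the
  -- exponential has no zeros.
  have hE : Differentiable ℂ fun b => Complex.exp (Complex.I * h b) := (hd.const_mul _).cexp
  have hbd : Bornology.IsBounded (Set.range fun b => Complex.exp (Complex.I * h b)) := by
    refine (Metric.isBounded_closedBall (x := (0 : ℂ)) (r := 1)).subset ?_
    rintro _ ⟨b, rfl⟩
    simp [Complex.norm_exp, him]
  refine is_const_of_deriv_eq_zero hd (fun c => ?_) a b
  have h1 : deriv (fun b => Complex.exp (Complex.I * h b)) c = 0 := by
    have : (fun b => Complex.exp (Complex.I * h b)) = fun _ => Complex.exp (Complex.I * h c) :=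
      funext fun b => hE.apply_eq_apply_of_bounded hbd b c
    rw [this, deriv_const]
  have h2 := ((hd c).hasDerivAt.const_mul Complex.I).cexp.deriv
  rw [h1] at h2
  simpa using h2.symm

/-- An entire function with `h(-b) = h(b)^*` is constant. -/
theorem eq_of_differentiable_of_conj {h : ℂ → ℂ} (hd : Differentiable ℂ h)
    (hc : ∀ b, h (-b) = (starRingEnd ℂ) (h b)) (a b : ℂ) : h a = h b := by
  have hd' : Differentiable ℂ fun b => h (-b) := hd.comp differentiable_neg
  -- The functions h(b) + h(-b) = 2 Re h(b) and i(h(b) - h(-b)) = -2 Im h(b) are entire and real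
  -- valued.
  have h1 := eq_of_differentiable_of_im_eq_zero (hd.add hd') (fun b => by simp [hc]) a b
  have h2 := eq_of_differentiable_of_im_eq_zero ((hd.sub hd').const_mul Complex.I)
    (fun b => by simp [hc]) a b
  simp only [Pi.add_apply, Pi.sub_apply] at h1 h2
  have h3 := mul_left_cancel₀ Complex.I_ne_zero h2
  linear_combination (h1 + h3) / 2

/-! ### Irreducibility of the Fock representation -/

/-- A self-adjoint operator that commutes with all Weyl operators is a multiple of `1`. -/
theorem eq_smul_one_of_commute_weyl {ι : Type} {T : FockSpace ι →L[ℂ] FockSpace ι}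
    (hT : ∀ φ ψ, ⟪T φ, ψ⟫_ℂ = ⟪φ, T ψ⟫_ℂ) (hcomm : ∀ f, T * weyl f = weyl f * T) :
    ∃ c : ℂ, T = c • 1 := by
  have hcomm' : ∀ f ψ, T (weyl f ψ) = weyl f (T ψ) := fun f ψ =>
    DFunLike.congr_fun (hcomm f) ψ
  -- Along the complex line b ↦ bx this expectation is entire. Since `T` is self-adjoint and
  -- commutes with the Weyl operators, the change b ↦ -b conjugates it, so it is constant.
  have key : ∀ x : L2 ι, ⟪vacuum ι, T (expVec x)⟫_ℂ = ⟪vacuum ι, T (vacuum ι)⟫_ℂ := by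
    intro x
    set h : ℂ → ℂ := fun b => ⟪T (vacuum ι), expVec (b • x)⟫_ℂ with hh
    have hn : ∀ b : ℂ, ‖expVec (b • x)‖ ≤ Real.exp (‖b • x‖ ^ 2 / 2) := by
      intro b
      rw [← sq_le_sq₀ (norm_nonneg _) (Real.exp_nonneg _), ← Real.exp_nat_mul,
        @norm_sq_eq_re_inner ℂ, inner_expVec, inner_self_eq_norm_sq_to_K]
      have : ((2 : ℕ) : ℝ) * (‖b • x‖ ^ 2 / 2) = ‖b • x‖ ^ 2 := by push_cast; ring
      rw [this]
      have h2 : Complex.exp ((RCLike.ofReal ‖b • x‖ : ℂ) ^ 2)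
          = ((Real.exp (‖b • x‖ ^ 2) : ℝ) : ℂ) := by
        push_cast
        rfl
      rw [h2]
      exact le_of_eq (Complex.ofReal_re _)
    have hd : Differentiable ℂ h := by
      refine differentiable_inner_of_expVec (v := fun b => expVec (b • x))
        (C := fun b => Real.exp (‖b • x‖ ^ 2 / 2)) (by fun_prop) hn (fun y => ?_) _
      simp only [inner_expVec, inner_smul_right]
      fun_prop
    have hc : ∀ b, h (-b) = (starRingEnd ℂ) (h b) := by
      intro b
      have e : ∀ b : ℂ, h b = Complex.exp ((‖rootHalf⁻¹ • b • x‖ : ℂ) ^ 2 / 4) *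
          ⟪vacuum ι, weyl (rootHalf⁻¹ • b • x) (T (vacuum ι))⟫_ℂ := by
        intro b
        rw [hh]
        simp only
        rw [expVec_eq_weyl, inner_smul_right, hT, hcomm']
      rw [e, e, map_mul, ← Complex.exp_conj, inner_conj_symm, inner_weyl_right,
        ← hcomm', hT]
      simp only [neg_smul, smul_neg, norm_neg, neg_neg, map_div₀, map_pow, Complex.conj_ofReal,
        Complex.conj_ofNat]
    have h1 := eq_of_differentiable_of_conj hd hc 1 0
    simp only [hh, one_smul, zero_smul, hT] at h1
    exact h1
  refine ⟨⟪vacuum ι, T (vacuum ι)⟫_ℂ, ?_⟩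
  have hvac : ∀ x : L2 ι, ⟪vacuum ι, expVec x⟫_ℂ = 1 := by
    intro x
    rw [vacuum, inner_expVec, inner_zero_left, Complex.exp_zero]
  apply ext_of_expVec
  intro x
  -- Tested against W(f)Ω, the operator W(-f) passes through `T` and turns `expVec x` into a
  -- multiple of another exponential vector, to which `key` applies.
  refine (dense_span_weyl_vacuum ι).eq_of_inner_right ℂ fun v hv => ?_
  induction hv using Submodule.span_induction with
  | zero => simp
  | add y z hy1 hz1 hy hz => rw [inner_add_left, inner_add_left, hy, hz]
  | smul c y hy1 hy => rw [inner_smul_left, inner_smul_left, hy]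
  | mem y hy =>
    obtain ⟨f, rfl⟩ := hy
    have e : ∀ ψ : FockSpace ι, ⟪weyl f (vacuum ι), ψ⟫_ℂ = ⟪vacuum ι, weyl (-f) ψ⟫_ℂ := by
      intro ψ
      rw [inner_weyl_right, neg_neg]
    simp only [e, ← hcomm', weyl_expVec, map_smul, inner_smul_right, key, smul_apply,
      one_apply_eq_self, hvac]
    ring

/-! ### Sums over pairings -/

/-- The sum over all perfect pairings of the finite set `A` of the products of the `L a b` over the
pairs `{a, b}` (the hafnian of `L` on `A`). -/
def hafnian {α : Type} [DecidableEq α] (L : α → α → ℂ) (A : Finset α) : ℂ :=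
  if h : A.Nonempty then
    ∑ a ∈ (A.erase h.choose).attach, L h.choose a * hafnian L ((A.erase h.choose).erase a)
  else 1
termination_by A.card
decreasing_by
  exact ((Finset.card_erase_lt_of_mem a.2).trans (Finset.card_erase_lt_of_mem h.choose_spec))

theorem hafnian_empty {α : Type} [DecidableEq α] (L : α → α → ℂ) : hafnian L ∅ = 1 := by
  rw [hafnian]
  simp

/-- Expansion of the hafnian along an arbitrary element. -/
theorem hafnian_eq {α : Type} [DecidableEq α] {L : α → α → ℂ} (hL : ∀ a b, L a b = L b a)
    {A : Finset α} {p : α} (hp : p ∈ A) :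
    hafnian L A = ∑ a ∈ A.erase p, L p a * hafnian L ((A.erase p).erase a) := by
  induction A using Finset.strongInduction generalizing p with
  | H A ih =>
    have hne : A.Nonempty := ⟨p, hp⟩
    have h0 : hafnian L A = ∑ a ∈ A.erase hne.choose,
        L hne.choose a * hafnian L ((A.erase hne.choose).erase a) := by
      rw [hafnian, dif_pos hne]
      exact Finset.sum_attach (A.erase hne.choose)
        (fun a => L hne.choose a * hafnian L ((A.erase hne.choose).erase a))
    set m := hne.choose with hm
    have hmA : m ∈ A := hne.choose_spec
    rw [h0]
    by_cases hpm : p = m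
    · rw [hpm]
    -- Expanding along `x` and then along `y` gives the term where the two are paired, plus a double
    -- sum over their distinct partners `a` and `b`. Both are symmetric in `x` and `y`.
    have hsplit : ∀ x y : α, x ∈ A → y ∈ A → x ≠ y →
        ∑ a ∈ A.erase x, L x a * hafnian L ((A.erase x).erase a)
          = L x y * hafnian L ((A.erase x).erase y) + ∑ a ∈ (A.erase x).erase y,
            ∑ b ∈ ((A.erase x).erase y).erase a, L x a * (L y b *
              hafnian L ((((A.erase x).erase y).erase a).erase b)) := by
      intro x y hx hy hxy
      have hy' : y ∈ A.erase x := Finset.mem_erase.2 ⟨hxy.symm, hy⟩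
      rw [← Finset.add_sum_erase _ _ hy']
      congr 1
      refine Finset.sum_congr rfl fun a ha => ?_
      have ha' := Finset.mem_erase.1 ha
      have hya : y ∈ (A.erase x).erase a := Finset.mem_erase.2 ⟨ha'.1.symm, hy'⟩
      rw [ih _ ((Finset.erase_ssubset ha'.2).trans (Finset.erase_ssubset hx)) hya,
        Finset.mul_sum, Finset.erase_right_comm (a := a) (b := y)]
    rw [hsplit m p hmA hp (Ne.symm hpm), hsplit p m hp hmA hpm, hL m p,
      Finset.erase_right_comm (a := p) (b := m)]
    congr 1
    rw [Finset.sum_comm' (t' := (A.erase m).erase p)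
      (s' := fun b => ((A.erase m).erase p).erase b)]
    · refine Finset.sum_congr rfl fun b _ => Finset.sum_congr rfl fun a _ => ?_
      rw [Finset.erase_right_comm (a := a) (b := b)]
      ring
    · intro a b
      simp only [Finset.mem_erase]
      tauto

/-- The definition expands along a chosen element, and the choices on the two sides need not
correspond. Expansion along an arbitrary element removes this dependence. -/
theorem hafnian_map {α β : Type} [DecidableEq α] [DecidableEq β] {L : β → β → ℂ}
    (hL : ∀ a b, L a b = L b a) (f : α ↪ β) (A : Finset α) :
    hafnian L (A.map f) = hafnian (fun a b => L (f a) (f b)) A := by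
  induction A using Finset.strongInduction with
  | H A ih =>
    rcases A.eq_empty_or_nonempty with rfl | ⟨p, hp⟩
    · simp [hafnian_empty]
    · rw [hafnian_eq hL (Finset.mem_map_of_mem f hp), hafnian_eq (fun a b => hL _ _) hp,
        ← Finset.map_erase, Finset.sum_map]
      refine Finset.sum_congr rfl fun a ha => ?_
      rw [← Finset.map_erase, ih _ ((Finset.erase_ssubset ha).trans (Finset.erase_ssubset hp))]

/-- The `n`-th moment tensor of the Gaussian with covariance `K`. -/
def wick {ι : Type} (K : ι → ι → ℂ) (n : ℕ) (v : Fin n → ι) : ℂ :=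
  hafnian (fun a b => K (v a) (v b)) Finset.univ

section Wick

variable {ι : Type} {K : ι → ι → ℂ}

theorem wick_zero (v : Fin 0 → ι) : wick K 0 v = 1 := by
  rw [wick, Finset.univ_eq_empty, hafnian_empty]

theorem wick_comp_embedding (hK : ∀ i j, K i j = K j i) {n : ℕ} {α : Type} [DecidableEq α]
    (u : α → ι) (f : Fin n ↪ α) :
    wick K n (u ∘ f) = hafnian (fun a b => K (u a) (u b)) (Finset.univ.map f) :=
  (hafnian_map (L := fun a b => K (u a) (u b)) (fun _ _ => hK _ _) f _).symm

theorem wick_comp_perm (hK : ∀ i j, K i j = K j i) {n : ℕ} (v : Fin n → ι)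
    (σ : Equiv.Perm (Fin n)) : wick K n (v ∘ σ) = wick K n v := by
  have := wick_comp_embedding hK v σ.toEmbedding
  rw [Finset.map_univ_equiv] at this
  exact this

theorem wick_cons (hK : ∀ i j, K i j = K j i) {n : ℕ} (i : ι) (u : Fin (n + 1) → ι) :
    wick K (n + 2) (Fin.cons i u)
      = ∑ a, K i (u a) * hafnian (fun b c => K (u b) (u c)) (Finset.univ.erase a) := by
  have h1 : (Finset.univ : Finset (Fin (n + 2))).erase 0
      = Finset.univ.map (Fin.succEmb (n + 1)) := by
    ext x
    cases x using Fin.cases <;> simp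
  rw [wick, hafnian_eq (fun _ _ => hK _ _) (Finset.mem_univ 0), h1, Finset.sum_map]
  refine Finset.sum_congr rfl fun a _ => ?_
  rw [← Finset.map_erase, hafnian_map (fun _ _ => hK _ _)]
  simp

theorem hafnian_univ_erase (hK : ∀ i j, K i j = K j i) {n : ℕ} (u : Fin (n + 1) → ι)
    (a : Fin (n + 1)) : hafnian (fun b c => K (u b) (u c)) (Finset.univ.erase a)
      = wick K n (fun j => u (a.succAbove j)) := by
  have h1 : (Finset.univ : Finset (Fin (n + 1))).erase a = Finset.univ.map a.succAboveEmb := by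
    ext x
    rw [Finset.mem_map]
    constructor
    · intro h
      obtain ⟨y, hy⟩ := Fin.exists_succAbove_eq (Finset.mem_erase.1 h).1
      exact ⟨y, Finset.mem_univ _, hy⟩
    · rintro ⟨y, _, rfl⟩
      exact Finset.mem_erase.2 ⟨Fin.succAbove_ne a y, Finset.mem_univ _⟩
  rw [h1]
  exact (wick_comp_embedding hK u a.succAboveEmb).symm

theorem wick_one (hK : ∀ i j, K i j = K j i) (v : Fin 1 → ι) : wick K 1 v = 0 := by
  rw [wick, hafnian_eq (fun _ _ => hK _ _) (Finset.mem_univ 0)]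
  simp

theorem hafnian_erase_perm (hK : ∀ i j, K i j = K j i) {n : ℕ} (u : Fin n → ι) (a : Fin n)
    (τ : Equiv.Perm (Fin n)) :
    hafnian (fun b c => K (u b) (u c)) (Finset.univ.erase (τ a))
      = hafnian (fun b c => K (u (τ b)) (u (τ c))) (Finset.univ.erase a) := by
  have h := hafnian_map (L := fun b c => K (u b) (u c)) (fun _ _ => hK _ _) τ.toEmbedding
    (Finset.univ.erase a)
  rw [Finset.map_erase, Finset.map_univ_equiv] at h
  exact h

/-- The estimate of the moment tensors by induction on the degree. -/
theorem sum_norm_sq_wick_le [Fintype ι] (hK : ∀ i j, K i j = K j i) {h κ : ℝ}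
    (hh : ∑ i, ∑ j, ‖K i j‖ ^ 2 ≤ h)
    (hκ : ∀ y : ι → ℂ, ∑ i, ‖∑ j, K i j * y j‖ ^ 2 ≤ κ * ∑ j, ‖y j‖ ^ 2) (n : ℕ) :
    ∑ v : Fin (n + 2) → ι, ‖wick K (n + 2) v‖ ^ 2
      ≤ (n + 1) * (h + n * κ) * ∑ v : Fin n → ι, ‖wick K n v‖ ^ 2 := by
  set S := ∑ v : Fin n → ι, ‖wick K n v‖ ^ 2 with hS
  have hS0 : 0 ≤ S := by positivity
  let t : ι → Fin (n + 1) → (Fin (n + 1) → ι) → ℂ := fun i a u =>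
    K i (u a) * hafnian (fun b c => K (u b) (u c)) (Finset.univ.erase a)
  -- In `t i a u` the first index is paired with position `a`. `F` is the Gram matrix of these n + 1
  -- terms, and the sum of its entries is the squared norm to be bounded.
  let F : Fin (n + 1) → Fin (n + 1) → ℂ := fun a b =>
    ∑ i, ∑ u, (starRingEnd ℂ) (t i a u) * t i b u
  have htot : ((∑ v : Fin (n + 2) → ι, ‖wick K (n + 2) v‖ ^ 2 : ℝ) : ℂ)
      = ∑ a, ∑ b, F a b := by
    rw [← (Fin.consEquiv (fun _ : Fin (n + 2) => ι)).sum_comp, Fintype.sum_prod_type]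
    have e : ∀ (i : ι) (u : Fin (n + 1) → ι),
        ((‖wick K (n + 2) (Fin.consEquiv (fun _ : Fin (n + 2) => ι) (i, u))‖ ^ 2 : ℝ) : ℂ)
          = ∑ a, ∑ b, (starRingEnd ℂ) (t i a u) * t i b u := by
      intro i u
      have : wick K (n + 2) (Fin.consEquiv (fun _ : Fin (n + 2) => ι) (i, u)) = ∑ a, t i a u :=
        wick_cons hK i u
      rw [this, Complex.ofReal_pow, ← Complex.conj_mul', map_sum, Finset.sum_mul_sum]
    simp only [Complex.ofReal_sum, e]
    rw [Finset.sum_congr rfl fun i _ => Finset.sum_comm, Finset.sum_comm]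
    refine Finset.sum_congr rfl fun a _ => ?_
    rw [Finset.sum_congr rfl fun i _ => Finset.sum_comm, Finset.sum_comm]
  -- By symmetry `F` has only one diagonal value, given by the Hilbert-Schmidt norm of `K`, and one
  -- off-diagonal value, controlled by its operator norm.
  have hperm : ∀ (a b : Fin (n + 1)) (τ : Equiv.Perm (Fin (n + 1))), F (τ a) (τ b) = F a b := by
    intro a b τ
    refine Finset.sum_congr rfl fun i _ => ?_
    rw [← (τ.arrowCongr (Equiv.refl ι)).sum_comp]
    refine Finset.sum_congr rfl fun u _ => ?_
    simp only [t]
    rw [hafnian_erase_perm hK, hafnian_erase_perm hK]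
    simp [Equiv.arrowCongr]
  have hdiag : ∀ a, F a a = F 0 0 := by
    intro a
    have := hperm 0 0 (Equiv.swap 0 a)
    rwa [Equiv.swap_apply_left] at this
  have h00 : F 0 0 = ((∑ i, ∑ j, ‖K i j‖ ^ 2) * S : ℝ) := by
    simp only [F]
    rw [Finset.sum_mul, Complex.ofReal_sum]
    refine Finset.sum_congr rfl fun i _ => ?_
    rw [← (Fin.consEquiv (fun _ : Fin (n + 1) => ι)).sum_comp, Fintype.sum_prod_type, hS,
      Finset.sum_mul_sum, Complex.ofReal_sum]
    refine Finset.sum_congr rfl fun j _ => ?_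
    rw [Complex.ofReal_sum]
    refine Finset.sum_congr rfl fun w _ => ?_
    simp only [t, hafnian_univ_erase hK, Fin.consEquiv_apply, Fin.cons_zero, Fin.succAbove_zero,
      Fin.cons_succ]
    rw [Complex.conj_mul', norm_mul]
    push_cast
    ring
  obtain _ | m := n
  · have h1 : ((∑ v : Fin 2 → ι, ‖wick K 2 v‖ ^ 2 : ℝ) : ℂ)
        = ((∑ i, ∑ j, ‖K i j‖ ^ 2) * S : ℝ) := by
      rw [htot, Fin.sum_univ_one, Fin.sum_univ_one]
      exact h00
    have h2 := Complex.ofReal_injective h1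
    simp only [Nat.reduceAdd, Nat.cast_zero, zero_add, zero_mul, add_zero, one_mul] at *
    rw [h2]
    exact mul_le_mul_of_nonneg_right hh hS0
  -- In an off-diagonal entry the two factors `K` share their first index, and each is contracted
  -- with the moment tensor of the other term. The entry is thus the squared norm of `K` applied in
  -- one slot of the conjugate tensor, which `hκ` bounds.
  · set G := ∑ i, ∑ w : Fin m → ι,
      ‖∑ j, K i j * (starRingEnd ℂ) (wick K (m + 1) (Fin.cons j w))‖ ^ 2 with hG
    have hoff : ∀ a b, a ≠ b → F a b = F 0 1 := by
      intro a b hab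
      have h01 : (0 : Fin (m + 1 + 1)) ≠ 1 := by simp
      have hc : (0 : Fin (m + 1 + 1)) ≠ Equiv.swap 0 a b := by
        intro h
        have := congrArg (Equiv.swap 0 a) h
        rw [Equiv.swap_apply_left, Equiv.swap_apply_self] at this
        exact hab this
      have := hperm 0 1 (Equiv.swap 0 a * Equiv.swap 1 (Equiv.swap 0 a b))
      rw [Equiv.Perm.mul_apply, Equiv.Perm.mul_apply, Equiv.swap_apply_left,
        Equiv.swap_apply_self, Equiv.swap_apply_of_ne_of_ne h01 hc,
        Equiv.swap_apply_left] at this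
      exact this
    have h01 : F 0 1 = (G : ℝ) := by
      simp only [F]
      rw [hG, Complex.ofReal_sum]
      refine Finset.sum_congr rfl fun i _ => ?_
      rw [← (Fin.consEquiv (fun _ : Fin (m + 1 + 1) => ι)).sum_comp, Fintype.sum_prod_type,
        Finset.sum_congr rfl fun j _ =>
          ((Fin.consEquiv (fun _ : Fin (m + 1) => ι)).sum_comp _).symm,
        Finset.sum_congr rfl fun j _ => Fintype.sum_prod_type _]
      rw [Finset.sum_congr rfl fun j _ => Finset.sum_comm, Finset.sum_comm, Complex.ofReal_sum]
      refine Finset.sum_congr rfl fun w _ => ?_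
      rw [Complex.ofReal_pow, ← Complex.conj_mul', map_sum, Finset.sum_mul_sum]
      refine Finset.sum_congr rfl fun j _ => Finset.sum_congr rfl fun k _ => ?_
      have e0 : (fun l => (Fin.cons j (Fin.cons k w : Fin (m + 1) → ι) : Fin (m + 1 + 1) → ι)
          ((0 : Fin (m + 1 + 1)).succAbove l)) = Fin.cons k w := by
        funext l
        simp
      have e1 : (fun l => (Fin.cons j (Fin.cons k w : Fin (m + 1) → ι) : Fin (m + 1 + 1) → ι)
          ((1 : Fin (m + 1 + 1)).succAbove l)) = Fin.cons j w := by
        funext l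
        cases l using Fin.cases with
        | zero => simp
        | succ l =>
          have : (1 : Fin (m + 1 + 1)).succAbove l.succ = l.succ.succ := by
            rw [← Fin.succ_zero_eq_one, Fin.succ_succAbove_succ, Fin.succAbove_zero]
          rw [this]
          simp
      have e3 : ∀ (l : ℕ) (a : ι) (x : Fin l → ι),
          Fin.consEquiv (fun _ : Fin (l + 1) => ι) (a, x) = Fin.cons a x := fun _ _ _ => rfl
      simp only [t, hafnian_univ_erase hK, e3, e0, e1, map_mul, Complex.conj_conj, Fin.cons_zero]
      have e2 : (Fin.cons j (Fin.cons k w : Fin (m + 1) → ι) : Fin (m + 1 + 1) → ι) 1 = k := by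
        rw [← Fin.succ_zero_eq_one, Fin.cons_succ, Fin.cons_zero]
      rw [e2]
      ring
    have hGle : G ≤ κ * S := by
      have hS' : S = ∑ w : Fin m → ι, ∑ j, ‖wick K (m + 1) (Fin.cons j w)‖ ^ 2 := by
        rw [hS, ← (Fin.consEquiv (fun _ : Fin (m + 1) => ι)).sum_comp,
          Fintype.sum_prod_type, Finset.sum_comm]
        rfl
      rw [hG, Finset.sum_comm, hS', Finset.mul_sum]
      refine Finset.sum_le_sum fun w _ => ?_
      simpa using hκ (fun j => (starRingEnd ℂ) (wick K (m + 1) (Fin.cons j w)))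
    have hsum : ∑ a, ∑ b, F a b = ((m + 2) * ((∑ i, ∑ j, ‖K i j‖ ^ 2) * S + (m + 1) * G) : ℝ) := by
      have : ∀ a, ∑ b, F a b = F 0 0 + (m + 1) * F 0 1 := by
        intro a
        rw [← Finset.add_sum_erase _ _ (Finset.mem_univ a), hdiag a,
          Finset.sum_congr rfl fun b hb => hoff a b (Finset.mem_erase.1 hb).1.symm]
        simp [Finset.card_erase_of_mem]
      rw [Finset.sum_congr rfl fun a _ => this a, h00, h01]
      simp
      ring
    have h2 := Complex.ofReal_injective (htot.trans hsum)
    rw [h2]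
    push_cast
    have h3 : (∑ i, ∑ j, ‖K i j‖ ^ 2) * S ≤ h * S := mul_le_mul_of_nonneg_right hh hS0
    have h4 : ((m : ℝ) + 1) * G ≤ (m + 1) * (κ * S) :=
      mul_le_mul_of_nonneg_left hGle (by positivity)
    have h5 : (0 : ℝ) ≤ (m : ℝ) + 2 := by positivity
    calc ((m : ℝ) + 2) * ((∑ i, ∑ j, ‖K i j‖ ^ 2) * S + (m + 1) * G)
        ≤ (m + 2) * (h * S + (m + 1) * (κ * S)) :=
          mul_le_mul_of_nonneg_left (add_le_add h3 h4) h5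
      _ = _ := by ring

end Wick

/-! ### Gaussian vectors in the Fock space -/

/-- The bounds `∏ (h + m κ) / (m + 2)`, `m = 0, 2, 4, …, n - 2`, of the norms of the components of
a Gaussian vector. -/
def gaussianBound (h κ : ℝ) : ℕ → ℝ
  | 0 => 1
  | 1 => 0
  | n + 2 => (h + n * κ) / (n + 2) * gaussianBound h κ n

theorem gaussianBound_odd (h κ : ℝ) (k : ℕ) : gaussianBound h κ (2 * k + 1) = 0 := by
  induction k with
  | zero => rfl
  | succ k ih =>
    have : 2 * (k + 1) + 1 = (2 * k + 1) + 2 := by ring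
    rw [this, gaussianBound, ih, mul_zero]

/-- The ratio (h + 2kκ)/(2k + 2) of successive even terms tends to κ < 1, hence is eventually at
most (1 + κ)/2. This is where the operator norm has to be less than one; the Hilbert-Schmidt bound
`h` may be large. -/
theorem summable_gaussianBound {h κ : ℝ} (hh : 0 ≤ h) (hκ : 0 ≤ κ) (hκ1 : κ < 1) :
    Summable (gaussianBound h κ) := by
  have he : Summable fun k => gaussianBound h κ (2 * k) := by
    refine summable_of_ratio_norm_eventually_le (r := (1 + κ) / 2) (by linarith) ?_
    filter_upwards [Filter.eventually_ge_atTop ⌈h / (1 - κ)⌉₊] with k hk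
    have h1 : h ≤ (1 - κ) * k := by
      have := (Nat.ceil_le.1 hk)
      rwa [div_le_iff₀' (by linarith)] at this
    have h2 : 2 * (k + 1) = 2 * k + 2 := by ring
    rw [h2, gaussianBound, norm_mul]
    refine mul_le_mul_of_nonneg_right ?_ (norm_nonneg _)
    have h3 : (0 : ℝ) ≤ ((2 * k : ℕ) : ℝ) := by positivity
    rw [Real.norm_of_nonneg (by positivity), div_le_iff₀ (by linarith)]
    push_cast
    nlinarith
  have ho : Summable fun k => gaussianBound h κ (2 * k + 1) := by
    simp only [gaussianBound_odd]
    exact summable_zero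
  exact (he.hasSum.even_add_odd ho.hasSum).summable

theorem sum_wick_le_gaussianBound {ι : Type} [Fintype ι] {K : ι → ι → ℂ}
    (hK : ∀ i j, K i j = K j i) {h κ : ℝ} (hh0 : 0 ≤ h) (hκ0 : 0 ≤ κ)
    (hh : ∑ i, ∑ j, ‖K i j‖ ^ 2 ≤ h)
    (hκ : ∀ y : ι → ℂ, ∑ i, ‖∑ j, K i j * y j‖ ^ 2 ≤ κ * ∑ j, ‖y j‖ ^ 2) :
    ∀ n, ∑ v : Fin n → ι, ‖wick K n v‖ ^ 2 ≤ n.factorial * gaussianBound h κ n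
  | 0 => by simp [wick_zero, gaussianBound]
  | 1 => by simp [wick_one hK, gaussianBound]
  | n + 2 => by
    refine (sum_norm_sq_wick_le hK hh hκ n).trans ?_
    refine (mul_le_mul_of_nonneg_left (sum_wick_le_gaussianBound hK hh0 hκ0 hh hκ n)
      (by positivity)).trans (le_of_eq ?_)
    rw [gaussianBound, Nat.factorial_succ, Nat.factorial_succ]
    have : (n : ℝ) + 2 ≠ 0 := by positivity
    field_simp
    push_cast
    ring

/-! ### Moment tensors and Gaussian vectors over an arbitrary index set -/

section Infinite

variable {ι : Type} {K : ι → ι → ℂ}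

/-- Finitely many tuples involve finitely many indices, so the estimate over a finite index set
applies to the truncation of `K` to these. -/
theorem sum_wick_le (hK : ∀ i j, K i j = K j i) {h κ : ℝ} (hh0 : 0 ≤ h) (hκ0 : 0 ≤ κ)
    (hh : ∀ S : Finset ι, ∑ i ∈ S, ∑ j ∈ S, ‖K i j‖ ^ 2 ≤ h)
    (hκ : ∀ (S : Finset ι) (y : ι → ℂ),
      ∑ i ∈ S, ‖∑ j ∈ S, K i j * y j‖ ^ 2 ≤ κ * ∑ j ∈ S, ‖y j‖ ^ 2)
    (n : ℕ) (U : Finset (Fin n → ι)) :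
    ∑ v ∈ U, ‖wick K n v‖ ^ 2 ≤ n.factorial * gaussianBound h κ n := by
  classical
  set S : Finset ι := U.biUnion fun v => Finset.univ.image v with hS
  have hmem : ∀ v ∈ U, ∀ j, v j ∈ S := fun v hv j =>
    Finset.mem_biUnion.2 ⟨v, hv, Finset.mem_image_of_mem _ (Finset.mem_univ j)⟩
  have h1 : ∑ v ∈ U, ‖wick K n v‖ ^ 2
      ≤ ∑ w : Fin n → S, ‖wick (fun a b : S => K a b) n w‖ ^ 2 := by
    have e : ∀ w : Fin n → S, wick (fun a b : S => K a b) n w = wick K n (fun j => w j) :=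
      fun w => rfl
    simp only [e]
    rw [← Finset.sum_image (s := Finset.univ) (g := fun (w : Fin n → S) j => (w j : ι))
      (f := fun v => ‖wick K n v‖ ^ 2)
      (fun x _ y _ hxy => funext fun j => Subtype.ext (congrFun hxy j))]
    refine Finset.sum_le_sum_of_subset_of_nonneg (fun v hv => ?_) fun _ _ _ => by positivity
    exact Finset.mem_image.2 ⟨fun j => ⟨v j, hmem v hv j⟩, Finset.mem_univ _, rfl⟩
  refine h1.trans (sum_wick_le_gaussianBound (K := fun a b : S => K a b) (fun i j => hK i j) hh0 hκ0 ?_ (fun y => ?_) n)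
  · rw [Finset.sum_coe_sort S (fun i => ∑ j : S, ‖K i j‖ ^ 2)]
    refine le_trans (le_of_eq (Finset.sum_congr rfl fun i _ => ?_)) (hh S)
    exact Finset.sum_coe_sort S (fun j => ‖K i j‖ ^ 2)
  · let y' : ι → ℂ := fun i => if hi : i ∈ S then y ⟨i, hi⟩ else 0
    have hy' : ∀ i : S, y' i = y i := fun i => by simp [y']
    have := hκ S y'
    rw [← Finset.sum_coe_sort S, ← Finset.sum_coe_sort S (fun j => ‖y' j‖ ^ 2)] at this
    simp only [hy'] at this
    refine le_trans (le_of_eq (Finset.sum_congr rfl fun i _ => ?_)) this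
    rw [← Finset.sum_coe_sort S]
    simp only [hy']

theorem memℓp_wick (hK : ∀ i j, K i j = K j i) {h κ : ℝ} (hh0 : 0 ≤ h) (hκ0 : 0 ≤ κ) (hκ1 : κ < 1)
    (hh : ∀ S : Finset ι, ∑ i ∈ S, ∑ j ∈ S, ‖K i j‖ ^ 2 ≤ h)
    (hκ : ∀ (S : Finset ι) (y : ι → ℂ),
      ∑ i ∈ S, ‖∑ j ∈ S, K i j * y j‖ ^ 2 ≤ κ * ∑ j ∈ S, ‖y j‖ ^ 2) :
    Memℓp (fun p : Σ n : ℕ, Fin n → ι =>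
      wick K p.1 p.2 / ((√(p.1.factorial : ℝ) : ℝ) : ℂ)) 2 := by
  refine memℓp_gen ?_
  have e : ∀ p : Σ n : ℕ, Fin n → ι,
      ‖wick K p.1 p.2 / ((√(p.1.factorial : ℝ) : ℝ) : ℂ)‖ ^ (2 : ENNReal).toReal
        = ‖wick K p.1 p.2‖ ^ 2 / p.1.factorial := by
    intro p
    rw [ENNReal.toReal_ofNat, Real.rpow_ofNat, norm_div, div_pow, Complex.norm_real,
      Real.norm_eq_abs, sq_abs, Real.sq_sqrt (by positivity)]
  simp only [e]
  have hb : ∀ (n : ℕ) (U : Finset (Fin n → ι)),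
      ∑ v ∈ U, ‖wick K n v‖ ^ 2 / n.factorial ≤ gaussianBound h κ n := by
    intro n U
    rw [← Finset.sum_div, div_le_iff₀' (by positivity)]
    exact sum_wick_le hK hh0 hκ0 hh hκ n U
  have hs : ∀ n : ℕ, Summable fun v : Fin n → ι => ‖wick K n v‖ ^ 2 / n.factorial := fun n =>
    summable_of_sum_le (fun _ => by positivity) (hb n)
  rw [summable_sigma_of_nonneg (fun _ => by positivity)]
  refine ⟨hs, ?_⟩
  refine (summable_gaussianBound hh0 hκ0 hκ1).of_nonneg_of_le
    (fun n => tsum_nonneg fun _ => by positivity) fun n => ?_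
  exact Real.tsum_le_of_sum_le (fun _ => by positivity) (hb n)

/-- The moments of a Gaussian with variance `q`. -/
def gaussianMoment (q : ℂ) : ℕ → ℂ
  | 0 => 1
  | 1 => 0
  | n + 2 => (n + 1) * q * gaussianMoment q n

theorem gaussianMoment_odd (q : ℂ) (k : ℕ) : gaussianMoment q (2 * k + 1) = 0 := by
  induction k with
  | zero => rfl
  | succ k ih =>
    have : 2 * (k + 1) + 1 = (2 * k + 1) + 2 := by ring
    rw [this, gaussianMoment, ih, mul_zero]

theorem gaussianMoment_even (q : ℂ) (k : ℕ) :
    gaussianMoment q (2 * k) / (2 * k).factorial = (q / 2) ^ k / k.factorial := by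
  induction k with
  | zero => simp [gaussianMoment]
  | succ k ih =>
    have h1 : 2 * (k + 1) = 2 * k + 2 := by ring
    have h2 : ((2 * k).factorial : ℂ) ≠ 0 := by exact_mod_cast (2 * k).factorial_ne_zero
    have h3 : (k.factorial : ℂ) ≠ 0 := by exact_mod_cast k.factorial_ne_zero
    have h4 : (2 * (k : ℂ) + 1) ≠ 0 := by exact_mod_cast (2 * k).succ_ne_zero
    have h5 : ((k : ℂ) + 1) ≠ 0 := by exact_mod_cast k.succ_ne_zero
    rw [h1, gaussianMoment, Nat.factorial_succ, Nat.factorial_succ, Nat.factorial_succ, pow_succ]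
    rw [div_eq_div_iff h2 h3] at ih
    push_cast
    have h6 : (2 * (k : ℂ) + 1 + 1) ≠ 0 := by
      have : 2 * (k : ℂ) + 1 + 1 = 2 * (k + 1) := by ring
      rw [this]
      exact mul_ne_zero two_ne_zero h5
    rw [div_eq_div_iff (by positivity) (by positivity)]
    linear_combination (2 * (k : ℂ) + 1) * q * (k + 1) * ih

theorem hasSum_gaussianMoment (q : ℂ) :
    HasSum (fun n => gaussianMoment q n / n.factorial) (Complex.exp (q / 2)) := by
  have he : HasSum (fun k => gaussianMoment q (2 * k) / (2 * k).factorial)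
      (Complex.exp (q / 2)) := by
    simp only [gaussianMoment_even]
    rw [Complex.exp_eq_exp_ℂ]
    exact NormedSpace.expSeries_div_hasSum_exp _
  have ho : HasSum (fun k => gaussianMoment q (2 * k + 1) / (2 * k + 1).factorial) 0 := by
    simp only [gaussianMoment_odd, zero_div]
    exact hasSum_zero
  simpa using he.even_add_odd (f := fun n => gaussianMoment q n / n.factorial) ho

/-- Expanding along the first index, each of its n + 1 possible partners splits off a factor q = ∑ K
z z and leaves the tensor of degree n. This is the recursion of the Gaussian moments; absolute
summability is carried along to justify the products of series. -/
theorem hasSum_wick (hK : ∀ i j, K i j = K j i) (z : ι → ℂ)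
    (hs : Summable fun p : ι × ι => ‖K p.1 p.2 * z p.1 * z p.2‖) :
    ∀ n, HasSum (fun v : Fin n → ι => wick K n v * ∏ j, z (v j))
        (gaussianMoment (∑' p : ι × ι, K p.1 p.2 * z p.1 * z p.2) n) ∧
      Summable fun v : Fin n → ι => ‖wick K n v * ∏ j, z (v j)‖
  | 0 => by
    refine ⟨?_, ?_⟩
    · simp [wick_zero, gaussianMoment]
    · exact (hasSum_unique _).summable
  | 1 => by
    simp only [wick_one hK, zero_mul, norm_zero]
    exact ⟨hasSum_zero, summable_zero⟩
  | n + 2 => by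
    obtain ⟨h1, h2⟩ := hasSum_wick hK z hs n
    set q := ∑' p : ι × ι, K p.1 p.2 * z p.1 * z p.2 with hq
    let k : ι × ι → ℂ := fun p => K p.1 p.2 * z p.1 * z p.2
    let w : (Fin n → ι) → ℂ := fun v => wick K n v * ∏ j, z (v j)
    have hv : HasSum (fun p : (ι × ι) × (Fin n → ι) => k p.1 * w p.2)
        (q * gaussianMoment q n) := by
      have : q * gaussianMoment q n = ∑' p : (ι × ι) × (Fin n → ι), k p.1 * w p.2 := by
        rw [← h1.tsum_eq]
        exact tsum_mul_tsum_of_summable_norm (f := k) (g := w) hs h2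
      rw [this]
      exact (summable_mul_of_summable_norm (f := k) (g := w) hs h2).hasSum
    have hn : Summable fun p : (ι × ι) × (Fin n → ι) => ‖k p.1 * w p.2‖ :=
      Summable.mul_norm (f := k) (g := w) hs h2
    let t : Fin (n + 1) → (Fin (n + 2) → ι) → ℂ := fun a v =>
      K (v 0) (v a.succ) * wick K n (fun j => v (a.succAbove j).succ) * ∏ j, z (v j)
    -- `E a` puts one index of the pair in front and the other at position `a` of the rest, so that
    -- the summand `t a` factorizes.
    let E : Fin (n + 1) → (ι × ι) × (Fin n → ι) ≃ (Fin (n + 2) → ι) := fun a =>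
      ((Equiv.prodAssoc ι ι (Fin n → ι)).trans ((Equiv.refl ι).prodCongr
        (Fin.insertNthEquiv (fun _ : Fin (n + 1) => ι) a))).trans
        (Fin.consEquiv (fun _ : Fin (n + 2) => ι))
    have hE : ∀ a p, t a (E a p) = k p.1 * w p.2 := by
      rintro a ⟨⟨i, j⟩, v⟩
      have e1 : E a ((i, j), v) = Fin.cons i (Fin.insertNth a j v : Fin (n + 1) → ι) := rfl
      simp only [t, e1, k, w, Fin.cons_zero, Fin.cons_succ, Fin.insertNth_apply_same,
        Fin.insertNth_apply_succAbove, Fin.prod_univ_succ (n := n + 1),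
        Fin.prod_univ_succAbove _ a]
      ring
    have hsplit : ∀ v : Fin (n + 2) → ι, wick K (n + 2) v * ∏ j, z (v j) = ∑ a, t a v := by
      intro v
      have e1 : v = Fin.cons (v 0) (Fin.tail v) := (Fin.cons_self_tail v).symm
      have e2 : wick K (n + 2) v
          = ∑ a : Fin (n + 1), K (v 0) (v a.succ) * wick K n (fun j => v (a.succAbove j).succ) := by
        conv_lhs => rw [e1]
        rw [wick_cons hK]
        simp only [hafnian_univ_erase hK]
        rfl
      rw [e2, Finset.sum_mul]
    refine ⟨?_, ?_⟩
    · simp only [hsplit]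
      have h3 : gaussianMoment q (n + 2) = ∑ _a : Fin (n + 1), q * gaussianMoment q n := by
        rw [gaussianMoment, Finset.sum_const, Finset.card_univ, Fintype.card_fin, nsmul_eq_mul]
        push_cast
        ring
      rw [h3]
      refine hasSum_sum fun a _ => ?_
      rw [← (E a).hasSum_iff]
      convert hv using 1
      exact funext (hE a)
    · simp only [hsplit]
      refine Summable.of_nonneg_of_le (fun _ => norm_nonneg _) (fun v => norm_sum_le _ _)
        (summable_sum fun a _ => ?_)
      rw [← (E a).summable_iff]
      convert hn using 1
      exact funext fun p => congrArg norm (hE a p)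

/-- A symmetric Hilbert-Schmidt kernel of norm less than `1` defines a Gaussian vector. -/
theorem exists_gaussian_of_kernel (hK : ∀ i j, K i j = K j i)
    (hs : Summable fun p : ι × ι => ‖K p.1 p.2‖ ^ 2) {κ : ℝ} (hκ0 : 0 ≤ κ) (hκ1 : κ < 1)
    (hκ : ∀ (S : Finset ι) (y : ι → ℂ),
      ∑ i ∈ S, ‖∑ j ∈ S, K i j * y j‖ ^ 2 ≤ κ * ∑ j ∈ S, ‖y j‖ ^ 2) :
    ∃ Ψ : FockSpace ι, ∀ x : L2 ι, ⟪expVec x, Ψ⟫_ℂ = Complex.exp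
      ((∑' p : ι × ι, K p.1 p.2 * (starRingEnd ℂ) (x p.1) * (starRingEnd ℂ) (x p.2)) / 2) := by
  have hh : ∀ S : Finset ι, ∑ i ∈ S, ∑ j ∈ S, ‖K i j‖ ^ 2 ≤ ∑' p : ι × ι, ‖K p.1 p.2‖ ^ 2 := by
    intro S
    rw [← Finset.sum_product']
    exact hs.sum_le_tsum _ fun _ _ => by positivity
  -- The n-particle component is the moment tensor divided by √n!. The exponential vector
  -- contributes another 1/√n!, and the pairing becomes the exponential generating series of the
  -- Gaussian moments.
  let Ψ : FockSpace ι := show symmSubspace ι from ⟨⟨_, memℓp_wick hK (tsum_nonneg fun _ => by positivity) hκ0 hκ1 hh hκ⟩, by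
    intro n σ i
    change wick K n (i ∘ σ) / _ = wick K n i / _
    rw [wick_comp_perm hK]⟩
  refine ⟨Ψ, fun x => ?_⟩
  have hx : Summable fun i => ‖x i‖ ^ 2 := by
    have := (memℓp_gen_iff (p := 2) (by norm_num)).1 (lp.memℓp x)
    simpa using this
  have hxx : Summable fun p : ι × ι => ‖x p.1‖ ^ 2 * ‖x p.2‖ ^ 2 :=
    hx.mul_of_nonneg hx (fun _ => by positivity) (fun _ => by positivity)
  have hz : Summable fun p : ι × ι =>
      ‖K p.1 p.2 * (starRingEnd ℂ) (x p.1) * (starRingEnd ℂ) (x p.2)‖ := by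
    refine ((hs.add hxx).mul_left (1 / 2)).of_nonneg_of_le (fun _ => norm_nonneg _) fun p => ?_
    rw [norm_mul, norm_mul, RCLike.norm_conj, RCLike.norm_conj]
    nlinarith [sq_nonneg (‖K p.1 p.2‖ - ‖x p.1‖ * ‖x p.2‖)]
  have hw := hasSum_wick hK (fun i => (starRingEnd ℂ) (x i)) hz
  have h1 := lp.hasSum_inner (𝕜 := ℂ) (expVec x).toFull Ψ.toFull
  rw [← FockSpace.inner_def] at h1
  have h2 := h1.sigma (g := fun n => gaussianMoment (∑' p : ι × ι,
    K p.1 p.2 * (starRingEnd ℂ) (x p.1) * (starRingEnd ℂ) (x p.2)) n / n.factorial) fun n => by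
      convert (hw n).1.div_const (n.factorial : ℂ) using 1
      funext v
      have e1 : Ψ.toFull ⟨n, v⟩ = wick K n v / ((√(n.factorial : ℝ) : ℝ) : ℂ) := rfl
      have e2 : ((√(n.factorial : ℝ) : ℝ) : ℂ) * ((√(n.factorial : ℝ) : ℝ) : ℂ) = n.factorial := by
        rw [← Complex.ofReal_mul, Real.mul_self_sqrt (by positivity)]
        simp
      rw [expVec_apply, e1, RCLike.inner_apply, map_div₀, map_prod, Complex.conj_ofReal,
        div_mul_div_comm, e2]
  exact h2.unique (hasSum_gaussianMoment _)

end Infinite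

/-! ### Gaussian vectors of antilinear operators and their Weyl expectations -/

section GaussianVector

variable {ι : Type} {θ : L2 ι →L[ℝ] L2 ι}

theorem norm_sq_eq_tsum (x : L2 ι) : ‖x‖ ^ 2 = ∑' i, ‖x i‖ ^ 2 := by
  have := lp.norm_rpow_eq_tsum (p := 2) (by norm_num) x
  simpa using this

theorem ofReal_norm_sq (x : L2 ι) : (‖x‖ : ℂ) ^ 2 = ⟪x, x⟫_ℂ :=
  (inner_self_eq_norm_sq_to_K x).symm

theorem hasSum_norm_sq (x : L2 ι) : HasSum (fun i => ‖x i‖ ^ 2) (‖x‖ ^ 2) := by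
  rw [norm_sq_eq_tsum]
  have := (memℓp_gen_iff (p := 2) (by norm_num)).1 (lp.memℓp x)
  exact Summable.hasSum (by simpa using this)

theorem inner_single_one [DecidableEq ι] (i : ι) (x : L2 ι) : ⟪lp.single 2 i (1 : ℂ), x⟫_ℂ = x i := by
  rw [lp.inner_single_left]
  simp

/-- A symmetric antilinear Hilbert-Schmidt operator `θ` of norm less than `1` defines a Gaussian
vector `exp(θ a^* a^* / 2) Ω`. -/
theorem exists_gaussian [DecidableEq ι] (hθ : ∀ (c : ℂ) x, θ (c • x) = (starRingEnd ℂ) c • θ x)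
    (hsymm : ∀ x y, ⟪x, θ y⟫_ℂ = ⟪y, θ x⟫_ℂ) {κ : ℝ} (hκ0 : 0 ≤ κ) (hκ1 : κ < 1)
    (hκ : ∀ x, ‖θ x‖ ^ 2 ≤ κ * ‖x‖ ^ 2)
    (hHS : Summable fun i => ‖θ (lp.single 2 i (1 : ℂ))‖ ^ 2) :
    ∃ Ψ : FockSpace ι, ∀ x : L2 ι, ⟪expVec x, Ψ⟫_ℂ = Complex.exp (⟪x, θ x⟫_ℂ / 2) := by
  let e : ι → L2 ι := fun i => lp.single 2 i (1 : ℂ)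
  let K : ι → ι → ℂ := fun i j => θ (e i) j
  have hK : ∀ i j, K i j = K j i := by
    intro i j
    have := hsymm (e j) (e i)
    rwa [inner_single_one, inner_single_one] at this
  have hs : Summable fun p : ι × ι => ‖K p.1 p.2‖ ^ 2 := by
    rw [summable_prod_of_nonneg fun _ => by positivity]
    refine ⟨fun i => (hasSum_norm_sq (θ (e i))).summable, ?_⟩
    refine hHS.congr fun i => ?_
    exact norm_sq_eq_tsum _
  have hKκ : ∀ (S : Finset ι) (y : ι → ℂ),
      ∑ i ∈ S, ‖∑ j ∈ S, K i j * y j‖ ^ 2 ≤ κ * ∑ j ∈ S, ‖y j‖ ^ 2 := by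
    intro S y
    -- The coefficients are conjugated because θ is antilinear; the coordinates of `θ Y` are then
    -- the sums ∑ K i j y j.
    let Y : L2 ι := ∑ j ∈ S, lp.single 2 j ((starRingEnd ℂ) (y j))
    have hY : ‖Y‖ ^ 2 = ∑ j ∈ S, ‖y j‖ ^ 2 := by
      have := lp.norm_sum_single (p := 2) (E := fun _ : ι => ℂ) (by norm_num)
        (fun j => (starRingEnd ℂ) (y j)) S
      simpa using this
    have hθY : ∀ i, θ Y i = ∑ j ∈ S, K i j * y j := by
      intro i
      have h1 : θ Y = ∑ j ∈ S, y j • θ (e j) := by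
        simp only [Y, map_sum]
        refine Finset.sum_congr rfl fun j _ => ?_
        have : lp.single 2 j ((starRingEnd ℂ) (y j)) = (starRingEnd ℂ) (y j) • e j := by
          rw [← lp.single_smul]
          simp
        rw [this, hθ, Complex.conj_conj]
      rw [h1, lp.coeFn_sum, Finset.sum_apply]
      refine Finset.sum_congr rfl fun j _ => ?_
      rw [lp.coeFn_smul, Pi.smul_apply, smul_eq_mul, mul_comm, hK i j]
    rw [← hY]
    refine le_trans ?_ (hκ Y)
    simp only [← hθY]
    exact sum_le_hasSum _ (fun _ _ => by positivity) (hasSum_norm_sq (θ Y))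
  obtain ⟨Ψ, hΨ⟩ := exists_gaussian_of_kernel hK hs hκ0 hκ1 hKκ
  refine ⟨Ψ, fun x => ?_⟩
  rw [hΨ]
  congr 2
  have hxx : Summable fun p : ι × ι => ‖x p.1‖ ^ 2 * ‖x p.2‖ ^ 2 :=
    (hasSum_norm_sq x).summable.mul_of_nonneg (hasSum_norm_sq x).summable
      (fun _ => by positivity) (fun _ => by positivity)
  have hz : Summable fun p : ι × ι =>
      K p.1 p.2 * (starRingEnd ℂ) (x p.1) * (starRingEnd ℂ) (x p.2) := by
    refine Summable.of_norm_bounded ((hs.add hxx).mul_left (1 / 2)) fun p => ?_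
    rw [norm_mul, norm_mul, RCLike.norm_conj, RCLike.norm_conj]
    nlinarith [sq_nonneg (‖K p.1 p.2‖ - ‖x p.1‖ * ‖x p.2‖)]
  have h1 : HasSum (fun i => (starRingEnd ℂ) (x i) * ⟪x, θ (e i)⟫_ℂ)
      (∑' p : ι × ι, K p.1 p.2 * (starRingEnd ℂ) (x p.1) * (starRingEnd ℂ) (x p.2)) := by
    refine hz.hasSum.prod_fiberwise fun i => ?_
    have h0 := (lp.hasSum_inner (𝕜 := ℂ) x (θ (e i))).mul_left ((starRingEnd ℂ) (x i))
    refine (congrArg (fun f => HasSum f _) (funext fun j => ?_)).mp h0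
    rw [RCLike.inner_apply]
    simp only [K]
    ring
  have h2 : HasSum (fun i => (starRingEnd ℂ) (x i) * ⟪x, θ (e i)⟫_ℂ) ⟪x, θ x⟫_ℂ := by
    have h3 := ((lp.hasSum_single (p := 2) (by norm_num) x).mapL θ).mapL
      ((innerSL ℂ x).restrictScalars ℝ)
    refine (congrArg (fun f => HasSum f _) (funext fun i => ?_)).mp h3
    have : lp.single 2 i (x i) = x i • e i := by
      rw [← lp.single_smul]
      simp
    rw [this, hθ]
    simp
  exact h1.unique h2

/-- The characteristic functional of a Gaussian vector. -/
theorem inner_weyl_gaussian (hθ : ∀ (c : ℂ) x, θ (c • x) = (starRingEnd ℂ) c • θ x)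
    (hsymm : ∀ x y, ⟪x, θ y⟫_ℂ = ⟪y, θ x⟫_ℂ) {Ψ : FockSpace ι}
    (hΨ : ∀ x : L2 ι, ⟪expVec x, Ψ⟫_ℂ = Complex.exp (⟪x, θ x⟫_ℂ / 2)) (w : L2 ι) :
    ⟪Ψ, weyl (w + θ w) Ψ⟫_ℂ
      = ⟪Ψ, Ψ⟫_ℂ * Complex.exp (-((‖w‖ : ℂ) ^ 2 - (‖θ w‖ : ℂ) ^ 2) / 4) := by
  -- The vector `ζ b` = bw + b̄ θw is not analytic in b. The prefactor exp(|b|² D/4) in `Υ` cancels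
  -- every b̄ that remains, and `key` shows that inner products with exponential vectors become
  -- exponentials of quadratic polynomials in b.
  set ζ : ℂ → L2 ι := fun b => b • w + θ (b • w) with hζ
  set s : ℂ := ⟪θ w, w - θ (θ w)⟫_ℂ with hs
  set D : ℂ := (‖w‖ : ℂ) ^ 2 - (‖θ w‖ : ℂ) ^ 2 with hD
  set Υ : ℂ → FockSpace ι := fun b =>
    Complex.exp ((starRingEnd ℂ) b * b * D / 4) • weyl (ζ b) Ψ with hΥ
  have hζneg : ∀ b, ζ (-b) = - ζ b := by
    intro b
    simp only [hζ, neg_smul, map_neg]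
    abel
  have key : ∀ x b, ⟪expVec x, Υ b⟫_ℂ = Complex.exp (⟪x, θ x⟫_ℂ / 2
      + b * (rootHalf * ⟪x, w - θ (θ w)⟫_ℂ) - b * b * s / 4) := by
    intro x b
    have hθr : θ (rootHalf • -ζ b) = rootHalf • -θ (ζ b) := by
      rw [hθ, conj_rootHalf, map_neg]
    rw [hΥ]
    simp only
    rw [inner_smul_right, inner_weyl_right, weyl_expVec, inner_smul_left, hΨ, norm_neg,
      ← Complex.exp_conj, ← Complex.exp_add, ← Complex.exp_add]
    congr 1
    have t1 : ⟪w, θ (θ w)⟫_ℂ = ⟪θ w, θ w⟫_ℂ := hsymm _ _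
    have t2 : ⟪x + rootHalf • -ζ b, θ (x + rootHalf • -ζ b)⟫_ℂ = ⟪x, θ x⟫_ℂ
        - 2 * rootHalf * ⟪x, θ (ζ b)⟫_ℂ + rootHalf * rootHalf * ⟪ζ b, θ (ζ b)⟫_ℂ := by
      rw [map_add, hθr]
      simp only [inner_add_left, inner_add_right, inner_smul_left, inner_smul_right,
        inner_neg_left, inner_neg_right, conj_rootHalf, hsymm (ζ b) x]
      ring
    have t3 : (starRingEnd ℂ) (-((‖ζ b‖ : ℂ) ^ 2 / 4) - rootHalf * ⟪-ζ b, x⟫_ℂ)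
        = -(⟪ζ b, ζ b⟫_ℂ / 4) + rootHalf * ⟪x, ζ b⟫_ℂ := by
      rw [← ofReal_norm_sq, inner_neg_left, map_sub, map_neg, map_div₀, map_pow,
        Complex.conj_ofReal, map_mul, map_neg, inner_conj_symm, conj_rootHalf, Complex.conj_ofNat]
      ring
    rw [t2, t3, rootHalf_mul_self, hD, hs, ofReal_norm_sq, ofReal_norm_sq]
    have t4 : ζ b = b • w + (starRingEnd ℂ) b • θ w := by rw [hζ]; simp only [hθ]
    have t5 : θ (ζ b) = (starRingEnd ℂ) b • θ w + b • θ (θ w) := by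
      rw [t4, map_add, hθ, hθ, Complex.conj_conj]
    rw [t5, t4]
    simp only [inner_add_left, inner_add_right, inner_smul_left, inner_smul_right,
      Complex.conj_conj, inner_sub_right]
    linear_combination (b * (starRingEnd ℂ) b / 4) * t1
  have hd : Differentiable ℂ fun b => ⟪Ψ, Υ b⟫_ℂ := by
    refine differentiable_inner_of_expVec
      (C := fun b => ‖Complex.exp ((starRingEnd ℂ) b * b * D / 4)‖ * ‖Ψ‖)
      (by fun_prop) (fun b => ?_) (fun x => ?_) _
    · rw [hΥ]
      simp only
      rw [norm_smul, norm_weyl_apply]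
    · simp only [key]
      fun_prop
  have hc : ∀ b, ⟪Ψ, Υ (-b)⟫_ℂ = (starRingEnd ℂ) ⟪Ψ, Υ b⟫_ℂ := by
    intro b
    have hDc : (starRingEnd ℂ) D = D := by
      rw [hD]
      simp
    simp only [hΥ, hζneg, inner_smul_right, map_mul, ← Complex.exp_conj, inner_conj_symm,
      inner_weyl_right, map_div₀, Complex.conj_conj, hDc, neg_neg, map_neg, Complex.conj_ofNat]
    congr 2
    ring
  -- The change b ↦ -b replaces the Weyl operator by its adjoint, so the entire function ⟨Ψ, Υ b⟩ is
  -- constant. Its values at 1 and 0 are the two sides of the claim, up to the prefactor.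
  have h1 := eq_of_differentiable_of_conj hd hc 1 0
  have hζ0 : ζ 0 = 0 := by simp [hζ]
  have hζ1 : ζ 1 = w + θ w := by simp [hζ]
  simp only [hΥ, hζ0, hζ1, isFockWeyl_weyl.map_zero, inner_smul_right, map_one, one_mul, map_zero,
    zero_mul, zero_div, Complex.exp_zero, one_apply_eq_self] at h1
  rw [← h1, mul_comm, ← mul_assoc, ← Complex.exp_add]
  have : -D / 4 + D / 4 = 0 := by ring
  rw [this, Complex.exp_zero, one_mul]

end GaussianVector

/-! ### Real linear operators and their complex linear and antilinear parts -/

section Symplectic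

variable {ι : Type}

theorem real_smul_eq (r : ℝ) (x : L2 ι) : r • x = (r : ℂ) • x := rfl

/-- Treats the linear case ε = 1 and the antilinear case ε = -1 together. -/
theorem map_smul_eq_of_map_I_smul (T : L2 ι →L[ℝ] L2 ι) {ε : ℝ}
    (hT : ∀ x, T (Complex.I • x) = ((ε : ℂ) * Complex.I) • T x) (c : ℂ) (x : L2 ι) :
    T (c • x) = ((c.re : ℂ) + ε * c.im * Complex.I) • T x := by
  have h1 : c • x = c.re • x + c.im • Complex.I • x := by
    rw [real_smul_eq, real_smul_eq, smul_smul, ← add_smul, Complex.re_add_im]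
  rw [h1, map_add, map_smul, map_smul, hT, real_smul_eq, real_smul_eq, smul_smul, ← add_smul]
  congr 1
  ring

/-- The complex antilinear part of a real linear operator. -/
def antilinearPart (T : L2 ι →L[ℝ] L2 ι) : L2 ι →L[ℝ] L2 ι :=
  (1 / 2 : ℝ) • (T + ((Complex.I • ContinuousLinearMap.id ℂ (L2 ι)).restrictScalars ℝ).comp
    (T.comp ((Complex.I • ContinuousLinearMap.id ℂ (L2 ι)).restrictScalars ℝ)))

/-- The complex linear part of a real linear operator. -/
def linearPart (T : L2 ι →L[ℝ] L2 ι) : L2 ι →L[ℝ] L2 ι :=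
  (1 / 2 : ℝ) • (T - ((Complex.I • ContinuousLinearMap.id ℂ (L2 ι)).restrictScalars ℝ).comp
    (T.comp ((Complex.I • ContinuousLinearMap.id ℂ (L2 ι)).restrictScalars ℝ)))

theorem antilinearPart_apply (T : L2 ι →L[ℝ] L2 ι) (x : L2 ι) :
    antilinearPart T x = (1 / 2 : ℂ) • (T x + Complex.I • T (Complex.I • x)) := by
  have : (1 / 2 : ℂ) = ((1 / 2 : ℝ) : ℂ) := by norm_num
  rw [this, ← real_smul_eq]
  rfl

theorem linearPart_apply (T : L2 ι →L[ℝ] L2 ι) (x : L2 ι) :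
    linearPart T x = (1 / 2 : ℂ) • (T x - Complex.I • T (Complex.I • x)) := by
  have : (1 / 2 : ℂ) = ((1 / 2 : ℝ) : ℂ) := by norm_num
  rw [this, ← real_smul_eq]
  rfl

theorem linearPart_add_antilinearPart (T : L2 ι →L[ℝ] L2 ι) (x : L2 ι) :
    linearPart T x + antilinearPart T x = T x := by
  rw [linearPart_apply, antilinearPart_apply]
  module

theorem map_I_smul_I_smul (T : L2 ι →L[ℝ] L2 ι) (x : L2 ι) :
    T (Complex.I • Complex.I • x) = - T x := by
  rw [smul_smul, Complex.I_mul_I, neg_one_smul, map_neg]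

theorem antilinearPart_smul (T : L2 ι →L[ℝ] L2 ι) (c : ℂ) (x : L2 ι) :
    antilinearPart T (c • x) = (starRingEnd ℂ) c • antilinearPart T x := by
  have h := map_smul_eq_of_map_I_smul (antilinearPart T) (ε := -1) (fun x => ?_) c x
  · rw [h]
    congr 1
    apply Complex.ext <;> simp
  · rw [antilinearPart_apply, antilinearPart_apply, map_I_smul_I_smul]
    match_scalars
    · linear_combination (1 / 2 : ℂ) * Complex.I_mul_I
    · ring

theorem linearPart_smul (T : L2 ι →L[ℝ] L2 ι) (c : ℂ) (x : L2 ι) :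
    linearPart T (c • x) = c • linearPart T x := by
  have h := map_smul_eq_of_map_I_smul (linearPart T) (ε := 1) (fun x => ?_) c x
  · rw [h]
    congr 1
    apply Complex.ext <;> simp
  · rw [linearPart_apply, linearPart_apply, map_I_smul_I_smul]
    match_scalars
    · linear_combination (1 / 2 : ℂ) * Complex.I_mul_I
    · ring

/-- The complex linear part of a real linear operator, as a complex linear operator. -/
def linearPartCLM (T : L2 ι →L[ℝ] L2 ι) : L2 ι →L[ℂ] L2 ι where
  toFun := linearPart T
  map_add' := map_add _
  map_smul' := linearPart_smul T
  cont := (linearPart T).continuous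

variable {V : L2 ι ≃L[ℝ] L2 ι}

/-- Symplecticity moves V across the imaginary part only; the real part is recovered by replacing x
by ix. Separating linear and antilinear parts then gives V⁻¹ = A* - Bᵗ for V = A + B, where ⟨x, Bᵗy⟩
= ⟨y, Bx⟩. -/
theorem inner_symm_apply (hV : ∀ x y, (⟪V x, V y⟫_ℂ).im = (⟪x, y⟫_ℂ).im) (x y : L2 ι) :
    ⟪x, V.symm y⟫_ℂ = -((⟪V (Complex.I • x), y⟫_ℂ).im : ℂ) + (⟪V x, y⟫_ℂ).im * Complex.I := by
  have h1 : ∀ x, (⟪V x, y⟫_ℂ).im = (⟪x, V.symm y⟫_ℂ).im := by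
    intro x
    rw [← hV x (V.symm y), V.apply_symm_apply]
  rw [h1, h1, inner_smul_left]
  apply Complex.ext <;> simp

theorem inner_linearPart_symm (hV : ∀ x y, (⟪V x, V y⟫_ℂ).im = (⟪x, y⟫_ℂ).im) (x y : L2 ι) :
    ⟪x, linearPart (V.symm : L2 ι →L[ℝ] L2 ι) y⟫_ℂ
      = ⟪linearPart (V : L2 ι →L[ℝ] L2 ι) x, y⟫_ℂ := by
  rw [linearPart_apply, linearPart_apply, inner_smul_right, inner_smul_left, inner_sub_right,
    inner_sub_left, inner_smul_right, inner_smul_left]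
  simp only [ContinuousLinearEquiv.coe_coe]
  rw [inner_symm_apply hV, inner_symm_apply hV, inner_smul_right, inner_smul_right]
  apply Complex.ext
  · simp
    ring
  · simp

theorem inner_antilinearPart_symm (hV : ∀ x y, (⟪V x, V y⟫_ℂ).im = (⟪x, y⟫_ℂ).im)
    (x y : L2 ι) : ⟪x, antilinearPart (V.symm : L2 ι →L[ℝ] L2 ι) y⟫_ℂ
      = -⟪y, antilinearPart (V : L2 ι →L[ℝ] L2 ι) x⟫_ℂ := by
  rw [antilinearPart_apply, antilinearPart_apply, inner_smul_right, inner_smul_right,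
    inner_add_right, inner_add_right, inner_smul_right, inner_smul_right]
  simp only [ContinuousLinearEquiv.coe_coe]
  rw [inner_symm_apply hV, inner_symm_apply hV, inner_smul_right, inner_smul_right,
    (inner_conj_symm y (V x)).symm, (inner_conj_symm y (V (Complex.I • x))).symm]
  generalize ⟪V x, y⟫_ℂ = a
  generalize ⟪V (Complex.I • x), y⟫_ℂ = b
  apply Complex.ext <;> (simp; ring)

/-- The linear and the antilinear part of the identity `S (T x) = x`. -/
theorem parts_of_comp_eq {S T : L2 ι →L[ℝ] L2 ι} (h : ∀ x, S (T x) = x) (x : L2 ι) :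
    linearPart S (linearPart T x) + antilinearPart S (antilinearPart T x) = x ∧
      linearPart S (antilinearPart T x) + antilinearPart S (linearPart T x) = 0 := by
  have h1 : ∀ x, (linearPart S (linearPart T x) + antilinearPart S (antilinearPart T x))
      + (linearPart S (antilinearPart T x) + antilinearPart S (linearPart T x)) = x := by
    intro x
    conv_rhs => rw [← h x, ← linearPart_add_antilinearPart T, map_add,
      ← linearPart_add_antilinearPart S, ← linearPart_add_antilinearPart S (antilinearPart T x)]
    abel
  have h2 := h1 x
  -- The first bracket commutes with i and the second anticommutes with it, so evaluation at ix
  -- separates them.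
  have h3 := h1 (Complex.I • x)
  simp only [linearPart_smul, antilinearPart_smul, Complex.conj_I,
    ← smul_add] at h3
  have h4 : (linearPart S (linearPart T x) + antilinearPart S (antilinearPart T x))
      - (linearPart S (antilinearPart T x) + antilinearPart S (linearPart T x)) = x := by
    have := congrArg (fun y => (-Complex.I) • y) h3
    simp only [smul_add, smul_smul] at this
    simp at this
    refine Eq.trans ?_ this
    abel
  set P := linearPart S (linearPart T x) + antilinearPart S (antilinearPart T x)
  set Q := linearPart S (antilinearPart T x) + antilinearPart S (linearPart T x)
  have hQ : (2 : ℂ) • Q = 0 := by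
    have : (2 : ℂ) • Q = (P + Q) - (P - Q) := by module
    rw [this, h2, h4, sub_self]
  have hQ0 : Q = 0 := (smul_eq_zero.1 hQ).resolve_left two_ne_zero
  rw [hQ0, add_zero] at h2
  exact ⟨h2, hQ0⟩

theorem symplectic_symm (hV : ∀ x y, (⟪V x, V y⟫_ℂ).im = (⟪x, y⟫_ℂ).im) (x y : L2 ι) :
    (⟪V.symm x, V.symm y⟫_ℂ).im = (⟪x, y⟫_ℂ).im := by
  rw [← hV, V.apply_symm_apply, V.apply_symm_apply]

/-- This is the linear part of V⁻¹V = 1, namely A*A - BᵗB = 1, paired with `x`. It bounds `A` from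
below by 1. -/
theorem norm_sq_linearPart (hV : ∀ x y, (⟪V x, V y⟫_ℂ).im = (⟪x, y⟫_ℂ).im) (x : L2 ι) :
    ‖linearPart (V : L2 ι →L[ℝ] L2 ι) x‖ ^ 2
      = ‖x‖ ^ 2 + ‖antilinearPart (V : L2 ι →L[ℝ] L2 ι) x‖ ^ 2 := by
  have h1 := (parts_of_comp_eq (S := (V.symm : L2 ι →L[ℝ] L2 ι)) (T := (V : L2 ι →L[ℝ] L2 ι))
    (fun x => V.symm_apply_apply x) x).1
  have h2 : ((‖linearPart (V : L2 ι →L[ℝ] L2 ι) x‖ ^ 2 : ℝ) : ℂ)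
      = ((‖x‖ ^ 2 + ‖antilinearPart (V : L2 ι →L[ℝ] L2 ι) x‖ ^ 2 : ℝ) : ℂ) := by
    push_cast
    rw [ofReal_norm_sq, ofReal_norm_sq, ofReal_norm_sq, ← inner_linearPart_symm hV,
      eq_sub_of_add_eq h1, inner_sub_right, inner_antilinearPart_symm hV]
    ring
  exact Complex.ofReal_injective h2

theorem norm_le_norm_linearPart (hV : ∀ x y, (⟪V x, V y⟫_ℂ).im = (⟪x, y⟫_ℂ).im) (x : L2 ι) :
    ‖x‖ ≤ ‖linearPart (V : L2 ι →L[ℝ] L2 ι) x‖ := by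
  rw [← sq_le_sq₀ (norm_nonneg _) (norm_nonneg _), norm_sq_linearPart hV]
  have : 0 ≤ ‖antilinearPart (V : L2 ι →L[ℝ] L2 ι) x‖ ^ 2 := by positivity
  linarith

/-- The complex linear part of a bounded symplectic operator with bounded inverse is invertible. -/
theorem bijective_linearPart (hV : ∀ x y, (⟪V x, V y⟫_ℂ).im = (⟪x, y⟫_ℂ).im) :
    Function.Bijective (linearPartCLM (V : L2 ι →L[ℝ] L2 ι)) := by
  set A := linearPartCLM (V : L2 ι →L[ℝ] L2 ι) with hA
  have hanti : AntilipschitzWith 1 A := by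
    refine AddMonoidHomClass.antilipschitz_of_bound A fun x => ?_
    rw [NNReal.coe_one, one_mul]
    exact norm_le_norm_linearPart hV x
  refine ⟨hanti.injective, ?_⟩
  have hclosed : IsClosed (A.range : Set (L2 ι)) :=
    hanti.isClosed_range A.uniformContinuous
  refine LinearMap.range_eq_top.1 ?_
  -- The adjoint of `A` is the linear part of the symplectic operator V⁻¹, which is bounded below as
  -- well and hence injective.
  have h1 : A.range.topologicalClosure = ⊤ := by
    rw [Submodule.topologicalClosure_eq_top_iff, Submodule.eq_bot_iff]
    intro y hy
    have h2 : linearPart (V.symm : L2 ι →L[ℝ] L2 ι) y = 0 := by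
      refine ext_inner_left ℂ fun x => ?_
      rw [inner_linearPart_symm hV, inner_zero_right]
      exact hy _ ⟨x, rfl⟩
    have h3 := norm_le_norm_linearPart (V := V.symm) (symplectic_symm hV) y
    rw [h2, norm_zero] at h3
    exact norm_le_zero_iff.1 h3
  rwa [hclosed.submodule_topologicalClosure_eq] at h1

/-- The antilinear operator `θ` with `V ξ = (1 + θ) A ξ`, where `A` is the complex linear part of
the symplectic operator `V`. -/
theorem exists_antilinear_of_symplectic [DecidableEq ι]
    (hV : ∀ x y, (⟪V x, V y⟫_ℂ).im = (⟪x, y⟫_ℂ).im)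
    (hHS : Summable fun i =>
      ‖antilinearPart (V.symm : L2 ι →L[ℝ] L2 ι) (lp.single 2 i (1 : ℂ))‖ ^ 2) :
    ∃ (θ : L2 ι →L[ℝ] L2 ι) (κ : ℝ), (∀ (c : ℂ) x, θ (c • x) = (starRingEnd ℂ) c • θ x) ∧
      (∀ x y, ⟪x, θ y⟫_ℂ = ⟪y, θ x⟫_ℂ) ∧ 0 ≤ κ ∧ κ < 1 ∧ (∀ x, ‖θ x‖ ^ 2 ≤ κ * ‖x‖ ^ 2) ∧
      (Summable fun i => ‖θ (lp.single 2 i (1 : ℂ))‖ ^ 2) ∧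
      ∀ ξ, ∃ w, V ξ = w + θ w ∧ ‖ξ‖ ^ 2 = ‖w‖ ^ 2 - ‖θ w‖ ^ 2 := by
  set A := linearPartCLM (V : L2 ι →L[ℝ] L2 ι) with hA
  set B := antilinearPart (V : L2 ι →L[ℝ] L2 ι) with hB
  set A₂ := linearPart (V.symm : L2 ι →L[ℝ] L2 ι) with hA₂
  set B₂ := antilinearPart (V.symm : L2 ι →L[ℝ] L2 ι) with hB₂
  let Ae : L2 ι ≃L[ℂ] L2 ι := ContinuousLinearEquiv.ofBijective A
    (LinearMap.ker_eq_bot.2 (bijective_linearPart hV).1)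
    (LinearMap.range_eq_top.2 (bijective_linearPart hV).2)
  have hAe : ∀ x, Ae x = linearPart (V : L2 ι →L[ℝ] L2 ι) x := fun x => rfl
  -- With w = Aξ, the decomposition Vξ = Aξ + Bξ reads w + θw.
  let θ : L2 ι →L[ℝ] L2 ι := B.comp ((Ae.symm : L2 ι →L[ℂ] L2 ι).restrictScalars ℝ)
  have hθA : ∀ x, θ (Ae x) = B x := by
    intro x
    change B (Ae.symm (Ae x)) = B x
    rw [Ae.symm_apply_apply]
  have hnorm : ∀ x, ‖Ae x‖ ^ 2 = ‖x‖ ^ 2 + ‖θ (Ae x)‖ ^ 2 := by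
    intro x
    rw [hθA]
    exact norm_sq_linearPart hV x
  -- The antilinear part of V⁻¹V = 1. It yields both the symmetry of `θ` and its Hilbert-Schmidt
  -- property.
  have hcross : ∀ x, A₂ (B x) = -B₂ (Ae x) := fun x =>
    eq_neg_of_add_eq_zero_left (parts_of_comp_eq (S := (V.symm : L2 ι →L[ℝ] L2 ι))
      (T := (V : L2 ι →L[ℝ] L2 ι)) (fun x => V.symm_apply_apply x) x).2
  set N : ℝ := ‖(Ae : L2 ι →L[ℂ] L2 ι)‖ ^ 2 + 1 with hN
  have hN1 : 1 ≤ N := by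
    have : 0 ≤ ‖(Ae : L2 ι →L[ℂ] L2 ι)‖ ^ 2 := by positivity
    linarith
  -- From ‖θAx‖² = ‖Ax‖² - ‖x‖² and ‖Ax‖² ≤ N‖x‖². The summand 1 in `N` ensures N ≥ 1 without any
  -- assumption that the space is nonzero.
  refine ⟨θ, 1 - 1 / N, ?_, ?_, ?_, ?_, ?_, ?_, ?_⟩
  · intro c x
    obtain ⟨y, rfl⟩ := Ae.surjective x
    rw [← map_smul, hθA, hθA, hB, antilinearPart_smul]
  · intro x y
    obtain ⟨x, rfl⟩ := Ae.surjective x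
    obtain ⟨y, rfl⟩ := Ae.surjective y
    rw [hθA, hθA, hAe x, ← inner_linearPart_symm hV, ← hA₂, hcross, inner_neg_right,
      inner_antilinearPart_symm hV, neg_neg]
  · rw [sub_nonneg, div_le_one (by linarith)]
    exact hN1
  · have : 0 < 1 / N := by positivity
    linarith
  · intro x
    obtain ⟨x, rfl⟩ := Ae.surjective x
    have h1 := hnorm x
    have h2 : ‖Ae x‖ ^ 2 ≤ N * ‖x‖ ^ 2 := by
      have h3 := (Ae : L2 ι →L[ℂ] L2 ι).le_opNorm x
      have h4 : ‖Ae x‖ ^ 2 ≤ (‖(Ae : L2 ι →L[ℂ] L2 ι)‖ * ‖x‖) ^ 2 :=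
        pow_le_pow_left₀ (norm_nonneg _) h3 2
      rw [mul_pow] at h4
      have : 0 ≤ ‖x‖ ^ 2 := by positivity
      rw [hN, add_mul, one_mul]
      linarith
    have h5 : ‖Ae x‖ ^ 2 / N ≤ ‖x‖ ^ 2 := by
      rw [div_le_iff₀' (by linarith)]
      exact h2
    have h6 : (1 - 1 / N) * ‖Ae x‖ ^ 2 = ‖Ae x‖ ^ 2 - ‖Ae x‖ ^ 2 / N := by ring
    rw [h6]
    linarith
  · refine hHS.of_nonneg_of_le (fun _ => by positivity) fun i => ?_
    obtain ⟨x, hx⟩ := Ae.surjective (lp.single 2 i (1 : ℂ))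
    rw [← hx, hθA]
    refine pow_le_pow_left₀ (norm_nonneg _) ?_ 2
    -- Since the linear part of V⁻¹ is bounded below by 1, ‖Bx‖ ≤ ‖A₂Bx‖ = ‖B₂Ax‖, and here Ax is
    -- the basis vector.
    have h1 := norm_le_norm_linearPart (V := V.symm) (symplectic_symm hV) (B x)
    rw [← hA₂, hcross, norm_neg] at h1
    exact h1
  · intro ξ
    refine ⟨Ae ξ, ?_, ?_⟩
    · rw [hθA, hAe]
      exact (linearPart_add_antilinearPart (V : L2 ι →L[ℝ] L2 ι) ξ).symm
    · rw [hnorm]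
      ring

/-! ### Implementation of symplectic operators: Shale's theorem -/

theorem weyl_weyl_apply (f g : L2 ι) (ψ : FockSpace ι) : weyl f (weyl g ψ)
    = Complex.exp (-(Complex.I * ((⟪f, g⟫_ℂ).im : ℂ) / 2)) • weyl (f + g) ψ := by
  rw [← mul_apply_eq_comp, isFockWeyl_weyl.map_mul, smul_apply]

theorem inner_weyl_weyl (f g : L2 ι) (φ ψ : FockSpace ι) : ⟪weyl f φ, weyl g ψ⟫_ℂ
    = Complex.exp (Complex.I * ((⟪f, g⟫_ℂ).im : ℂ) / 2) * ⟪φ, weyl (g - f) ψ⟫_ℂ := by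
  have h1 : ⟪weyl f φ, weyl g ψ⟫_ℂ = ⟪φ, weyl (-f) (weyl g ψ)⟫_ℂ := by
    rw [inner_weyl_right (-f), neg_neg]
  rw [h1, weyl_weyl_apply, inner_smul_right, inner_neg_left, Complex.neg_im, neg_add_eq_sub]
  congr 2
  push_cast
  ring

/-- **Shale's theorem**: a bounded symplectic operator with bounded inverse, whose inverse has a
Hilbert-Schmidt antilinear part, is implemented by a unitary operator on the Fock space. -/
theorem exists_unitary_of_symplectic [DecidableEq ι]
    (hV : ∀ x y, (⟪V x, V y⟫_ℂ).im = (⟪x, y⟫_ℂ).im)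
    (hHS : Summable fun i =>
      ‖antilinearPart (V.symm : L2 ι →L[ℝ] L2 ι) (lp.single 2 i (1 : ℂ))‖ ^ 2) :
    ∃ U ∈ unitary (FockSpace ι →L[ℂ] FockSpace ι), ∀ ξ, U * weyl ξ * star U = weyl (V ξ) := by
  obtain ⟨θ, κ, hθ, hsymm, hκ0, hκ1, hκ, hθHS, hVθ⟩ := exists_antilinear_of_symplectic hV hHS
  obtain ⟨Φ, hΦ⟩ := exists_gaussian hθ hsymm hκ0 hκ1 hκ hθHS
  have hΦ0 : Φ ≠ 0 := by
    rintro rfl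
    have := hΦ 0
    simp at this
  set Ψ : FockSpace ι := ((‖Φ‖⁻¹ : ℝ) : ℂ) • Φ with hΨ
  have hchar : ∀ ξ, ⟪Ψ, weyl (V ξ) Ψ⟫_ℂ = ⟪vacuum ι, weyl ξ (vacuum ι)⟫_ℂ := by
    intro ξ
    obtain ⟨w, hw, hn⟩ := hVθ ξ
    have hn' : (‖ξ‖ : ℂ) ^ 2 = (‖w‖ : ℂ) ^ 2 - (‖θ w‖ : ℂ) ^ 2 := by exact_mod_cast hn
    rw [hw, hΨ, map_smul, inner_smul_left, inner_smul_right, inner_weyl_gaussian hθ hsymm hΦ,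
      weyl_vacuum, inner_smul_right, vacuum, inner_expVec, inner_zero_left, Complex.exp_zero,
      mul_one, Complex.conj_ofReal, ← hn']
    have h1 : ⟪Φ, Φ⟫_ℂ = (‖Φ‖ : ℂ) ^ 2 := inner_self_eq_norm_sq_to_K Φ
    have h2 : (‖Φ‖ : ℂ) ≠ 0 := by exact_mod_cast norm_ne_zero_iff.2 hΦ0
    rw [h1]
    push_cast
    field_simp
  -- Inner products within either family reduce to a phase, depending only on the symplectic form,
  -- times an expectation. These agree by `hV` and `hchar`; Ψ is the image of the vacuum.
  obtain ⟨T, hT, hTn⟩ := exists_isometry (fun ξ => weyl ξ (vacuum ι)) (fun ξ => weyl (V ξ) Ψ)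
    (fun ξ η => by rw [inner_weyl_weyl, inner_weyl_weyl, hV, ← map_sub, hchar])
    (dense_span_weyl_vacuum ι)
  have hint : ∀ ξ, T * weyl ξ = weyl (V ξ) * T := by
    intro ξ
    apply ContinuousLinearMap.ext_on (dense_span_weyl_vacuum ι)
    rintro _ ⟨η, rfl⟩
    simp only [mul_apply_eq_comp, hT]
    rw [weyl_weyl_apply, weyl_weyl_apply, map_smul, hT, hV, map_add]
  have hstar : star T * T = 1 := (ContinuousLinearMap.norm_map_iff_adjoint_comp_self T).1 hTn
  have hint' : ∀ ξ, weyl ξ * star T = star T * weyl (V ξ) := by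
    intro ξ
    have := congrArg star (hint (-ξ))
    rwa [star_mul, star_mul, star_weyl, star_weyl, map_neg, neg_neg, neg_neg] at this
  -- T T* commutes with every W(Vξ), hence with all Weyl operators because V is onto. The scalar is
  -- 1 because T is an isometry of a nonzero space.
  obtain ⟨c, hc⟩ := eq_smul_one_of_commute_weyl (T := T * star T)
    (fun φ ψ => by
      simp only [mul_apply_eq_comp, ContinuousLinearMap.star_eq_adjoint]
      rw [← ContinuousLinearMap.adjoint_inner_right, ContinuousLinearMap.adjoint_inner_left])
    (fun f => by
      obtain ⟨ξ, rfl⟩ := V.surjective f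
      rw [mul_assoc, ← hint', ← mul_assoc, hint, mul_assoc])
  have hc1 : c = 1 := by
    have h1 : T (vacuum ι) = c • T (vacuum ι) := by
      have h2 : T * star T * T = T := by rw [mul_assoc, hstar, mul_one]
      rw [hc] at h2
      have := DFunLike.congr_fun h2 (vacuum ι)
      rw [smul_one_mul, smul_apply] at this
      exact this.symm
    have h3 : T (vacuum ι) ≠ 0 := by
      rw [← norm_ne_zero_iff, hTn, norm_ne_zero_iff]
      intro h
      have : ⟪vacuum ι, vacuum ι⟫_ℂ = 1 := by
        rw [vacuum, inner_expVec, inner_zero_left, Complex.exp_zero]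
      rw [h, inner_zero_left] at this
      exact zero_ne_one this
    have h4 : (1 - c) • T (vacuum ι) = 0 := by rw [sub_smul, one_smul, ← h1, sub_self]
    exact (sub_eq_zero.1 ((smul_eq_zero.1 h4).resolve_right h3)).symm
  rw [hc1, one_smul] at hc
  refine ⟨T, Unitary.mem_iff.2 ⟨hstar, hc⟩, fun ξ => ?_⟩
  rw [hint, mul_assoc, hc, mul_one]

end Symplectic

/-! ### Fourier coefficients of continuously differentiable periodic functions -/

/-- A continuously differentiable `2π`-periodic function. -/
structure PeriodicC1 (u : ℝ → ℂ) : Prop where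
  contDiff : ContDiff ℝ 1 u
  periodic : Function.Periodic u (2 * Real.pi)

/-- The `k`-th Fourier coefficient of a complex `2π`-periodic function. -/
def cfCoef (u : ℝ → ℂ) (k : ℤ) : ℂ :=
  (1 / (2 * Real.pi) : ℂ) * ∫ θ in (0 : ℝ)..(2 * Real.pi), Complex.exp (-(Complex.I * k * θ)) * u θ

theorem fourierCoef_eq_cfCoef (f : ℝ → ℝ) (k : ℤ) :
    fourierCoef f k = cfCoef (fun θ => (f θ : ℂ)) k := rfl

theorem cfCoef_eq_fourierCoeffOn (u : ℝ → ℂ) (k : ℤ) :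
    cfCoef u k = fourierCoeffOn Real.two_pi_pos u k := by
  rw [fourierCoeffOn_eq_integral, cfCoef, Complex.real_smul]
  congr 1
  · push_cast
    simp
  · refine intervalIntegral.integral_congr fun θ _ => ?_
    simp only [fourier_coe_apply, smul_eq_mul]
    congr 2
    have : (Real.pi : ℂ) ≠ 0 := by exact_mod_cast Real.pi_ne_zero
    push_cast
    field_simp
    simp
    ring

theorem ofReal_pi_ne_zero : (Real.pi : ℂ) ≠ 0 := by exact_mod_cast Real.pi_ne_zero

theorem hasSum_norm_sq_cfCoef {u : ℝ → ℂ} (hu : Continuous u) :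
    HasSum (fun k => ‖cfCoef u k‖ ^ 2)
      ((2 * Real.pi)⁻¹ * ∫ θ in (0 : ℝ)..(2 * Real.pi), ‖u θ‖ ^ 2) := by
  obtain ⟨C, hC⟩ := isCompact_Icc.exists_bound_of_continuousOn
    (hu.continuousOn (s := Set.Icc (0 : ℝ) (2 * Real.pi)))
  have h := hasSum_sq_fourierCoeffOn Real.two_pi_pos (f := u)
    (MeasureTheory.MemLp.of_bound hu.aestronglyMeasurable C
      ((MeasureTheory.ae_restrict_mem measurableSet_Ioc).mono fun θ hθ =>
        hC θ (Set.Ioc_subset_Icc_self hθ)))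
  simp only [← cfCoef_eq_fourierCoeffOn, sub_zero, smul_eq_mul] at h
  exact h

theorem cfCoef_add {u v : ℝ → ℂ} (hu : Continuous u) (hv : Continuous v) (k : ℤ) :
    cfCoef (fun θ => u θ + v θ) k = cfCoef u k + cfCoef v k := by
  simp only [cfCoef, mul_add]
  rw [intervalIntegral.integral_add, mul_add]
  · exact Continuous.intervalIntegrable (by fun_prop) _ _
  · exact Continuous.intervalIntegrable (by fun_prop) _ _

theorem cfCoef_const_mul (c : ℂ) (u : ℝ → ℂ) (k : ℤ) :
    cfCoef (fun θ => c * u θ) k = c * cfCoef u k := by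
  simp only [cfCoef, mul_left_comm _ c, intervalIntegral.integral_const_mul]

theorem cfCoef_conj (u : ℝ → ℂ) (k : ℤ) :
    cfCoef (fun θ => (starRingEnd ℂ) (u θ)) k = (starRingEnd ℂ) (cfCoef u (-k)) := by
  simp only [cfCoef, map_mul, intervalIntegral, map_sub, ← integral_conj, map_div₀, map_one,
    Complex.conj_ofReal, Complex.conj_ofNat, ← Complex.exp_conj]
  simp

/-- **Parseval's identity**. -/
theorem hasSum_conj_cfCoef_mul {u v : ℝ → ℂ} (hu : Continuous u) (hv : Continuous v) :
    HasSum (fun k => (starRingEnd ℂ) (cfCoef u k) * cfCoef v k)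
      (((2 * Real.pi)⁻¹ : ℝ) *
        ∫ θ in (0 : ℝ)..(2 * Real.pi), (starRingEnd ℂ) (u θ) * v θ) := by
  -- Polarization reduces the sesquilinear identity to the one for norms, both for the coefficients
  -- and under the integral.
  have pol : ∀ a b : ℂ, (starRingEnd ℂ) a * b = ((‖a + 1 * b‖ ^ 2 : ℝ) : ℂ) * (1 / 4)
      + ((‖a + (-1) * b‖ ^ 2 : ℝ) : ℂ) * (-1 / 4) + ((‖a + Complex.I * b‖ ^ 2 : ℝ) : ℂ) *
        (-Complex.I / 4) + ((‖a + (-Complex.I) * b‖ ^ 2 : ℝ) : ℂ) * (Complex.I / 4) := by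
    intro a b
    simp only [Complex.ofReal_pow, ← Complex.conj_mul', map_add, map_mul, map_neg, map_one,
      Complex.conj_I]
    linear_combination ((1 / 2 : ℂ) * b * (starRingEnd ℂ) a
      - (1 / 2 : ℂ) * a * (starRingEnd ℂ) b) * Complex.I_mul_I
  have h : ∀ c : ℂ, HasSum (fun k => ((‖cfCoef u k + c * cfCoef v k‖ ^ 2 : ℝ) : ℂ))
      (((2 * Real.pi)⁻¹ : ℝ) *
        ∫ θ in (0 : ℝ)..(2 * Real.pi), ((‖u θ + c * v θ‖ ^ 2 : ℝ) : ℂ)) := by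
    intro c
    have h1 := hasSum_norm_sq_cfCoef (u := fun θ => u θ + c * v θ) (by fun_prop)
    have e : ∀ k, cfCoef (fun θ => u θ + c * v θ) k = cfCoef u k + c * cfCoef v k := fun k => by
      rw [cfCoef_add hu (by fun_prop), cfCoef_const_mul]
    simp only [e] at h1
    rw [intervalIntegral.integral_ofReal, ← Complex.ofReal_mul, Complex.hasSum_ofReal]
    exact h1
  have h2 := (((h 1).mul_right (1 / 4)).add ((h (-1)).mul_right (-1 / 4))).add
    ((h Complex.I).mul_right (-Complex.I / 4)) |>.add ((h (-Complex.I)).mul_right (Complex.I / 4))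
  simp only [← pol] at h2
  refine (congrArg (HasSum _) ?_).mp h2
  symm
  rw [mul_assoc, mul_assoc, mul_assoc, mul_assoc, ← mul_add, ← mul_add, ← mul_add]
  congr 1
  rw [intervalIntegral.integral_congr fun θ _ => pol (u θ) (v θ)]
  have hI : ∀ c d : ℂ, IntervalIntegrable
      (fun θ => ((‖u θ + c * v θ‖ ^ 2 : ℝ) : ℂ) * d) MeasureTheory.volume 0 (2 * Real.pi) :=
    fun c d => Continuous.intervalIntegrable (by fun_prop) _ _
  rw [intervalIntegral.integral_add (((hI _ _).add (hI _ _)).add (hI _ _)) (hI _ _),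
    intervalIntegral.integral_add ((hI _ _).add (hI _ _)) (hI _ _),
    intervalIntegral.integral_add (hI _ _) (hI _ _)]
  simp only [intervalIntegral.integral_mul_const]

theorem PeriodicC1.hasDerivAt {u : ℝ → ℂ} (hu : PeriodicC1 u) (θ : ℝ) :
    HasDerivAt u (deriv u θ) θ :=
  ((hu.contDiff.differentiable one_ne_zero) θ).hasDerivAt

theorem PeriodicC1.continuous_deriv {u : ℝ → ℂ} (hu : PeriodicC1 u) : Continuous (deriv u) :=
  hu.contDiff.continuous_deriv le_rfl

theorem PeriodicC1.continuous {u : ℝ → ℂ} (hu : PeriodicC1 u) : Continuous u :=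
  hu.contDiff.continuous

theorem PeriodicC1.conj {u : ℝ → ℂ} (hu : PeriodicC1 u) :
    PeriodicC1 fun θ => (starRingEnd ℂ) (u θ) where
  contDiff := Complex.conjCLE.contDiff.comp hu.contDiff
  periodic θ := by simp only [hu.periodic θ]

/-- The integral of a derivative over a period vanishes. -/
theorem integral_deriv_period {u u' : ℝ → ℂ} (h : ∀ θ, HasDerivAt u (u' θ) θ)
    (hc : Continuous u') (hp : Function.Periodic u (2 * Real.pi)) :
    ∫ θ in (0 : ℝ)..(2 * Real.pi), u' θ = 0 := by
  rw [intervalIntegral.integral_eq_sub_of_hasDerivAt (fun θ _ => h θ) (hc.intervalIntegrable _ _)]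
  have := hp 0
  rw [zero_add] at this
  rw [this, sub_self]

theorem hasDerivAt_exp_int (k : ℤ) (θ : ℝ) :
    HasDerivAt (fun θ : ℝ => Complex.exp (Complex.I * k * θ))
      (Complex.I * k * Complex.exp (Complex.I * k * θ)) θ := by
  have h1 : HasDerivAt (fun θ : ℝ => (θ : ℂ)) 1 θ := Complex.ofRealCLM.hasDerivAt
  have h2 := (h1.const_mul (Complex.I * k)).cexp
  convert h2 using 1
  ring

theorem exp_int_period (k : ℤ) (θ : ℝ) :
    Complex.exp (Complex.I * k * ((θ + 2 * Real.pi : ℝ) : ℂ)) = Complex.exp (Complex.I * k * θ) := by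
  rw [Complex.exp_eq_exp_iff_exists_int]
  exact ⟨k, by push_cast; ring⟩

theorem periodicC1_exp (k : ℤ) : PeriodicC1 fun θ : ℝ => Complex.exp (Complex.I * k * θ) where
  contDiff := by
    have : ContDiff ℝ 1 fun θ : ℝ => (θ : ℂ) := Complex.ofRealCLM.contDiff
    exact (contDiff_const.mul this).cexp
  periodic := exp_int_period k

theorem cfCoef_deriv {u : ℝ → ℂ} (hu : PeriodicC1 u) (k : ℤ) :
    cfCoef (deriv u) k = Complex.I * k * cfCoef u k := by
  have h1 : ∀ θ : ℝ, HasDerivAt (fun θ : ℝ => Complex.exp (Complex.I * (-k : ℤ) * θ) * u θ)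
      (Complex.I * (-k : ℤ) * Complex.exp (Complex.I * (-k : ℤ) * θ) * u θ
        + Complex.exp (Complex.I * (-k : ℤ) * θ) * deriv u θ) θ := fun θ =>
    (hasDerivAt_exp_int (-k) θ).mul (hu.hasDerivAt θ)
  have c1 := hu.continuous
  have c2 := hu.continuous_deriv
  have h2 := integral_deriv_period h1 (by fun_prop) (fun θ => by
    simp only [exp_int_period, hu.periodic θ])
  simp only [mul_assoc (Complex.I * _)] at h2
  rw [intervalIntegral.integral_add (Continuous.intervalIntegrable (by fun_prop) _ _)
    (Continuous.intervalIntegrable (by fun_prop) _ _), intervalIntegral.integral_const_mul] at h2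
  have e : ∀ θ : ℝ, Complex.exp (-(Complex.I * k * θ)) = Complex.exp (Complex.I * (-k : ℤ) * θ) := by
    intro θ
    congr 1
    push_cast
    ring
  simp only [cfCoef, e]
  rw [eq_neg_of_add_eq_zero_right h2]
  push_cast
  ring

theorem summable_sq_mul_cfCoef {u : ℝ → ℂ} (hu : PeriodicC1 u) :
    Summable fun k : ℤ => (k : ℝ) ^ 2 * ‖cfCoef u k‖ ^ 2 := by
  refine (hasSum_norm_sq_cfCoef hu.continuous_deriv).summable.congr fun k => ?_
  rw [cfCoef_deriv hu, norm_mul, norm_mul, Complex.norm_I, one_mul, mul_pow]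
  simp

/-- |ûₖ| ≤ 1/k² + k²|ûₖ|² for k ≠ 0, by the arithmetic-geometric mean inequality. At k = 0 the right
side is 0 with the convention 1/0 = 0, so that term is added separately. -/
theorem summable_norm_cfCoef {u : ℝ → ℂ} (hu : PeriodicC1 u) :
    Summable fun k : ℤ => ‖cfCoef u k‖ := by
  have h1 : Summable fun k : ℤ => 1 / (k : ℝ) ^ 2 := Real.summable_one_div_int_pow.2 one_lt_two
  have h2 : Summable fun k : ℤ => if k = 0 then ‖cfCoef u 0‖ else 0 :=
    (hasSum_ite_eq 0 _).summable
  refine ((h1.add (summable_sq_mul_cfCoef hu)).add h2).of_nonneg_of_le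
    (fun _ => norm_nonneg _) fun k => ?_
  by_cases hk : k = 0
  · subst hk
    simp
  · have hk' : (0 : ℝ) < (k : ℝ) ^ 2 := by positivity
    have h3 : 0 ≤ ‖cfCoef u k‖ := norm_nonneg _
    rw [if_neg hk, add_zero, div_add' _ _ _ hk'.ne', le_div_iff₀ hk']
    nlinarith [sq_nonneg ((k : ℝ) ^ 2 * ‖cfCoef u k‖ - 1)]

/-- The Fourier series of a continuous periodic function with summable coefficients. -/
theorem hasSum_cfCoef_exp {u : ℝ → ℂ} (hu : Continuous u) (hp : Function.Periodic u (2 * Real.pi))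
    (hs : Summable fun k : ℤ => ‖cfCoef u k‖) (θ : ℝ) :
    HasSum (fun k : ℤ => cfCoef u k * Complex.exp (Complex.I * k * θ)) (u θ) := by
  have : Fact (0 < 2 * Real.pi) := ⟨Real.two_pi_pos⟩
  let U : C(AddCircle (2 * Real.pi), ℂ) := ⟨hp.lift, continuous_coinduced_dom.2 hu⟩
  have hU : ∀ θ : ℝ, U θ = u θ := fun θ => rfl
  have hc : ∀ k, fourierCoeff U k = cfCoef u k := by
    intro k
    rw [fourierCoeff_eq_intervalIntegral U k 0, cfCoef, Complex.real_smul, zero_add]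
    congr 1
    · push_cast
      rfl
    · refine intervalIntegral.integral_congr fun θ _ => ?_
      simp only [fourier_coe_apply, smul_eq_mul, hU]
      congr 2
      have := ofReal_pi_ne_zero
      push_cast
      field_simp
  have h := has_pointwise_sum_fourier_series_of_summable (f := U)
    (hs.of_norm.congr fun k => (hc k).symm) (θ : AddCircle (2 * Real.pi))
  simp only [hc, hU, smul_eq_mul] at h
  convert h using 1
  funext k
  rw [fourier_coe_apply]
  congr 2
  have := ofReal_pi_ne_zero
  push_cast
  field_simp

/-! ### Positive frequency parts and the symplectic form -/

theorem memℓp_posPart {u : ℝ → ℂ} (hu : PeriodicC1 u) :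
    Memℓp (fun k : ℕ+ => ((√(k : ℝ) : ℝ) : ℂ) * cfCoef u ((k : ℕ) : ℤ)) 2 := by
  refine memℓp_gen ?_
  have hinj : Function.Injective fun k : ℕ+ => ((k : ℕ) : ℤ) := fun a b h =>
    PNat.coe_injective (Int.ofNat_inj.1 h)
  refine Summable.of_nonneg_of_le (fun k => by positivity) (fun k => ?_)
    ((summable_sq_mul_cfCoef hu).comp_injective hinj)
  rw [ENNReal.toReal_ofNat, Real.rpow_ofNat, norm_mul, mul_pow, Complex.norm_real,
    Real.norm_eq_abs, sq_abs, Real.sq_sqrt (by positivity)]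
  refine mul_le_mul_of_nonneg_right ?_ (by positivity)
  have : (1 : ℝ) ≤ k := by exact Nat.one_le_cast.2 k.pos
  push_cast
  nlinarith

/-- The class in the one-particle space of the positive frequency part of a periodic function. -/
def posPart (u : ℝ → ℂ) (hu : PeriodicC1 u) : OneParticle := ⟨_, memℓp_posPart hu⟩

theorem posPart_apply {u : ℝ → ℂ} (hu : PeriodicC1 u) (k : ℕ+) :
    posPart u hu k = ((√(k : ℝ) : ℝ) : ℂ) * cfCoef u ((k : ℕ) : ℤ) := rfl

theorem ofReal_sqrt_mul_self (k : ℕ+) :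
    ((√(k : ℝ) : ℝ) : ℂ) * ((√(k : ℝ) : ℝ) : ℂ) = ((k : ℕ) : ℂ) := by
  rw [← Complex.ofReal_mul, Real.mul_self_sqrt (by positivity)]
  simp

theorem ofReal_sqrt_ne_zero (k : ℕ+) : ((√(k : ℝ) : ℝ) : ℂ) ≠ 0 := by
  have : (0 : ℝ) < k := by exact_mod_cast k.pos
  exact_mod_cast (Real.sqrt_pos.2 this).ne'

theorem hasSum_inner_posPart {u v : ℝ → ℂ} (hu : PeriodicC1 u) (hv : PeriodicC1 v) :
    HasSum (fun k : ℕ+ => ((k : ℕ) : ℂ) * ((starRingEnd ℂ) (cfCoef u ((k : ℕ) : ℤ)) *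
      cfCoef v ((k : ℕ) : ℤ))) ⟪posPart u hu, posPart v hv⟫_ℂ := by
  refine (congrArg (fun f => HasSum f _) (funext fun k => ?_)).mp
    (lp.hasSum_inner (𝕜 := ℂ) (posPart u hu) (posPart v hv))
  rw [RCLike.inner_apply, posPart_apply, posPart_apply, map_mul, Complex.conj_ofReal,
    ← ofReal_sqrt_mul_self]
  ring

/-- The sesquilinear form `(1 / 2πi) ∫ u^* v'`, whose restriction to real functions is the
symplectic form. -/
def circleForm (u v : ℝ → ℂ) : ℂ :=
  -Complex.I * (((2 * Real.pi)⁻¹ : ℝ) *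
    ∫ θ in (0 : ℝ)..(2 * Real.pi), (starRingEnd ℂ) (u θ) * deriv v θ)

theorem hasSum_circleForm {u v : ℝ → ℂ} (hu : PeriodicC1 u) (hv : PeriodicC1 v) :
    HasSum (fun k : ℤ => (k : ℂ) * ((starRingEnd ℂ) (cfCoef u k) * cfCoef v k))
      (circleForm u v) := by
  have h := (hasSum_conj_cfCoef_mul hu.continuous hv.continuous_deriv).mul_left (-Complex.I)
  refine (congrArg (fun f => HasSum f _) (funext fun k => ?_)).mp h
  rw [cfCoef_deriv hv]
  linear_combination (-(k : ℂ) * (starRingEnd ℂ) (cfCoef u k) * cfCoef v k) * Complex.I_mul_I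

/-- A sum over the nonzero integers is the sum over the positive and the negative ones. -/
theorem hasSum_int_of_pnat {f : ℤ → ℂ} (h0 : f 0 = 0) {p m : ℂ}
    (hp : HasSum (fun k : ℕ+ => f ((k : ℕ) : ℤ)) p)
    (hm : HasSum (fun k : ℕ+ => f (-((k : ℕ) : ℤ))) m) : HasSum f (p + m) := by
  have h1 : HasSum (fun k : ℤ => if 0 < k then f k else 0) p := by
    have hinj : Function.Injective fun k : ℕ+ => ((k : ℕ) : ℤ) := fun a b h =>
      PNat.coe_injective (Int.ofNat_inj.1 h)
    rw [← hinj.hasSum_iff]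
    · refine (congrArg (fun f => HasSum f _) (funext fun k => ?_)).mp hp
      simp
    · intro k hk
      rw [if_neg]
      intro h
      exact hk ⟨⟨k.toNat, by omega⟩, by simpa using h.le⟩
  have h2 : HasSum (fun k : ℤ => if k < 0 then f k else 0) m := by
    have hinj : Function.Injective fun k : ℕ+ => -((k : ℕ) : ℤ) := fun a b h =>
      PNat.coe_injective (Int.ofNat_inj.1 (neg_injective h))
    rw [← hinj.hasSum_iff]
    · refine (congrArg (fun f => HasSum f _) (funext fun k => ?_)).mp hm
      simp
    · intro k hk
      rw [if_neg]
      intro h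
      refine hk ⟨⟨(-k).toNat, by omega⟩, ?_⟩
      simp only [PNat.mk_coe]
      omega
  refine (congrArg (fun f => HasSum f _) (funext fun k => ?_)).mp (h1.add h2)
  rcases lt_trichotomy k 0 with h | h | h
  · simp [h, h.not_gt]
  · simp [h, h0]
  · simp [h, h.not_gt]

/-- In the Fourier expansion of the form, negative frequencies enter with the opposite sign and are
the positive frequencies of the conjugate functions. For real functions the left side is 2i times
the imaginary part of the scalar product. -/
theorem inner_posPart_sub {u v : ℝ → ℂ} (hu : PeriodicC1 u) (hv : PeriodicC1 v) :
    ⟪posPart u hu, posPart v hv⟫_ℂ - (starRingEnd ℂ) ⟪posPart _ hu.conj, posPart _ hv.conj⟫_ℂ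
      = circleForm u v := by
  have hm : HasSum (fun k : ℕ+ => ((-((k : ℕ) : ℤ) : ℤ) : ℂ) *
      ((starRingEnd ℂ) (cfCoef u (-((k : ℕ) : ℤ))) * cfCoef v (-((k : ℕ) : ℤ))))
      (-(starRingEnd ℂ) ⟪posPart _ hu.conj, posPart _ hv.conj⟫_ℂ) := by
    have h := (Complex.hasSum_conj'.2 (hasSum_inner_posPart hu.conj hv.conj)).neg
    refine (congrArg (fun f => HasSum f _) (funext fun k => ?_)).mp h
    rw [cfCoef_conj, cfCoef_conj, map_mul, map_mul, Complex.conj_conj, Complex.conj_conj,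
      Complex.conj_natCast]
    push_cast
    ring
  have hp := hasSum_inner_posPart hu hv
  rw [sub_eq_add_neg]
  refine HasSum.unique (hasSum_int_of_pnat (f := fun k : ℤ => (k : ℂ) *
    ((starRingEnd ℂ) (cfCoef u k) * cfCoef v k)) (by simp) ?_ hm) (hasSum_circleForm hu hv)
  refine (congrArg (fun f => HasSum f _) (funext fun k => ?_)).mp hp
  push_cast
  rfl

/-! ### Composition with a diffeomorphism -/

/-- A lift to the real line of an orientation preserving `C¹` diffeomorphism of the circle. -/
structure IsCircleLift (g : ℝ → ℝ) : Prop where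
  contDiff : ContDiff ℝ 1 g
  deriv_pos : ∀ θ, 0 < deriv g θ
  map_add_period : ∀ θ, g (θ + 2 * Real.pi) = g θ + 2 * Real.pi

section Composition

variable {g : ℝ → ℝ}

theorem PeriodicC1.comp {u : ℝ → ℂ} (hu : PeriodicC1 u) (hg : IsCircleLift g) :
    PeriodicC1 fun θ => u (g θ) where
  contDiff := hu.contDiff.comp hg.contDiff
  periodic θ := by simp only [hg.map_add_period, hu.periodic (g θ)]

/-- The integral of the one-form ū dv over the circle does not depend on the parametrization. This
is why composition is symplectic. -/
theorem circleForm_comp {u v : ℝ → ℂ} (hu : PeriodicC1 u) (hv : PeriodicC1 v)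
    (hg : IsCircleLift g) :
    circleForm (fun θ => u (g θ)) (fun θ => v (g θ)) = circleForm u v := by
  rw [circleForm, circleForm]
  congr 2
  have hgd : ∀ θ, HasDerivAt g (deriv g θ) θ := fun θ =>
    ((hg.contDiff.differentiable one_ne_zero) θ).hasDerivAt
  have hd : ∀ θ, deriv (fun θ => v (g θ)) θ = deriv g θ • deriv v (g θ) := fun θ =>
    ((hv.hasDerivAt (g θ)).scomp θ (hgd θ)).deriv
  have c1 := hu.continuous
  have c2 := hv.continuous_deriv
  have h1 := intervalIntegral.integral_deriv_smul_comp (a := 0) (b := 2 * Real.pi)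
    (f := g) (f' := deriv g) (g := fun θ => (starRingEnd ℂ) (u θ) * deriv v θ)
    (fun θ _ => hgd θ) (hg.contDiff.continuous_deriv le_rfl).continuousOn (by fun_prop)
  have hper : Function.Periodic (fun θ => (starRingEnd ℂ) (u θ) * deriv v θ) (2 * Real.pi) := by
    intro θ
    have : deriv v (θ + 2 * Real.pi) = deriv v θ := by
      rw [← deriv_comp_add_const]
      congr 1
      exact funext hv.periodic
    simp only [hu.periodic θ, this]
  have h2 : g (2 * Real.pi) = g 0 + 2 * Real.pi := by
    have := hg.map_add_period 0
    rwa [zero_add] at this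
  rw [h2, hper.intervalIntegral_add_eq (g 0) 0, zero_add] at h1
  rw [← h1]
  refine intervalIntegral.integral_congr fun θ _ => ?_
  simp only [hd, Function.comp_apply, Complex.real_smul]
  ring

theorem circleForm_exp (j k : ℤ) : circleForm (fun θ : ℝ => Complex.exp (Complex.I * j * θ))
    (fun θ : ℝ => Complex.exp (Complex.I * k * θ)) = if j = k then (k : ℂ) else 0 := by
  have h1 : ∀ θ : ℝ, (starRingEnd ℂ) (Complex.exp (Complex.I * j * θ)) *
      deriv (fun θ : ℝ => Complex.exp (Complex.I * k * θ)) θ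
        = Complex.I * k * Complex.exp (Complex.I * (k - j : ℤ) * θ) := by
    intro θ
    rw [(hasDerivAt_exp_int k θ).deriv, ← Complex.exp_conj, mul_left_comm, ← Complex.exp_add]
    congr 2
    simp
    ring
  rw [circleForm, intervalIntegral.integral_congr fun θ _ => h1 θ,
    intervalIntegral.integral_const_mul, integral_exp_int]
  have hpi := ofReal_pi_ne_zero
  by_cases h : j = k
  · subst h
    simp only [sub_self, if_true]
    push_cast
    field_simp
    simp
  · rw [if_neg (by omega), if_neg h]
    simp

/-- The class of `e^{ikg} / √k`, `k ≥ 1`. -/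
def expClass (hg : IsCircleLift g) (k : ℕ+) : OneParticle :=
  ((√(k : ℝ) : ℝ) : ℂ)⁻¹ • posPart _ ((periodicC1_exp ((k : ℕ) : ℤ)).comp hg)

/-- The class of `e^{-ikg} / √k`, `k ≥ 1`. -/
def expNegClass (hg : IsCircleLift g) (k : ℕ+) : OneParticle :=
  ((√(k : ℝ) : ℝ) : ℂ)⁻¹ • posPart _ ((periodicC1_exp (-((k : ℕ) : ℤ))).comp hg)

/-- The form is invariant under composition and diagonal on the exponentials. Hence the `expClass`
vectors fail to be orthonormal only by the Gram matrix of the `expNegClass` vectors, whose square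
summability therefore controls both families. -/
theorem inner_expClass (hg : IsCircleLift g) (j k : ℕ+) :
    ⟪expClass hg j, expClass hg k⟫_ℂ
      = (if j = k then 1 else 0) + ⟪expNegClass hg k, expNegClass hg j⟫_ℂ := by
  have h := inner_posPart_sub ((periodicC1_exp ((j : ℕ) : ℤ)).comp hg)
    ((periodicC1_exp ((k : ℕ) : ℤ)).comp hg)
  rw [circleForm_comp (periodicC1_exp _) (periodicC1_exp _) hg, circleForm_exp,
    inner_conj_symm] at h
  have e : ∀ k : ℕ+, posPart _ ((periodicC1_exp ((k : ℕ) : ℤ)).comp hg).conj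
      = posPart _ ((periodicC1_exp (-((k : ℕ) : ℤ))).comp hg) := by
    intro k
    congr 1
    funext θ
    rw [← Complex.exp_conj]
    simp
  rw [e, e] at h
  have e2 : (((j : ℕ) : ℤ) = ((k : ℕ) : ℤ)) ↔ j = k := by
    rw [Int.natCast_inj, PNat.coe_inj]
  simp only [e2] at h
  rw [expClass, expClass, expNegClass, expNegClass, inner_smul_left, inner_smul_right,
    inner_smul_left, inner_smul_right, eq_add_of_sub_eq h, map_inv₀, map_inv₀,
    Complex.conj_ofReal, Complex.conj_ofReal, mul_add, mul_add]
  congr 1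
  · split_ifs with hjk
    · subst hjk
      have := ofReal_sqrt_ne_zero j
      have h2 := ofReal_sqrt_mul_self j
      rw [Int.cast_natCast, ← h2]
      field_simp
    · simp
  · ring

theorem norm_sq_sum_expClass (hg : IsCircleLift g) (S : Finset ℕ+) (c : ℕ+ → ℂ) :
    ‖∑ k ∈ S, c k • expClass hg k‖ ^ 2 = ∑ k ∈ S, ‖c k‖ ^ 2
      + ‖∑ k ∈ S, (starRingEnd ℂ) (c k) • expNegClass hg k‖ ^ 2 := by
  apply Complex.ofReal_injective
  push_cast
  rw [ofReal_norm_sq, ofReal_norm_sq, sum_inner, sum_inner]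
  simp only [inner_sum, inner_smul_left, inner_smul_right, inner_expClass, mul_add,
    Finset.sum_add_distrib, Complex.conj_conj]
  congr 1
  · refine Finset.sum_congr rfl fun k hk => ?_
    rw [Finset.sum_eq_single k]
    · rw [if_pos rfl, mul_one, Complex.mul_conj']
    · intro b _ hb
      rw [if_neg (Ne.symm hb), mul_zero, mul_zero]
    · exact fun h => (h hk).elim
  · rw [Finset.sum_comm]
    refine Finset.sum_congr rfl fun j _ => Finset.sum_congr rfl fun k _ => ?_
    ring

theorem norm_sum_smul_le {E : Type} [NormedAddCommGroup E] [NormedSpace ℂ E] {b : ℕ+ → E}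
    (hb : Summable fun k => ‖b k‖ ^ 2) (S : Finset ℕ+) (c : ℕ+ → ℂ) :
    ‖∑ k ∈ S, c k • b k‖ ^ 2 ≤ (∑' k, ‖b k‖ ^ 2) * ∑ k ∈ S, ‖c k‖ ^ 2 := by
  have h1 : ‖∑ k ∈ S, c k • b k‖ ≤ ∑ k ∈ S, ‖c k‖ * ‖b k‖ := by
    refine (norm_sum_le _ _).trans (le_of_eq ?_)
    simp only [norm_smul]
  calc ‖∑ k ∈ S, c k • b k‖ ^ 2 ≤ (∑ k ∈ S, ‖c k‖ * ‖b k‖) ^ 2 :=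
        pow_le_pow_left₀ (norm_nonneg _) h1 2
    _ ≤ (∑ k ∈ S, ‖c k‖ ^ 2) * ∑ k ∈ S, ‖b k‖ ^ 2 := Finset.sum_mul_sq_le_sq_mul_sq _ _ _
    _ ≤ (∑ k ∈ S, ‖c k‖ ^ 2) * ∑' k, ‖b k‖ ^ 2 :=
        mul_le_mul_of_nonneg_left (hb.sum_le_tsum _ fun _ _ => by positivity) (by positivity)
    _ = _ := mul_comm _ _

/-- The composition operator `[f] ↦ [f ∘ g]` on the one-particle space, defined on the
orthonormal basis. -/
theorem exists_compositionOperator (hg : IsCircleLift g)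
    (hb : Summable fun k => ‖expNegClass hg k‖ ^ 2) :
    ∃ T : OneParticle →L[ℝ] OneParticle, ∀ (k : ℕ+) (c : ℂ), T (lp.single 2 k c)
      = c • expClass hg k + (starRingEnd ℂ) c • expNegClass hg k := by
  -- The vector with the single coordinate c at k is the class of 2 Re(c e^{ikθ})/√k; substituting
  -- g(θ) for θ gives the formula. The operator is `f` composed with the inverse of `e`, extended by
  -- continuity.
  let f : (ℕ+ →₀ ℂ) →ₗ[ℝ] OneParticle := Finsupp.lsum ℝ fun k =>
    { toFun := fun c : ℂ => c • expClass hg k + (starRingEnd ℂ) c • expNegClass hg k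
      map_add' := fun x y => by
        rw [map_add]
        module
      map_smul' := fun r x => by
        rw [Complex.real_smul, map_mul, Complex.conj_ofReal, RingHom.id_apply, real_smul_eq]
        module }
  let e : (ℕ+ →₀ ℂ) →ₗ[ℝ] OneParticle := Finsupp.lsum ℝ fun k =>
    { toFun := fun c : ℂ => lp.single 2 k c
      map_add' := fun x y => lp.single_add _ _ _ _
      map_smul' := fun r x => lp.single_smul _ _ _ _ }
  have hf : ∀ c : ℕ+ →₀ ℂ, f c = ∑ k ∈ c.support, c k • expClass hg k
      + ∑ k ∈ c.support, (starRingEnd ℂ) (c k) • expNegClass hg k := by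
    intro c
    rw [← Finset.sum_add_distrib]
    rfl
  have he : ∀ c : ℕ+ →₀ ℂ, ‖e c‖ ^ 2 = ∑ k ∈ c.support, ‖c k‖ ^ 2 := by
    intro c
    have e1 : e c = ∑ k ∈ c.support, lp.single 2 k (c k) := rfl
    rw [e1]
    have := lp.norm_sum_single (p := 2) (E := fun _ : ℕ+ => ℂ) (by norm_num) (fun j => c j)
      c.support
    simpa using this
  have hdense : DenseRange e := by
    intro ξ
    refine mem_closure_of_tendsto (lp.hasSum_single (p := 2) (by norm_num) ξ)
      (Filter.Eventually.of_forall fun S => ?_)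
    refine ⟨∑ k ∈ S, Finsupp.single k (ξ k), ?_⟩
    rw [map_sum]
    refine Finset.sum_congr rfl fun k _ => ?_
    exact Finsupp.lsum_single _ _ _ _
  set h := ∑' k, ‖expNegClass hg k‖ ^ 2 with hh
  have hh0 : 0 ≤ h := tsum_nonneg fun _ => by positivity
  -- The antilinear sum is bounded by √h through Cauchy-Schwarz; `norm_sq_sum_expClass` then gives
  -- √(1 + h) for the linear sum.
  have hbound : ∀ c, ‖f c‖ ≤ (√(1 + h) + √h) * ‖e c‖ := by
    intro c
    have h1 : ‖∑ k ∈ c.support, (starRingEnd ℂ) (c k) • expNegClass hg k‖ ^ 2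
        ≤ h * ‖e c‖ ^ 2 := by
      rw [he]
      simpa using norm_sum_smul_le hb c.support (fun k => (starRingEnd ℂ) (c k))
    have h2 : ‖∑ k ∈ c.support, c k • expClass hg k‖ ^ 2 ≤ (1 + h) * ‖e c‖ ^ 2 := by
      rw [norm_sq_sum_expClass, ← he]
      linarith
    rw [hf, add_mul]
    refine (norm_add_le _ _).trans (add_le_add ?_ ?_)
    · rw [← Real.sqrt_sq (norm_nonneg (e c)), ← Real.sqrt_mul (by linarith)]
      exact Real.le_sqrt_of_sq_le h2
    · rw [← Real.sqrt_sq (norm_nonneg (e c)), ← Real.sqrt_mul hh0]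
      exact Real.le_sqrt_of_sq_le h1
  refine ⟨f.extendOfNorm e, fun k c => ?_⟩
  have h1 := LinearMap.extendOfNorm_eq hdense ⟨_, hbound⟩ (Finsupp.single k c)
  have h2 : e (Finsupp.single k c) = lp.single 2 k c := Finsupp.lsum_single _ _ _ _
  have h3 : f (Finsupp.single k c) = c • expClass hg k
      + (starRingEnd ℂ) c • expNegClass hg k := Finsupp.lsum_single _ _ _ _
  rw [h2, h3] at h1
  exact h1

end Composition

/-! ### The composition operator on functions, its symplecticity and its inverse -/

section CompositionOperator

variable {g : ℝ → ℝ}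

/-- Fourier coefficients of `u ∘ g` from the Fourier series of `u`. -/
theorem hasSum_cfCoef_comp {u : ℝ → ℂ} (hu : PeriodicC1 u) (hg : IsCircleLift g) (l : ℤ) :
    HasSum (fun k : ℤ => cfCoef u k * cfCoef (fun θ => Complex.exp (Complex.I * k * g θ)) l)
      (cfCoef (fun θ => u (g θ)) l) := by
  have hs := summable_norm_cfCoef hu
  have hgc := hg.contDiff.continuous
  have hn : ∀ (l : ℤ) (θ : ℝ), ‖Complex.exp (Complex.I * l * θ)‖ = 1 := by
    intro l θ
    simp [Complex.norm_exp]
  have hn' : ∀ (l : ℤ) (θ : ℝ), ‖Complex.exp (-(Complex.I * l * θ))‖ = 1 := by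
    intro l θ
    simp [Complex.norm_exp]
  have h := intervalIntegral.hasSum_integral_of_dominated_convergence
    (μ := MeasureTheory.volume) (a := 0) (b := 2 * Real.pi)
    (F := fun (k : ℤ) θ => Complex.exp (-(Complex.I * l * θ)) *
      (cfCoef u k * Complex.exp (Complex.I * k * g θ)))
    (f := fun θ => Complex.exp (-(Complex.I * l * θ)) * u (g θ))
    (fun k _ => ‖cfCoef u k‖)
    (fun k => Continuous.aestronglyMeasurable (by fun_prop))
    (fun k => Filter.Eventually.of_forall fun θ _ => by
      rw [norm_mul, norm_mul, hn, hn', one_mul, mul_one])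
    (Filter.Eventually.of_forall fun θ _ => hs) intervalIntegrable_const
    (Filter.Eventually.of_forall fun θ _ =>
      (hasSum_cfCoef_exp hu.continuous hu.periodic hs (g θ)).mul_left _)
  refine (congrArg (fun f => HasSum f _) (funext fun k => ?_)).mp
    (h.mul_left (1 / (2 * Real.pi) : ℂ))
  generalize cfCoef u k = c
  rw [cfCoef, ← intervalIntegral.integral_const_mul, ← intervalIntegral.integral_const_mul,
    ← intervalIntegral.integral_const_mul]
  refine intervalIntegral.integral_congr fun θ _ => ?_
  ring

theorem norm_cfCoef_exp_le (g : ℝ → ℝ) (k l : ℤ) :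
    ‖cfCoef (fun θ => Complex.exp (Complex.I * k * g θ)) l‖ ≤ 1 := by
  have h1 : ‖∫ θ in (0 : ℝ)..(2 * Real.pi), Complex.exp (-(Complex.I * l * θ)) *
      Complex.exp (Complex.I * k * g θ)‖ ≤ 1 * |2 * Real.pi - 0| := by
    refine intervalIntegral.norm_integral_le_of_norm_le_const fun θ _ => ?_
    rw [norm_mul]
    simp [Complex.norm_exp]
  rw [cfCoef, norm_mul]
  have h2 : ‖(1 / (2 * Real.pi) : ℂ)‖ = (2 * Real.pi)⁻¹ := by
    rw [one_div, norm_inv, norm_mul, Complex.norm_real, Real.norm_of_nonneg Real.pi_pos.le]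
    simp
  rw [h2, inv_mul_le_iff₀ Real.two_pi_pos, mul_one]
  rwa [one_mul, sub_zero, abs_of_pos Real.two_pi_pos] at h1

/-- Both sides have the same l-th coordinate. Continuity of `T` gives a series over k ≥ 1, while the
Fourier series of u ∘ g runs over all k. The terms ±k match because û₋ₖ is the conjugate of ûₖ, and
k = 0 contributes nothing to a frequency l ≥ 1. -/
theorem compositionOperator_posPart (hg : IsCircleLift g) {T : OneParticle →L[ℝ] OneParticle}
    (hT : ∀ (k : ℕ+) (c : ℂ), T (lp.single 2 k c)
      = c • expClass hg k + (starRingEnd ℂ) c • expNegClass hg k)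
    {u : ℝ → ℂ} (hu : PeriodicC1 u) (hreal : ∀ θ, (starRingEnd ℂ) (u θ) = u θ) :
    T (posPart u hu) = posPart _ (hu.comp hg) := by
  apply lp.ext
  funext l
  have hF := hasSum_cfCoef_comp hu hg ((l : ℕ) : ℤ)
  set F : ℤ → ℂ := fun k =>
    cfCoef u k * cfCoef (fun θ => Complex.exp (Complex.I * k * g θ)) ((l : ℕ) : ℤ) with hFdef
  have hF0 : F 0 = 0 := by
    have h1 : cfCoef (fun θ => Complex.exp (Complex.I * (0 : ℤ) * g θ)) ((l : ℕ) : ℤ) = 0 := by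
      have h2 : ∀ θ : ℝ, Complex.exp (-(Complex.I * ((l : ℕ) : ℤ) * θ)) *
          Complex.exp (Complex.I * (0 : ℤ) * g θ)
            = Complex.exp (Complex.I * (-((l : ℕ) : ℤ) : ℤ) * θ) := by
        intro θ
        rw [← Complex.exp_add]
        congr 1
        push_cast
        ring
      have hl := l.pos
      rw [cfCoef, intervalIntegral.integral_congr fun θ _ => h2 θ, integral_exp_int,
        if_neg (by omega), mul_zero]
    simp only [hFdef, h1, mul_zero]
  have hsF : Summable fun k => ‖F k‖ := by
    refine (summable_norm_cfCoef hu).of_nonneg_of_le (fun _ => norm_nonneg _) fun k => ?_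
    rw [hFdef, norm_mul]
    exact mul_le_of_le_one_right (norm_nonneg _) (norm_cfCoef_exp_le g _ _)
  have hp : Summable fun k : ℕ+ => F ((k : ℕ) : ℤ) :=
    (hsF.comp_injective (i := fun k : ℕ+ => ((k : ℕ) : ℤ)) fun a b h =>
      PNat.coe_injective (Int.ofNat_inj.1 h)).of_norm
  have hm : Summable fun k : ℕ+ => F (-((k : ℕ) : ℤ)) :=
    (hsF.comp_injective (i := fun k : ℕ+ => -((k : ℕ) : ℤ)) fun a b h =>
      PNat.coe_injective (Int.ofNat_inj.1 (neg_injective h))).of_norm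
  have htot := (hasSum_int_of_pnat hF0 hp.hasSum hm.hasSum).unique hF
  have h1 := ((lp.hasSum_single (p := 2) (by norm_num) (posPart u hu)).mapL T).mapL
    ((innerSL ℂ (lp.single 2 l (1 : ℂ) : OneParticle)).restrictScalars ℝ)
  have hcoord : ∀ ξ : OneParticle, ((innerSL ℂ (lp.single 2 l (1 : ℂ) : OneParticle)).restrictScalars
      ℝ) ξ = ξ l := fun ξ => inner_single_one l ξ
  simp only [hcoord] at h1
  have h2 := ((hp.hasSum.add hm.hasSum).mul_left ((√(l : ℝ) : ℝ) : ℂ))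
  rw [htot] at h2
  refine h1.unique ((congrArg (fun f => HasSum f _) (funext fun k => ?_)).mp h2)
  have hconj : (starRingEnd ℂ) (cfCoef u ((k : ℕ) : ℤ)) = cfCoef u (-((k : ℕ) : ℤ)) := by
    have := cfCoef_conj u (-((k : ℕ) : ℤ))
    rw [neg_neg, funext hreal] at this
    exact this.symm
  rw [hT, lp.coeFn_add, Pi.add_apply, lp.coeFn_smul, lp.coeFn_smul, Pi.smul_apply, Pi.smul_apply,
    expClass, expNegClass, lp.coeFn_smul, lp.coeFn_smul, Pi.smul_apply, Pi.smul_apply,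
    posPart_apply, posPart_apply, posPart_apply, map_mul, Complex.conj_ofReal, hconj]
  have h0 := ofReal_sqrt_ne_zero k
  simp only [smul_eq_mul, hFdef]
  field_simp

theorem im_inner_posPart {u v : ℝ → ℂ} (hu : PeriodicC1 u) (hv : PeriodicC1 v)
    (hur : ∀ θ, (starRingEnd ℂ) (u θ) = u θ) (hvr : ∀ θ, (starRingEnd ℂ) (v θ) = v θ) :
    (2 * (⟪posPart u hu, posPart v hv⟫_ℂ).im : ℝ) * Complex.I = circleForm u v := by
  rw [← inner_posPart_sub hu hv]
  have e1 : posPart _ hu.conj = posPart u hu := by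
    congr 1
    exact funext hur
  have e2 : posPart _ hv.conj = posPart v hv := by
    congr 1
    exact funext hvr
  rw [e1, e2, Complex.sub_conj]

theorem periodicC1_angular {f : Circle → ℝ} (hf : ContMDiff (𝓡 1) 𝓘(ℝ, ℝ) 1 f) :
    PeriodicC1 fun θ => (angular f θ : ℂ) where
  contDiff := by
    have h1 : ContMDiff 𝓘(ℝ, ℝ) 𝓘(ℝ, ℝ) 1 (f ∘ Circle.exp) := hf.comp contMDiff_circleExp
    exact Complex.ofRealCLM.contDiff.comp h1.contDiff
  periodic θ := by
    simp only [angular, Circle.exp_add, Circle.exp_two_pi, mul_one]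

theorem memSobolev_angular {f : Circle → ℝ} (hf : ContMDiff (𝓡 1) 𝓘(ℝ, ℝ) 1 f) :
    MemSobolev (1 / 2) (angular f) := by
  have hu := periodicC1_angular hf
  have hc : Continuous (angular f) := hf.continuous.comp Circle.exp.continuous
  refine ⟨fun θ => ?_, ?_, ?_⟩
  · simp only [angular, Circle.exp_add, Circle.exp_two_pi, mul_one]
  · obtain ⟨C, hC⟩ := isCompact_Icc.exists_bound_of_continuousOn
      (hc.continuousOn (s := Set.Icc (0 : ℝ) (2 * Real.pi)))
    refine MeasureTheory.MemLp.of_bound hc.aestronglyMeasurable C ?_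
    refine (MeasureTheory.ae_restrict_mem measurableSet_Ioc).mono fun θ hθ => ?_
    exact hC θ (Set.Ioc_subset_Icc_self hθ)
  · refine ((hasSum_norm_sq_cfCoef hu.continuous).summable.add
      (summable_sq_mul_cfCoef hu)).of_nonneg_of_le (fun _ => by positivity) fun k => ?_
    rw [fourierCoef_eq_cfCoef]
    have h1 : (1 + (k : ℝ) ^ 2) ^ (1 / 2 : ℝ) ≤ 1 + (k : ℝ) ^ 2 := by
      conv_rhs => rw [← Real.rpow_one (1 + (k : ℝ) ^ 2)]
      exact Real.rpow_le_rpow_of_exponent_le (by nlinarith [sq_nonneg (k : ℝ)]) (by norm_num)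
    have h2 := mul_le_mul_of_nonneg_right h1
      (sq_nonneg ‖cfCoef (fun θ => (angular f θ : ℂ)) k‖)
    linarith

theorem oneParticleClass_eq_posPart {f : Circle → ℝ} (hf : ContMDiff (𝓡 1) 𝓘(ℝ, ℝ) 1 f)
    (hf' : MemSobolev (1 / 2) (angular f)) :
    oneParticleClass f hf' = posPart _ (periodicC1_angular hf) := rfl

theorem symplectic_of_dense {T : OneParticle →L[ℝ] OneParticle} {D : Set OneParticle}
    (hD : Dense D) (h : ∀ ξ ∈ D, ∀ η ∈ D, (⟪T ξ, T η⟫_ℂ).im = (⟪ξ, η⟫_ℂ).im) (ξ η : OneParticle) :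
    (⟪T ξ, T η⟫_ℂ).im = (⟪ξ, η⟫_ℂ).im := by
  have h1 : ∀ ξ ∈ D, ∀ η, (⟪T ξ, T η⟫_ℂ).im = (⟪ξ, η⟫_ℂ).im := by
    intro ξ hξ
    refine congrFun (Continuous.ext_on hD ?_ ?_ (h ξ hξ))
    · exact Complex.continuous_im.comp (continuous_const.inner T.continuous)
    · exact Complex.continuous_im.comp (continuous_const.inner continuous_id)
  refine congrFun (Continuous.ext_on (f := fun ξ => (⟪T ξ, T η⟫_ℂ).im)
    (g := fun ξ => (⟪ξ, η⟫_ℂ).im) hD ?_ ?_ fun ξ hξ => h1 ξ hξ η) ξ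
  · exact Complex.continuous_im.comp (T.continuous.inner continuous_const)
  · exact Complex.continuous_im.comp (continuous_id.inner continuous_const)

/-- A bounded symplectic operator with dense range has a bounded inverse. -/
theorem exists_equiv_of_symplectic {T : OneParticle →L[ℝ] OneParticle}
    (hT : ∀ ξ η, (⟪T ξ, T η⟫_ℂ).im = (⟪ξ, η⟫_ℂ).im) (hr : DenseRange T) :
    ∃ V : OneParticle ≃L[ℝ] OneParticle, (V : OneParticle →L[ℝ] OneParticle) = T := by
  -- ‖ξ‖² = Im⟨ξ, iξ⟩ = Im⟨Tξ, T(iξ)⟩ ≤ ‖Tξ‖ ‖T‖ ‖ξ‖: a symplectic operator is automatically bounded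
  -- below.
  have hle : ∀ ξ, ‖ξ‖ ≤ ‖T‖ * ‖T ξ‖ := by
    intro ξ
    have h1 : ‖ξ‖ ^ 2 = (⟪ξ, Complex.I • ξ⟫_ℂ).im := by
      rw [inner_smul_right, ← ofReal_norm_sq, ← Complex.ofReal_pow, Complex.I_mul_im,
        Complex.ofReal_re]
    have h2 : (⟪T ξ, T (Complex.I • ξ)⟫_ℂ).im ≤ ‖T ξ‖ * (‖T‖ * ‖ξ‖) := by
      refine (Complex.abs_im_le_norm _ |> (le_abs_self _).trans).trans
        ((norm_inner_le_norm _ _).trans ?_)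
      refine mul_le_mul_of_nonneg_left ((T.le_opNorm _).trans (le_of_eq ?_)) (norm_nonneg _)
      rw [norm_smul, Complex.norm_I, one_mul]
    rw [hT, ← h1] at h2
    rcases (norm_nonneg ξ).eq_or_lt with h0 | h0
    · rw [← h0]
      positivity
    · nlinarith
  have hanti : AntilipschitzWith ‖T‖₊ T := AddMonoidHomClass.antilipschitz_of_bound T hle
  have hsurj : Function.Surjective T := by
    rw [← Set.range_eq_univ, ← (hanti.isClosed_range T.uniformContinuous).closure_eq]
    exact hr.closure_range
  refine ⟨ContinuousLinearEquiv.ofBijective T (LinearMap.ker_eq_bot.2 hanti.injective)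
    (LinearMap.range_eq_top.2 hsurj), ?_⟩
  ext ξ
  rfl

theorem antilinearPart_compositionOperator (hg : IsCircleLift g)
    {T : OneParticle →L[ℝ] OneParticle} (hT : ∀ (k : ℕ+) (c : ℂ), T (lp.single 2 k c)
      = c • expClass hg k + (starRingEnd ℂ) c • expNegClass hg k) (k : ℕ+) :
    antilinearPart T (lp.single 2 k (1 : ℂ)) = expNegClass hg k := by
  have h1 : Complex.I • (lp.single 2 k (1 : ℂ) : OneParticle) = lp.single 2 k Complex.I := by
    rw [← lp.single_smul]
    simp
  rw [antilinearPart_apply, h1, hT, hT, map_one, Complex.conj_I]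
  match_scalars
  · linear_combination (1 / 2 : ℂ) * Complex.I_mul_I
  · linear_combination (-1 / 2 : ℂ) * Complex.I_mul_I

end CompositionOperator

/-- A diffeomorphism of the circle, for a lift of which the antilinear part of the composition
operator is Hilbert-Schmidt, is implemented by a unitary operator on the Fock space. -/
theorem exists_implementer (γ : Circle ≃ₘ^1⟮𝓡 1, 𝓡 1⟯ Circle) {g : ℝ → ℝ} (hg : IsCircleLift g)
    (hγ : ∀ θ, γ (Circle.exp θ) = Circle.exp (g θ))
    (hb : Summable fun k => ‖expNegClass hg k‖ ^ 2) :
    ∃ V : OneParticle ≃L[ℝ] OneParticle,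
      (∀ ξ η : OneParticle, (⟪V ξ, V η⟫_ℂ).im = (⟪ξ, η⟫_ℂ).im) ∧
      ∃ U ∈ unitary (FockSpace ℕ+ →L[ℂ] FockSpace ℕ+),
        (∀ ξ : OneParticle, U * weyl ξ * star U = weyl (V ξ)) ∧
        ∀ f : Circle → ℝ, ContMDiff (𝓡 1) 𝓘(ℝ, ℝ) ∞ f →
          ∃ (hf : MemSobolev (1 / 2) (angular f))
            (hfγ : MemSobolev (1 / 2) (angular (f ∘ γ.symm))),
            V (oneParticleClass f hf) = oneParticleClass (f ∘ γ.symm) hfγ ∧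
            U * weyl (oneParticleClass f hf) * star U
              = weyl (oneParticleClass (f ∘ γ.symm) hfγ) := by
  -- `T` composes with γ, so it is the inverse of the operator sought, and its antilinear part is
  -- the one that Shale's theorem needs.
  obtain ⟨T, hT⟩ := exists_compositionOperator hg hb
  have hreal : ∀ (f : Circle → ℝ) (θ : ℝ),
      (starRingEnd ℂ) (angular f θ : ℂ) = (angular f θ : ℂ) := fun f θ => Complex.conj_ofReal _
  have hTsymp : ∀ ξ η, (⟪T ξ, T η⟫_ℂ).im = (⟪ξ, η⟫_ℂ).im := by
    refine symplectic_of_dense dense_oneParticleClass ?_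
    rintro _ ⟨f₁, h₁, hf₁, rfl⟩ _ ⟨f₂, h₂, hf₂, rfl⟩
    have hu := periodicC1_angular (hf₁.of_le (by exact_mod_cast le_top))
    have hv := periodicC1_angular (hf₂.of_le (by exact_mod_cast le_top))
    rw [oneParticleClass_eq_posPart (hf₁.of_le (by exact_mod_cast le_top)),
      oneParticleClass_eq_posPart (hf₂.of_le (by exact_mod_cast le_top)),
      compositionOperator_posPart hg hT hu (hreal f₁),
      compositionOperator_posPart hg hT hv (hreal f₂)]
    have e1 := im_inner_posPart hu hv (hreal f₁) (hreal f₂)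
    have e2 := im_inner_posPart (hu.comp hg) (hv.comp hg) (fun θ => hreal f₁ (g θ))
      (fun θ => hreal f₂ (g θ))
    rw [circleForm_comp hu hv hg, ← e1] at e2
    have e3 := Complex.ofReal_injective (mul_right_cancel₀ Complex.I_ne_zero e2)
    linarith
  -- f ∘ γ⁻¹ is merely C¹, which suffices for its class and for the action of `T`. This also shows
  -- that the range of `T` contains the dense set of smooth classes.
  have hclass : ∀ f : Circle → ℝ, ContMDiff (𝓡 1) 𝓘(ℝ, ℝ) ∞ f →
      ∃ (hf : MemSobolev (1 / 2) (angular f)) (hfγ : MemSobolev (1 / 2) (angular (f ∘ γ.symm))),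
        T (oneParticleClass (f ∘ γ.symm) hfγ) = oneParticleClass f hf := by
    intro f hf
    have hf1 : ContMDiff (𝓡 1) 𝓘(ℝ, ℝ) 1 f := hf.of_le (by exact_mod_cast le_top)
    have hf2 : ContMDiff (𝓡 1) 𝓘(ℝ, ℝ) 1 (f ∘ γ.symm) := hf1.comp γ.symm.contMDiff
    refine ⟨memSobolev_angular hf1, memSobolev_angular hf2, ?_⟩
    rw [oneParticleClass_eq_posPart hf1, oneParticleClass_eq_posPart hf2,
      compositionOperator_posPart hg hT _ (hreal _)]
    congr 1
    funext θ
    simp only [angular, Function.comp_apply, ← hγ, γ.symm_apply_apply]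
  have hdense : DenseRange T := by
    refine dense_oneParticleClass.mono ?_
    rintro _ ⟨f, hf, hfs, rfl⟩
    obtain ⟨hf', hfγ, h⟩ := hclass f hfs
    exact ⟨_, h⟩
  obtain ⟨V, hV⟩ := exists_equiv_of_symplectic hTsymp hdense
  have hVT : ∀ ξ, V ξ = T ξ := fun ξ => DFunLike.congr_fun hV ξ
  have hVsymp : ∀ ξ η, (⟪V.symm ξ, V.symm η⟫_ℂ).im = (⟪ξ, η⟫_ℂ).im :=
    symplectic_symm fun ξ η => by rw [hVT, hVT, hTsymp]
  obtain ⟨U, hU, hUW⟩ := exists_unitary_of_symplectic hVsymp (by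
    rw [V.symm_symm, hV]
    simp only [antilinearPart_compositionOperator hg hT]
    exact hb)
  refine ⟨V.symm, hVsymp, U, hU, hUW, fun f hf => ?_⟩
  obtain ⟨h1, h2, h3⟩ := hclass f hf
  have h4 : V.symm (oneParticleClass f h1) = oneParticleClass (f ∘ γ.symm) h2 := by
    rw [← h3, ← hVT, V.symm_apply_apply]
  exact ⟨h1, h2, h4, by rw [hUW, h4]⟩

/-! ### Bessel's inequality for the functions `e^{ikg}` -/

section Bessel

variable {g : ℝ → ℝ}

theorem IsCircleLift.hasDerivAt (hg : IsCircleLift g) (θ : ℝ) : HasDerivAt g (deriv g θ) θ :=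
  ((hg.contDiff.differentiable one_ne_zero) θ).hasDerivAt

theorem IsCircleLift.continuous_deriv (hg : IsCircleLift g) : Continuous (deriv g) :=
  hg.contDiff.continuous_deriv le_rfl

theorem IsCircleLift.deriv_periodic (hg : IsCircleLift g) :
    Function.Periodic (deriv g) (2 * Real.pi) := by
  intro θ
  rw [← deriv_comp_add_const]
  have : (fun θ => g (θ + 2 * Real.pi)) = fun θ => g θ + 2 * Real.pi := funext hg.map_add_period
  rw [this, deriv_add_const]

theorem integral_deriv_mul_exp (hg : IsCircleLift g) (m : ℤ) :
    ∫ θ in (0 : ℝ)..(2 * Real.pi), ((deriv g θ : ℝ) : ℂ) * Complex.exp (Complex.I * m * g θ)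
      = if m = 0 then (2 * Real.pi : ℂ) else 0 := by
  split_ifs with h
  · subst h
    have h1 := intervalIntegral.integral_eq_sub_of_hasDerivAt (a := 0) (b := 2 * Real.pi)
      (fun θ _ => hg.hasDerivAt θ) (hg.continuous_deriv.intervalIntegrable _ _)
    have h2 := hg.map_add_period 0
    rw [zero_add] at h2
    simp only [Int.cast_zero, mul_zero, zero_mul, Complex.exp_zero, mul_one]
    rw [intervalIntegral.integral_ofReal, h1, h2]
    push_cast
    ring
  · have hd : ∀ θ : ℝ, HasDerivAt (fun θ => Complex.exp (Complex.I * m * g θ))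
        (((deriv g θ : ℝ) : ℂ) * (Complex.I * m * Complex.exp (Complex.I * m * g θ))) θ := by
      intro θ
      have h1 := (hasDerivAt_exp_int m (g θ)).scomp θ (hg.hasDerivAt θ)
      rwa [Complex.real_smul] at h1
    have c1 := hg.continuous_deriv
    have c2 := hg.contDiff.continuous
    have h2 := integral_deriv_period hd (by fun_prop) ((periodicC1_exp m).comp hg).periodic
    simp only [mul_left_comm _ (Complex.I * (m : ℂ))] at h2
    rw [intervalIntegral.integral_const_mul] at h2
    refine (mul_eq_zero.1 h2).resolve_left (mul_ne_zero Complex.I_ne_zero ?_)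
    exact_mod_cast h

variable {ι : Type*} {m : ι → ℤ}

theorem integral_deriv_mul_norm_sq (hg : IsCircleLift g) (hm : Function.Injective m)
    (S : Finset ι) (a : ι → ℂ) :
    ∫ θ in (0 : ℝ)..(2 * Real.pi),
      deriv g θ * ‖∑ k ∈ S, a k * Complex.exp (Complex.I * m k * g θ)‖ ^ 2
        = 2 * Real.pi * ∑ k ∈ S, ‖a k‖ ^ 2 := by
  have c1 := hg.continuous_deriv
  have c2 := hg.contDiff.continuous
  apply Complex.ofReal_injective
  rw [← intervalIntegral.integral_ofReal]
  have e : ∀ θ : ℝ, ((deriv g θ * ‖∑ k ∈ S, a k * Complex.exp (Complex.I * m k * g θ)‖ ^ 2 : ℝ) : ℂ)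
      = ∑ k ∈ S, ∑ j ∈ S, (starRingEnd ℂ) (a k) * a j *
        (((deriv g θ : ℝ) : ℂ) * Complex.exp (Complex.I * (m j - m k : ℤ) * g θ)) := by
    intro θ
    rw [Complex.ofReal_mul, Complex.ofReal_pow, ← Complex.conj_mul', map_sum, Finset.sum_mul_sum,
      Finset.mul_sum]
    refine Finset.sum_congr rfl fun k _ => ?_
    rw [Finset.mul_sum]
    refine Finset.sum_congr rfl fun j _ => ?_
    have h1 : Complex.exp (Complex.I * (m j - m k : ℤ) * g θ)
        = (starRingEnd ℂ) (Complex.exp (Complex.I * m k * g θ)) *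
          Complex.exp (Complex.I * m j * g θ) := by
      rw [← Complex.exp_conj, ← Complex.exp_add]
      congr 1
      simp
      ring
    rw [h1, map_mul]
    ring
  rw [intervalIntegral.integral_congr fun θ _ => e θ, intervalIntegral.integral_finsetSum fun k _ =>
    Continuous.intervalIntegrable (by fun_prop) _ _]
  push_cast
  rw [Finset.mul_sum]
  refine Finset.sum_congr rfl fun k hk => ?_
  rw [intervalIntegral.integral_finsetSum fun j _ =>
    Continuous.intervalIntegrable (by fun_prop) _ _, Finset.sum_eq_single k]
  · rw [← Int.cast_sub, intervalIntegral.integral_const_mul, integral_deriv_mul_exp hg, if_pos (sub_self _),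
      Complex.conj_mul', mul_comm]
  · intro j _ hj
    rw [← Int.cast_sub, intervalIntegral.integral_const_mul, integral_deriv_mul_exp hg,
      if_neg (sub_ne_zero.2 (hm.ne hj)), mul_zero]
  · exact fun h => (h hk).elim

/-- Duality: the sum is ∫ P v for the combination `P` of the exponentials with conjugate
coefficients, and `P` is computed by orthogonality with respect to the weight g' ≥ c. -/
theorem sum_norm_sq_integral_le (hg : IsCircleLift g) (hm : Function.Injective m) {c : ℝ}
    (hc : 0 < c) (hgc : ∀ θ, c ≤ deriv g θ) {v : ℝ → ℂ} (hv : Continuous v) (S : Finset ι) :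
    ∑ k ∈ S, ‖∫ θ in (0 : ℝ)..(2 * Real.pi), v θ * Complex.exp (Complex.I * m k * g θ)‖ ^ 2
      ≤ 2 * Real.pi / c * ∫ θ in (0 : ℝ)..(2 * Real.pi), ‖v θ‖ ^ 2 := by
  have c1 := hg.continuous_deriv
  have c2 := hg.contDiff.continuous
  set a : ι → ℂ := fun k =>
    ∫ θ in (0 : ℝ)..(2 * Real.pi), v θ * Complex.exp (Complex.I * m k * g θ) with ha
  set P : ℝ → ℂ := fun θ => ∑ k ∈ S, (starRingEnd ℂ) (a k) * Complex.exp (Complex.I * m k * g θ)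
    with hP
  have cP : Continuous P := by fun_prop
  set A := ∑ k ∈ S, ‖a k‖ ^ 2 with hA
  have h1 : ((A : ℝ) : ℂ) = ∫ θ in (0 : ℝ)..(2 * Real.pi), P θ * v θ := by
    simp only [hP, Finset.sum_mul]
    rw [intervalIntegral.integral_finsetSum fun j _ =>
      Continuous.intervalIntegrable (by fun_prop) _ _, hA]
    push_cast
    refine Finset.sum_congr rfl fun k _ => ?_
    simp only [mul_assoc]
    rw [intervalIntegral.integral_const_mul, ← Complex.conj_mul']
    simp only [ha, mul_comm (v _), mul_assoc]
  have h2 : ∫ θ in (0 : ℝ)..(2 * Real.pi), deriv g θ * ‖P θ‖ ^ 2 = 2 * Real.pi * A := by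
    have := integral_deriv_mul_norm_sq hg hm S fun k => (starRingEnd ℂ) (a k)
    simpa only [RCLike.norm_conj] using this
  -- Young's inequality with the factor 1/(4π), for which the integral of the first term is exactly
  -- A/2 and can be absorbed.
  have h3 : A ≤ ∫ θ in (0 : ℝ)..(2 * Real.pi),
      ((4 * Real.pi)⁻¹ * (deriv g θ * ‖P θ‖ ^ 2) + Real.pi / c * ‖v θ‖ ^ 2) := by
    have h4 : A ≤ ∫ θ in (0 : ℝ)..(2 * Real.pi), ‖P θ * v θ‖ := by
      refine le_trans ?_ (intervalIntegral.norm_integral_le_integral_norm Real.two_pi_pos.le)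
      rw [← h1, Complex.norm_real]
      exact le_abs_self _
    refine h4.trans (intervalIntegral.integral_mono_on Real.two_pi_pos.le
      (Continuous.intervalIntegrable (by fun_prop) _ _)
      (Continuous.intervalIntegrable (by fun_prop) _ _) fun θ _ => ?_)
    rw [norm_mul]
    have h5 : c * ‖P θ‖ ^ 2 ≤ deriv g θ * ‖P θ‖ ^ 2 :=
      mul_le_mul_of_nonneg_right (hgc θ) (by positivity)
    have hpi := Real.pi_pos
    have h6 : ‖P θ‖ * ‖v θ‖ ≤ (4 * Real.pi)⁻¹ * (c * ‖P θ‖ ^ 2) + Real.pi / c * ‖v θ‖ ^ 2 := by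
      have : (4 * Real.pi)⁻¹ * (c * ‖P θ‖ ^ 2) + Real.pi / c * ‖v θ‖ ^ 2 - ‖P θ‖ * ‖v θ‖
          = (4 * Real.pi * c)⁻¹ * (c * ‖P θ‖ - 2 * Real.pi * ‖v θ‖) ^ 2 := by
        field_simp
        ring
      have h7 : 0 ≤ (4 * Real.pi * c)⁻¹ * (c * ‖P θ‖ - 2 * Real.pi * ‖v θ‖) ^ 2 := by positivity
      linarith
    have h8 := mul_le_mul_of_nonneg_left h5 (by positivity : 0 ≤ (4 * Real.pi)⁻¹)
    linarith
  rw [intervalIntegral.integral_add (Continuous.intervalIntegrable (by fun_prop) _ _)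
    (Continuous.intervalIntegrable (by fun_prop) _ _), intervalIntegral.integral_const_mul,
    intervalIntegral.integral_const_mul, h2] at h3
  have h9 : (4 * Real.pi)⁻¹ * (2 * Real.pi * A) = A / 2 := by
    have := Real.pi_pos
    field_simp
    norm_num
  rw [h9] at h3
  have h10 : 2 * Real.pi / c = 2 * (Real.pi / c) := by ring
  rw [h10]
  linarith

end Bessel

/-! ### Oscillatory integrals with the phase `lθ + k g(θ)` -/

section Oscillatory

variable {g : ℝ → ℝ}

/-- The integral `∫ v(θ) e^{i(lθ + k g(θ))} dθ` over a period. -/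
def oscInt (g : ℝ → ℝ) (l k : ℕ+) (v : ℝ → ℝ) : ℂ :=
  ∫ θ in (0 : ℝ)..(2 * Real.pi), (v θ : ℂ) * Complex.exp (Complex.I * (l * θ + k * g θ))

theorem norm_exp_phase (g : ℝ → ℝ) (l k : ℕ+) (θ : ℝ) :
    ‖Complex.exp (Complex.I * (l * θ + k * g θ))‖ = 1 := by
  simp [Complex.norm_exp]

theorem norm_oscInt_le (l k : ℕ+) {v : ℝ → ℝ} {C : ℝ} (hv : ∀ θ, |v θ| ≤ C) :
    ‖oscInt g l k v‖ ≤ C * (2 * Real.pi) := by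
  have h := intervalIntegral.norm_integral_le_of_norm_le_const (a := 0) (b := 2 * Real.pi)
    (f := fun θ => (v θ : ℂ) * Complex.exp (Complex.I * (l * θ + k * g θ))) (C := C)
    (fun θ _ => by
      rw [norm_mul, norm_exp_phase, mul_one, Complex.norm_real]
      exact hv θ)
  rwa [sub_zero, abs_of_pos Real.two_pi_pos] at h

theorem hasDerivAt_exp_phase (hg : IsCircleLift g) (l k : ℕ+) (θ : ℝ) :
    HasDerivAt (fun θ : ℝ => Complex.exp (Complex.I * (l * θ + k * g θ)))
      (Complex.exp (Complex.I * (l * θ + k * g θ)) * (Complex.I * (l + k * deriv g θ))) θ := by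
  have h1 : HasDerivAt (fun θ : ℝ => (θ : ℂ)) 1 θ := Complex.ofRealCLM.hasDerivAt
  have h2 : HasDerivAt (fun θ : ℝ => (g θ : ℂ)) ((deriv g θ : ℝ) : ℂ) θ := HasDerivAt.ofReal_comp (hg.hasDerivAt θ)
  have h3 := (((h1.const_mul (l : ℂ)).add (h2.const_mul (k : ℂ))).const_mul Complex.I).cexp
  simpa only [mul_one, Pi.add_apply] using h3

/-- Integration by parts. -/
theorem mul_oscInt_pow (hg : IsCircleLift g) (hg2 : ContDiff ℝ 2 g) (M : ℝ) (l k : ℕ+) (j : ℕ) :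
    ((l + k * M : ℝ) : ℂ) * oscInt g l k (fun θ => (M - deriv g θ) ^ j)
      = -(Complex.I * j * oscInt g l k (fun θ => (M - deriv g θ) ^ (j - 1) * deriv (deriv g) θ))
        + k * oscInt g l k (fun θ => (M - deriv g θ) ^ (j + 1)) := by
  have hd : ContDiff ℝ 1 (deriv g) := (contDiff_succ_iff_deriv (n := 1) (f := g)).1 hg2 |>.2.2
  have c1 := hg.continuous_deriv
  have c2 := hg.contDiff.continuous
  have c3 : Continuous (deriv (deriv g)) := hd.continuous_deriv le_rfl
  have h1 : ∀ θ, HasDerivAt (fun θ : ℝ => (((M - deriv g θ) ^ j : ℝ) : ℂ) *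
      Complex.exp (Complex.I * (l * θ + k * g θ)))
      ((((j : ℝ) * (M - deriv g θ) ^ (j - 1) * (-deriv (deriv g) θ) : ℝ) : ℂ) *
        Complex.exp (Complex.I * (l * θ + k * g θ))
        + (((M - deriv g θ) ^ j : ℝ) : ℂ) * (Complex.exp (Complex.I * (l * θ + k * g θ)) *
          (Complex.I * (l + k * deriv g θ)))) θ := by
    intro θ
    have h2 : HasDerivAt (deriv g) (deriv (deriv g) θ) θ :=
      ((hd.differentiable one_ne_zero) θ).hasDerivAt
    exact (((h2.const_sub M).pow j).ofReal_comp).mul (hasDerivAt_exp_phase hg l k θ)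
  have h3 := integral_deriv_period h1 (by fun_prop) (fun θ => by
    simp only [hg.deriv_periodic θ, hg.map_add_period]
    congr 1
    rw [Complex.exp_eq_exp_iff_exists_int]
    refine ⟨l + k, ?_⟩
    push_cast
    ring)
  have hI : ∀ (a : ℂ) (v : ℝ → ℝ), Continuous v → IntervalIntegrable (fun θ : ℝ => a * ((v θ : ℂ) *
      Complex.exp (Complex.I * (l * θ + k * g θ)))) MeasureTheory.volume 0 (2 * Real.pi) :=
    fun a v hv => Continuous.intervalIntegrable (by fun_prop) _ _
  -- The phase derivative is written as l + k g' = (l + kM) - k(M - g'): a constant, and a term that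
  -- raises the power by one. For j = 0 the truncated exponent j - 1 is harmless because of the
  -- factor j.
  have h4 : ∀ θ : ℝ, (((j : ℝ) * (M - deriv g θ) ^ (j - 1) * (-deriv (deriv g) θ) : ℝ) : ℂ) *
        Complex.exp (Complex.I * (l * θ + k * g θ))
        + (((M - deriv g θ) ^ j : ℝ) : ℂ) * (Complex.exp (Complex.I * (l * θ + k * g θ)) *
          (Complex.I * (l + k * deriv g θ)))
      = ((-j : ℂ) * ((((M - deriv g θ) ^ (j - 1) * deriv (deriv g) θ : ℝ) : ℂ) *
          Complex.exp (Complex.I * (l * θ + k * g θ)))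
        + (Complex.I * ((l + k * M : ℝ) : ℂ)) * ((((M - deriv g θ) ^ j : ℝ) : ℂ) *
          Complex.exp (Complex.I * (l * θ + k * g θ))))
        + (-(Complex.I * k)) * ((((M - deriv g θ) ^ (j + 1) : ℝ) : ℂ) *
          Complex.exp (Complex.I * (l * θ + k * g θ))) := by
    intro θ
    push_cast
    ring
  rw [intervalIntegral.integral_congr fun θ _ => h4 θ, intervalIntegral.integral_add
    ((hI _ _ (by fun_prop)).add (hI _ _ (by fun_prop))) (hI _ _ (by fun_prop)),
    intervalIntegral.integral_add (hI _ _ (by fun_prop)) (hI _ _ (by fun_prop)),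
    intervalIntegral.integral_const_mul, intervalIntegral.integral_const_mul,
    intervalIntegral.integral_const_mul] at h3
  simp only [oscInt]
  linear_combination (-Complex.I) * h3 + ((((l + k * M : ℝ) : ℂ) *
    (∫ θ in (0 : ℝ)..(2 * Real.pi), (((M - deriv g θ) ^ j : ℝ) : ℂ) *
      Complex.exp (Complex.I * (l * θ + k * g θ)))) -
    k * (∫ θ in (0 : ℝ)..(2 * Real.pi), (((M - deriv g θ) ^ (j + 1) : ℝ) : ℂ) *
      Complex.exp (Complex.I * (l * θ + k * g θ)))) * Complex.I_mul_I

/-- Iterated integration by parts, with k/(l + kM) ≤ 1/M at each step. Dividing by the constant l +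
kM instead of l + k g' leaves the amplitudes (M - g')ʲ g'' free of l and k, as Bessel's inequality
requires. -/
theorem norm_oscInt_one_le (hg : IsCircleLift g) (hg2 : ContDiff ℝ 2 g) {M : ℝ} (hM : 0 < M)
    (l k : ℕ+) (J : ℕ) :
    ‖oscInt g l k (fun _ => 1)‖ ≤ k / (l + k * M) ^ 2 * ∑ j ∈ Finset.range J,
        (j + 1) * M⁻¹ ^ j * ‖oscInt g l k (fun θ => (M - deriv g θ) ^ j * deriv (deriv g) θ)‖
      + M⁻¹ ^ (J + 1) * ‖oscInt g l k (fun θ => (M - deriv g θ) ^ (J + 1))‖ := by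
  have hl : (0 : ℝ) < l := by exact_mod_cast l.pos
  have hk : (0 : ℝ) < k := by exact_mod_cast k.pos
  set A : ℝ := l + k * M with hA
  have hA0 : 0 < A := by positivity
  have hq : (k : ℝ) / A ≤ M⁻¹ := by
    rw [div_le_iff₀ hA0, inv_mul_eq_div, le_div_iff₀ hM]
    linarith
  have step : ∀ j : ℕ, ‖oscInt g l k (fun θ => (M - deriv g θ) ^ j)‖
      ≤ j / A * ‖oscInt g l k (fun θ => (M - deriv g θ) ^ (j - 1) * deriv (deriv g) θ)‖
        + k / A * ‖oscInt g l k (fun θ => (M - deriv g θ) ^ (j + 1))‖ := by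
    intro j
    have h1 := congrArg norm (mul_oscInt_pow hg hg2 M l k j)
    rw [← hA, norm_mul, Complex.norm_real, Real.norm_of_nonneg hA0.le] at h1
    have h2 : A * ‖oscInt g l k (fun θ => (M - deriv g θ) ^ j)‖
        ≤ j * ‖oscInt g l k (fun θ => (M - deriv g θ) ^ (j - 1) * deriv (deriv g) θ)‖
          + k * ‖oscInt g l k (fun θ => (M - deriv g θ) ^ (j + 1))‖ := by
      rw [h1]
      refine (norm_add_le _ _).trans (le_of_eq ?_)
      rw [norm_neg, norm_mul, norm_mul, norm_mul, Complex.norm_I, one_mul, Complex.norm_natCast,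
        Complex.norm_natCast]
    rw [div_mul_eq_mul_div, div_mul_eq_mul_div, ← add_div, le_div_iff₀ hA0]
    linarith
  have main : ‖oscInt g l k (fun _ => 1)‖ ≤ k / A ^ 2 * ∑ j ∈ Finset.range J,
        (j + 1) * (k / A) ^ j * ‖oscInt g l k (fun θ => (M - deriv g θ) ^ j * deriv (deriv g) θ)‖
      + (k / A) ^ (J + 1) * ‖oscInt g l k (fun θ => (M - deriv g θ) ^ (J + 1))‖ := by
    induction J with
    | zero =>
      have := step 0
      simpa using this
    | succ J ih =>
      refine ih.trans ?_
      have h1 := mul_le_mul_of_nonneg_left (step (J + 1))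
        (by positivity : 0 ≤ ((k : ℝ) / A) ^ (J + 1))
      rw [Nat.add_sub_cancel] at h1
      rw [Finset.sum_range_succ, mul_add]
      have h2 : k / A ^ 2 * ((J + 1) * (k / A) ^ J *
            ‖oscInt g l k (fun θ => (M - deriv g θ) ^ J * deriv (deriv g) θ)‖)
          + (k / A) ^ (J + 1 + 1) * ‖oscInt g l k (fun θ => (M - deriv g θ) ^ (J + 1 + 1))‖
          = (k / A) ^ (J + 1) * (((J + 1 : ℕ) : ℝ) / A *
            ‖oscInt g l k (fun θ => (M - deriv g θ) ^ J * deriv (deriv g) θ)‖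
            + k / A * ‖oscInt g l k (fun θ => (M - deriv g θ) ^ (J + 1 + 1))‖) := by
        push_cast
        ring_nf
      linarith
  refine main.trans ?_
  gcongr

/-- Bessel's inequality for oscillatory integrals. -/
theorem sum_norm_sq_oscInt_le (hg : IsCircleLift g) {c : ℝ} (hc : 0 < c)
    (hgc : ∀ θ, c ≤ deriv g θ) {v : ℝ → ℝ} (hv : Continuous v) (l : ℕ+) (T : Finset ℕ+) :
    ∑ k ∈ T, ‖oscInt g l k v‖ ^ 2
      ≤ 2 * Real.pi / c * ∫ θ in (0 : ℝ)..(2 * Real.pi), v θ ^ 2 := by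
  have h := sum_norm_sq_integral_le hg (m := fun k : ℕ+ => ((k : ℕ) : ℤ))
    (fun a b h => PNat.coe_injective (Int.ofNat_inj.1 h)) hc hgc
    (v := fun θ => (v θ : ℂ) * Complex.exp (Complex.I * l * θ)) (by fun_prop) T
  have h1 : ∀ θ : ℝ, ‖(v θ : ℂ) * Complex.exp (Complex.I * l * θ)‖ ^ 2 = v θ ^ 2 := by
    intro θ
    rw [norm_mul, Complex.norm_real, Complex.norm_exp]
    simp
  simp only [h1] at h
  refine le_trans (le_of_eq ?_) h
  refine Finset.sum_congr rfl fun k _ => ?_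
  rw [oscInt]
  congr 2
  refine intervalIntegral.integral_congr fun θ _ => ?_
  rw [mul_assoc, ← Complex.exp_add]
  congr 2
  push_cast
  ring

/-- A bound for the Hilbert-Schmidt norm of the antilinear part of the composition operator in
terms of the second derivative of `g` and bounds for its first derivative. -/
theorem exists_sum_oscInt_le {c M : ℝ} (hc : 0 < c) (hcM : c < M) :
    ∃ C : ℝ, 0 ≤ C ∧ ∀ g : ℝ → ℝ, IsCircleLift g → ContDiff ℝ 2 g → (∀ θ, c ≤ deriv g θ) →
      (∀ θ, deriv g θ ≤ M) → ∀ S T : Finset ℕ+,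
        ∑ l ∈ S, ∑ k ∈ T, (l : ℝ) / k * ‖oscInt g l k (fun _ => 1)‖ ^ 2
          ≤ C * ∫ θ in (0 : ℝ)..(2 * Real.pi), deriv (deriv g) θ ^ 2 := by
  have hM : 0 < M := hc.trans hcM
  have hd : 0 < M - c := sub_pos.2 hcM
  -- The ratio of the geometric series: the powers of 1/M meet the bound 0 ≤ M - g' ≤ M - c.
  set ρ : ℝ := M⁻¹ * (M - c) with hρ
  have hρ0 : 0 < ρ := by positivity
  have hρ1 : ρ < 1 := by
    rw [hρ, inv_mul_lt_iff₀ hM]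
    linarith
  have hw : Summable fun j : ℕ => ((j : ℝ) + 1) * ρ ^ j := by
    have h1 := summable_pow_mul_geometric_of_norm_lt_one (R := ℝ) 1
      (r := ρ) (by rwa [Real.norm_of_nonneg hρ0.le])
    have h2 := summable_geometric_of_lt_one hρ0.le hρ1
    refine (h1.add h2).congr fun j => ?_
    ring
  set Z := ∑' j : ℕ, ((j : ℝ) + 1) * ρ ^ j with hZ
  have hZle : ∀ J, ∑ j ∈ Finset.range J, ((j : ℝ) + 1) * ρ ^ j ≤ Z := fun J =>
    hw.sum_le_tsum _ fun j _ => by positivity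
  have hZ0 : 0 ≤ Z := tsum_nonneg fun j => by positivity
  have hs : Summable fun l : ℕ+ => 1 / (l : ℝ) ^ 2 :=
    (Real.summable_one_div_nat_pow.2 one_lt_two).comp_injective PNat.coe_injective
  set Y := ∑' l : ℕ+, 1 / (l : ℝ) ^ 2 with hY
  have hY0 : 0 ≤ Y := tsum_nonneg fun l => by positivity
  have hpi := Real.pi_pos
  -- The constant depends on `c` and `M` only, hence is uniform along approximations of a given
  -- lift.
  refine ⟨2 * (Y * (M⁻¹ * (Z * (Z * (2 * Real.pi / c))))), by positivity,
    fun g hg hg2 hgc hgM S T => ?_⟩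
  set E := ∫ θ in (0 : ℝ)..(2 * Real.pi), deriv (deriv g) θ ^ 2 with hE
  have hE0 : 0 ≤ E := intervalIntegral.integral_nonneg Real.two_pi_pos.le fun θ _ => by positivity
  have hdg : ContDiff ℝ 1 (deriv g) := (contDiff_succ_iff_deriv (n := 1) (f := g)).1 hg2 |>.2.2
  have c1 := hg.continuous_deriv
  have c3 : Continuous (deriv (deriv g)) := hdg.continuous_deriv le_rfl
  have hpow : ∀ (j : ℕ) θ, |(M - deriv g θ) ^ j| ≤ (M - c) ^ j := by
    intro j θ
    rw [abs_pow, abs_of_nonneg (sub_nonneg.2 (hgM θ))]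
    exact pow_le_pow_left₀ (sub_nonneg.2 (hgM θ)) (by linarith [hgc θ]) j
  let β : ℕ+ → ℕ+ → ℕ → ℝ := fun l k j =>
    ‖oscInt g l k (fun θ => (M - deriv g θ) ^ j * deriv (deriv g) θ)‖ / (M - c) ^ j
  have hβ : ∀ l j, ∑ k ∈ T, β l k j ^ 2 ≤ 2 * Real.pi / c * E := by
    intro l j
    have h1 := sum_norm_sq_oscInt_le hg hc hgc
      (v := fun θ => (M - deriv g θ) ^ j * deriv (deriv g) θ) (by fun_prop) l T
    have h2 : ∫ θ in (0 : ℝ)..(2 * Real.pi), ((M - deriv g θ) ^ j * deriv (deriv g) θ) ^ 2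
        ≤ ((M - c) ^ j) ^ 2 * E := by
      rw [hE, ← intervalIntegral.integral_const_mul]
      refine intervalIntegral.integral_mono_on Real.two_pi_pos.le
        (Continuous.intervalIntegrable (by fun_prop) _ _)
        (Continuous.intervalIntegrable (by fun_prop) _ _) fun θ _ => ?_
      rw [mul_pow]
      refine mul_le_mul_of_nonneg_right ?_ (sq_nonneg _)
      rw [← sq_abs]
      exact pow_le_pow_left₀ (abs_nonneg _) (hpow j θ) 2
    simp only [β, div_pow]
    rw [← Finset.sum_div, div_le_iff₀ (by positivity)]
    refine h1.trans ?_
    have := mul_le_mul_of_nonneg_left h2 (by positivity : 0 ≤ 2 * Real.pi / c)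
    linarith
  -- Cauchy-Schwarz with the weights (j + 1)ρʲ of total mass at most `Z` gives one factor `Z`;
  -- summing the bound `hβ`, uniform in j, gives the other.
  have hβ' : ∀ l J, ∑ k ∈ T, (∑ j ∈ Finset.range J, ((j : ℝ) + 1) * ρ ^ j * β l k j) ^ 2
      ≤ Z * (Z * (2 * Real.pi / c * E)) := by
    intro l J
    have h1 : ∀ k ∈ T, (∑ j ∈ Finset.range J, ((j : ℝ) + 1) * ρ ^ j * β l k j) ^ 2
        ≤ Z * ∑ j ∈ Finset.range J, ((j : ℝ) + 1) * ρ ^ j * β l k j ^ 2 := by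
      intro k _
      refine (Finset.sum_sq_le_sum_mul_sum_of_sq_le_mul (Finset.range J)
        (f := fun j : ℕ => ((j : ℝ) + 1) * ρ ^ j)
        (g := fun j : ℕ => ((j : ℝ) + 1) * ρ ^ j * β l k j ^ 2) (fun j _ => by positivity)
        (fun j _ => by positivity) (fun j _ => le_of_eq (by ring))).trans ?_
      exact mul_le_mul_of_nonneg_right (hZle J) (Finset.sum_nonneg fun j _ => by positivity)
    refine (Finset.sum_le_sum h1).trans ?_
    rw [← Finset.mul_sum, Finset.sum_comm]
    refine mul_le_mul_of_nonneg_left ?_ hZ0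
    calc ∑ j ∈ Finset.range J, ∑ k ∈ T, ((j : ℝ) + 1) * ρ ^ j * β l k j ^ 2
        ≤ ∑ j ∈ Finset.range J, ((j : ℝ) + 1) * ρ ^ j * (2 * Real.pi / c * E) := by
          refine Finset.sum_le_sum fun j _ => ?_
          rw [← Finset.mul_sum]
          exact mul_le_mul_of_nonneg_left (hβ l j) (by positivity)
      _ ≤ Z * (2 * Real.pi / c * E) := by
          rw [← Finset.sum_mul]
          exact mul_le_mul_of_nonneg_right (hZle J) (by positivity)
  have hterm : ∀ (J : ℕ) (l k : ℕ+), (l : ℝ) / k * ‖oscInt g l k (fun _ => 1)‖ ^ 2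
      ≤ 2 * (1 / (l : ℝ) ^ 2 * (M⁻¹ *
          (∑ j ∈ Finset.range J, ((j : ℝ) + 1) * ρ ^ j * β l k j) ^ 2))
        + 2 * ((l : ℝ) / k * (ρ ^ (J + 1) * (2 * Real.pi)) ^ 2) := by
    intro J l k
    have hl : (0 : ℝ) < l := by exact_mod_cast l.pos
    have hk : (0 : ℝ) < k := by exact_mod_cast k.pos
    have h1 := norm_oscInt_one_le hg hg2 hM l k J
    have h2 : ∑ j ∈ Finset.range J, ((j : ℝ) + 1) * M⁻¹ ^ j *
          ‖oscInt g l k (fun θ => (M - deriv g θ) ^ j * deriv (deriv g) θ)‖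
        = ∑ j ∈ Finset.range J, ((j : ℝ) + 1) * ρ ^ j * β l k j := by
      refine Finset.sum_congr rfl fun j _ => ?_
      have : (M - c) ^ j ≠ 0 := (pow_pos hd j).ne'
      simp only [β, hρ, mul_pow]
      field_simp
    rw [h2] at h1
    set X := ∑ j ∈ Finset.range J, ((j : ℝ) + 1) * ρ ^ j * β l k j with hX
    have hX0 : 0 ≤ X := Finset.sum_nonneg fun j _ => by positivity
    have h3 : M⁻¹ ^ (J + 1) * ‖oscInt g l k (fun θ => (M - deriv g θ) ^ (J + 1))‖
        ≤ ρ ^ (J + 1) * (2 * Real.pi) := by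
      rw [hρ, mul_pow, mul_assoc]
      exact mul_le_mul_of_nonneg_left (norm_oscInt_le l k (hpow (J + 1))) (by positivity)
    set R := ρ ^ (J + 1) * (2 * Real.pi) with hR
    set A : ℝ := l + k * M with hA
    have hA0 : 0 < A := by positivity
    have h4 : ‖oscInt g l k (fun _ => 1)‖ ^ 2 ≤ 2 * (k / A ^ 2 * X) ^ 2 + 2 * R ^ 2 := by
      have h5 : ‖oscInt g l k (fun _ => 1)‖ ^ 2 ≤ (k / A ^ 2 * X + R) ^ 2 :=
        pow_le_pow_left₀ (norm_nonneg _) (h1.trans (by linarith)) 2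
      nlinarith [sq_nonneg (k / A ^ 2 * X - R)]
    -- The weight lk/A⁴ is summable in l uniformly in k; the sum over k is left to Bessel's
    -- inequality.
    have h6 : (l : ℝ) / k * (k / A ^ 2) ^ 2 ≤ 1 / (l : ℝ) ^ 2 * M⁻¹ := by
      have h7 : (l : ℝ) ^ 3 * (k * M) ≤ A ^ 4 := by
        have h8 : (l : ℝ) ≤ A := by
          rw [hA]
          nlinarith [mul_pos hk hM]
        have h9 : (k : ℝ) * M ≤ A := by
          rw [hA]
          linarith
        calc (l : ℝ) ^ 3 * (k * M) ≤ A ^ 3 * A := by gcongr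
          _ = A ^ 4 := by ring
      have e : (l : ℝ) / k * (k / A ^ 2) ^ 2 = l * k / A ^ 4 := by
        field_simp
      have e2 : 1 / (l : ℝ) ^ 2 * M⁻¹ = 1 / (l ^ 2 * M) := by
        field_simp
      rw [e, e2, div_le_div_iff₀ (by positivity) (by positivity)]
      linarith
    have h10 := mul_le_mul_of_nonneg_left h4 (by positivity : 0 ≤ (l : ℝ) / k)
    have h11 := mul_le_mul_of_nonneg_right h6 (sq_nonneg X)
    have e3 : (l : ℝ) / k * (2 * (k / A ^ 2 * X) ^ 2 + 2 * R ^ 2)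
        = 2 * ((l : ℝ) / k * (k / A ^ 2) ^ 2 * X ^ 2) + 2 * ((l : ℝ) / k * R ^ 2) := by ring
    rw [e3] at h10
    linarith
  have hsum : ∀ J : ℕ, ∑ l ∈ S, ∑ k ∈ T, (l : ℝ) / k * ‖oscInt g l k (fun _ => 1)‖ ^ 2
      ≤ 2 * (Y * (M⁻¹ * (Z * (Z * (2 * Real.pi / c))))) * E
        + 2 * ((∑ l ∈ S, ∑ k ∈ T, (l : ℝ) / k) * (ρ ^ (J + 1) * (2 * Real.pi)) ^ 2) := by
    intro J
    refine (Finset.sum_le_sum fun l _ => Finset.sum_le_sum fun k _ => hterm J l k).trans ?_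
    simp only [Finset.sum_add_distrib, ← Finset.mul_sum, ← Finset.sum_mul]
    refine add_le_add_left ?_ _
    have h1 : ∑ l ∈ S, 1 / (l : ℝ) ^ 2 * (M⁻¹ *
          ∑ k ∈ T, (∑ j ∈ Finset.range J, ((j : ℝ) + 1) * ρ ^ j * β l k j) ^ 2)
        ≤ ∑ l ∈ S, 1 / (l : ℝ) ^ 2 * (M⁻¹ * (Z * (Z * (2 * Real.pi / c * E)))) := by
      refine Finset.sum_le_sum fun l _ => ?_
      gcongr
      exact hβ' l J
    rw [← Finset.sum_mul] at h1
    have h2 : ∑ l ∈ S, 1 / (l : ℝ) ^ 2 ≤ Y := hs.sum_le_tsum _ fun l _ => by positivity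
    have h3 := mul_le_mul_of_nonneg_right h2
      (by positivity : 0 ≤ M⁻¹ * (Z * (Z * (2 * Real.pi / c * E))))
    linarith
  -- For fixed finite `S` and `T` the remainder of the iteration disappears as J → ∞.
  have hlim : Filter.Tendsto (fun J : ℕ => 2 * (Y * (M⁻¹ * (Z * (Z * (2 * Real.pi / c))))) * E
        + 2 * ((∑ l ∈ S, ∑ k ∈ T, (l : ℝ) / k) * (ρ ^ (J + 1) * (2 * Real.pi)) ^ 2))
      Filter.atTop (nhds (2 * (Y * (M⁻¹ * (Z * (Z * (2 * Real.pi / c))))) * E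
        + 2 * ((∑ l ∈ S, ∑ k ∈ T, (l : ℝ) / k) * (0 * (2 * Real.pi)) ^ 2))) := by
    have h1 := (tendsto_pow_atTop_nhds_zero_of_lt_one hρ0.le hρ1).comp (Filter.tendsto_add_atTop_nat 1)
    exact tendsto_const_nhds.add (((((h1.mul_const _).pow 2).const_mul _)).const_mul 2)
  have := ge_of_tendsto' hlim hsum
  simpa using this

end Oscillatory

/-! ### Approximation by trigonometric polynomials -/

/-- The real part of the trigonometric polynomial `∑ cₖ e^{ikθ}`. -/
def trigSum (F : Finset ℤ) (c : ℤ → ℂ) (θ : ℝ) : ℝ :=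
  ∑ k ∈ F, (c k * Complex.exp (Complex.I * k * θ)).re

theorem hasDerivAt_trigSum (F : Finset ℤ) (c : ℤ → ℂ) (θ : ℝ) :
    HasDerivAt (trigSum F c) (trigSum F (fun k => Complex.I * k * c k) θ) θ := by
  refine HasDerivAt.fun_sum fun k _ => ?_
  have h := (hasDerivAt_exp_int k θ).const_mul (c k)
  have h2 := (Complex.reCLM.hasFDerivAt (x := c k * Complex.exp (Complex.I * k * θ))).comp_hasDerivAt
    θ h
  have e : Complex.I * k * c k * Complex.exp (Complex.I * k * θ)
      = c k * (Complex.I * k * Complex.exp (Complex.I * k * θ)) := by ring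
  rw [e]
  exact h2

theorem deriv_trigSum (F : Finset ℤ) (c : ℤ → ℂ) :
    deriv (trigSum F c) = trigSum F fun k => Complex.I * k * c k :=
  funext fun θ => (hasDerivAt_trigSum F c θ).deriv

theorem contDiff_trigSum (F : Finset ℤ) (c : ℤ → ℂ) : ContDiff ℝ 2 (trigSum F c) := by
  refine ContDiff.sum fun k _ => ?_
  have h1 : ContDiff ℝ 2 fun θ : ℝ => (θ : ℂ) := Complex.ofRealCLM.contDiff
  exact Complex.reCLM.contDiff.comp (contDiff_const.mul (contDiff_const.mul h1).cexp)

theorem trigSum_periodic (F : Finset ℤ) (c : ℤ → ℂ) :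
    Function.Periodic (trigSum F c) (2 * Real.pi) := by
  intro θ
  simp only [trigSum, exp_int_period]

theorem isCircleLift_id : IsCircleLift fun θ => θ where
  contDiff := contDiff_id
  deriv_pos θ := by simp
  map_add_period θ := rfl

theorem integral_trigSum_sq_le (F : Finset ℤ) (c : ℤ → ℂ) :
    ∫ θ in (0 : ℝ)..(2 * Real.pi), trigSum F c θ ^ 2 ≤ 2 * Real.pi * ∑ k ∈ F, ‖c k‖ ^ 2 := by
  have h := integral_deriv_mul_norm_sq isCircleLift_id (m := fun k : ℤ => k)
    Function.injective_id F c
  simp only [deriv_id'', one_mul] at h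
  rw [← h]
  have c1 := (contDiff_trigSum F c).continuous
  refine intervalIntegral.integral_mono_on Real.two_pi_pos.le
    (Continuous.intervalIntegrable (by fun_prop) _ _)
    (Continuous.intervalIntegrable (by fun_prop) _ _) fun θ _ => ?_
  rw [trigSum, ← Complex.re_sum, ← sq_abs]
  exact pow_le_pow_left₀ (abs_nonneg _) (Complex.abs_re_le_norm _) 2

/-- A continuous real function with summable Fourier coefficients is the uniform limit of the
partial sums of its Fourier series. -/
theorem tendstoUniformly_trigSum {u : ℝ → ℝ} (hu : Continuous u)
    (hp : Function.Periodic u (2 * Real.pi))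
    (hs : Summable fun k : ℤ => ‖cfCoef (fun θ => (u θ : ℂ)) k‖) :
    TendstoUniformly (fun F θ => trigSum F (cfCoef fun θ => (u θ : ℂ)) θ) u Filter.atTop := by
  have h := tendstoUniformly_tsum (f := fun (k : ℤ) (θ : ℝ) =>
    (cfCoef (fun θ => (u θ : ℂ)) k * Complex.exp (Complex.I * k * θ)).re) hs (fun k θ => by
      refine (Complex.abs_re_le_norm _).trans (le_of_eq ?_)
      rw [norm_mul]
      simp [Complex.norm_exp])
  refine (congrArg (fun f => TendstoUniformly _ f _) (funext fun θ => ?_)).mp h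
  have h1 := hasSum_cfCoef_exp (u := fun θ => (u θ : ℂ)) (by fun_prop)
    (fun θ => by simp only [hp θ]) hs θ
  have h2 := (Complex.hasSum_re h1).tsum_eq
  rwa [Complex.ofReal_re] at h2

theorem tendsto_oscInt {ι : Type*} {L : Filter ι} [L.IsCountablyGenerated] {p : ι → ℝ → ℝ}
    {g : ℝ → ℝ} (hp : ∀ i, Continuous (p i))
    (hlim : ∀ θ, Filter.Tendsto (fun i => p i θ) L (nhds (g θ))) (l k : ℕ+) :
    Filter.Tendsto (fun i => oscInt (p i) l k fun _ => 1) L (nhds (oscInt g l k fun _ => 1)) := by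
  refine intervalIntegral.tendsto_integral_filter_of_dominated_convergence (fun _ => 1)
    (Filter.Eventually.of_forall fun i => ?_) (Filter.Eventually.of_forall fun i =>
      Filter.Eventually.of_forall fun θ _ => ?_) intervalIntegrable_const
    (Filter.Eventually.of_forall fun θ _ => ?_)
  · have := hp i
    exact Continuous.aestronglyMeasurable (by fun_prop)
  · rw [norm_mul, norm_exp_phase]
    simp
  · have h1 : Continuous fun x : ℝ => ((1 : ℝ) : ℂ) *
        Complex.exp (Complex.I * ((l : ℂ) * (θ : ℂ) + (k : ℂ) * (x : ℂ))) := by fun_prop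
    exact (h1.tendsto _).comp (hlim θ)

theorem IsCircleLift.exists_deriv_bounds {g : ℝ → ℝ} (hg : IsCircleLift g) :
    ∃ c M : ℝ, 0 < c ∧ ∀ θ, c ≤ deriv g θ ∧ deriv g θ ≤ M := by
  have hne : (Set.Icc (0 : ℝ) (2 * Real.pi)).Nonempty := ⟨0, le_rfl, Real.two_pi_pos.le⟩
  obtain ⟨x, _, hx⟩ := isCompact_Icc.exists_isMinOn hne hg.continuous_deriv.continuousOn
  obtain ⟨y, _, hy⟩ := isCompact_Icc.exists_isMaxOn hne hg.continuous_deriv.continuousOn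
  refine ⟨deriv g x, deriv g y, hg.deriv_pos x, fun θ => ?_⟩
  obtain ⟨t, ht, h⟩ := hg.deriv_periodic.exists_mem_Ico₀ Real.two_pi_pos θ
  rw [h]
  exact ⟨hx (Set.Ico_subset_Icc_self ht), hy (Set.Ico_subset_Icc_self ht)⟩

/-- The partial sums of the Fourier series of g - id give C² functions `p F`. The coefficients of g'
- 1 are absolutely summable, so the derivatives converge uniformly and eventually lie between c/2
and M + c. The integrals of the squared second derivatives stay below 2π ∑ k⁴|αₖ|², and finite sums
pass to the limit. -/
theorem exists_sum_oscInt_le_of_summable {g : ℝ → ℝ} (hg : IsCircleLift g)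
    (h2 : Summable fun k : ℤ => (k : ℝ) ^ 4 * ‖cfCoef (fun θ => ((g θ - θ : ℝ) : ℂ)) k‖ ^ 2) :
    ∃ C : ℝ, ∀ S T : Finset ℕ+,
      ∑ l ∈ S, ∑ k ∈ T, (l : ℝ) / k * ‖oscInt g l k (fun _ => 1)‖ ^ 2 ≤ C := by
  obtain ⟨c, M, hc, hb⟩ := hg.exists_deriv_bounds
  have hcM : c ≤ M := (hb 0).1.trans (hb 0).2
  obtain ⟨C, hC0, hC⟩ := exists_sum_oscInt_le (c := c / 2) (M := M + c) (by linarith) (by linarith)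
  set α : ℤ → ℂ := cfCoef fun θ => ((g θ - θ : ℝ) : ℂ) with hα
  have hdiff : ContDiff ℝ 1 fun θ => g θ - θ := hg.contDiff.sub contDiff_id
  have hper : Function.Periodic (fun θ => g θ - θ) (2 * Real.pi) := by
    intro θ
    simp only [hg.map_add_period]
    ring
  have hu : PeriodicC1 fun θ => ((g θ - θ : ℝ) : ℂ) :=
    ⟨Complex.ofRealCLM.contDiff.comp hdiff, fun θ => by
      have := hper θ
      simp only at this
      rw [this]⟩
  have hd : deriv (fun θ => ((g θ - θ : ℝ) : ℂ)) = fun θ => ((deriv g θ - 1 : ℝ) : ℂ) :=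
    funext fun θ => (((hg.hasDerivAt θ).sub (hasDerivAt_id θ)).ofReal_comp).deriv
  have hα' : (fun k : ℤ => Complex.I * k * α k) = cfCoef fun θ => ((deriv g θ - 1 : ℝ) : ℂ) := by
    funext k
    rw [← hd, cfCoef_deriv hu]
  have hs' : Summable fun k : ℤ => ‖cfCoef (fun θ => ((deriv g θ - 1 : ℝ) : ℂ)) k‖ := by
    have h1 : Summable fun k : ℤ => 1 / (k : ℝ) ^ 2 := Real.summable_one_div_int_pow.2 one_lt_two
    refine (h1.add h2).of_nonneg_of_le (fun _ => norm_nonneg _) fun k => ?_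
    rw [← hα', norm_mul, norm_mul, Complex.norm_I, one_mul, Complex.norm_intCast]
    by_cases hk : k = 0
    · subst hk
      simp
    · have hk' : (0 : ℝ) < |(k : ℝ)| := by positivity
      have h3 : |(k : ℝ)| * ‖α k‖ = 1 / |(k : ℝ)| * ((k : ℝ) ^ 2 * ‖α k‖) := by
        rw [← sq_abs]
        field_simp
      have h4 : 1 / (k : ℝ) ^ 2 = (1 / |(k : ℝ)|) ^ 2 := by
        rw [div_pow, sq_abs, one_pow]
      rw [h3, h4]
      nlinarith [sq_nonneg (1 / |(k : ℝ)| - (k : ℝ) ^ 2 * ‖α k‖),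
        sq_nonneg (1 / |(k : ℝ)|), sq_nonneg ((k : ℝ) ^ 2 * ‖α k‖)]
  let p : Finset ℤ → ℝ → ℝ := fun F θ => θ + trigSum F α θ
  have hp2 : ∀ F, ContDiff ℝ 2 (p F) := fun F => contDiff_id.add (contDiff_trigSum F α)
  have hpd : ∀ F, deriv (p F) = fun θ => 1 + trigSum F (fun k : ℤ => Complex.I * k * α k) θ :=
    fun F => funext fun θ => ((hasDerivAt_id θ).add (hasDerivAt_trigSum F α θ)).deriv
  have hpdd : ∀ F, deriv (deriv (p F))
      = trigSum F fun k : ℤ => Complex.I * k * (Complex.I * k * α k) := by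
    intro F
    rw [hpd]
    funext θ
    rw [deriv_const_add, deriv_trigSum]
  have hlim : ∀ θ, Filter.Tendsto (fun F => p F θ) Filter.atTop (nhds (g θ)) := by
    intro θ
    have h3 := ((tendstoUniformly_trigSum hdiff.continuous hper
      (summable_norm_cfCoef hu)).tendsto_at θ).const_add θ
    rwa [add_sub_cancel] at h3
  have hunif : ∀ᶠ F in Filter.atTop, ∀ θ, |deriv (p F) θ - deriv g θ| < c / 2 := by
    have c1 := hg.continuous_deriv
    have h3 := tendstoUniformly_trigSum (u := fun θ => deriv g θ - 1) (by fun_prop)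
      (fun θ => by simp only [hg.deriv_periodic θ]) hs'
    filter_upwards [Metric.tendstoUniformly_iff.1 h3 (c / 2) (by linarith)] with F hF θ
    have h4 := hF θ
    rw [dist_comm, Real.dist_eq, ← hα'] at h4
    rw [hpd]
    refine lt_of_eq_of_lt (congrArg _ ?_) h4
    ring
  refine ⟨C * (2 * Real.pi * ∑' k : ℤ, (k : ℝ) ^ 4 * ‖α k‖ ^ 2), fun S T => ?_⟩
  have htend : Filter.Tendsto (fun F => ∑ l ∈ S, ∑ k ∈ T,
      (l : ℝ) / k * ‖oscInt (p F) l k (fun _ => 1)‖ ^ 2) Filter.atTop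
      (nhds (∑ l ∈ S, ∑ k ∈ T, (l : ℝ) / k * ‖oscInt g l k (fun _ => 1)‖ ^ 2)) :=
    tendsto_finsetSum _ fun l _ => tendsto_finsetSum _ fun k _ =>
      ((tendsto_oscInt (fun F => (hp2 F).continuous) hlim l k).norm.pow 2).const_mul _
  refine le_of_tendsto htend (hunif.mono fun F hF => ?_)
  have hlow : ∀ θ, c / 2 ≤ deriv (p F) θ := fun θ => by
    have h3 := abs_lt.1 (hF θ)
    linarith [(hb θ).1]
  have hup : ∀ θ, deriv (p F) θ ≤ M + c := fun θ => by
    have h3 := abs_lt.1 (hF θ)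
    linarith [(hb θ).2]
  have hlift : IsCircleLift (p F) := by
    refine ⟨(hp2 F).of_le (by norm_num), fun θ => lt_of_lt_of_le (by linarith) (hlow θ),
      fun θ => ?_⟩
    simp only [p, trigSum_periodic F α θ]
    ring
  refine (hC (p F) hlift (hp2 F) hlow hup S T).trans (mul_le_mul_of_nonneg_left ?_ hC0)
  rw [hpdd]
  refine (integral_trigSum_sq_le F _).trans (mul_le_mul_of_nonneg_left ?_ Real.two_pi_pos.le)
  refine le_trans (le_of_eq (Finset.sum_congr rfl fun k _ => ?_))
    (h2.sum_le_tsum F fun k _ => by positivity)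
  rw [norm_mul, norm_mul, norm_mul, norm_mul, Complex.norm_I, Complex.norm_intCast, mul_pow,
    mul_pow, mul_pow, mul_pow, sq_abs]
  ring

theorem norm_sq_expNegClass_apply {g : ℝ → ℝ} (hg : IsCircleLift g) (k l : ℕ+) :
    ‖expNegClass hg k l‖ ^ 2
      = ((2 * Real.pi)⁻¹) ^ 2 * ((l : ℝ) / k * ‖oscInt g l k (fun _ => 1)‖ ^ 2) := by
  have h1 : ‖cfCoef (fun θ => Complex.exp (Complex.I * (-((k : ℕ) : ℤ) : ℤ) * g θ)) ((l : ℕ) : ℤ)‖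
      = (2 * Real.pi)⁻¹ * ‖oscInt g l k (fun _ => 1)‖ := by
    have e : ∀ θ : ℝ, Complex.exp (-(Complex.I * ((l : ℕ) : ℤ) * θ)) *
        Complex.exp (Complex.I * (-((k : ℕ) : ℤ) : ℤ) * g θ)
          = (starRingEnd ℂ) (((1 : ℝ) : ℂ) * Complex.exp (Complex.I * (l * θ + k * g θ))) := by
      intro θ
      rw [Complex.ofReal_one, one_mul, ← Complex.exp_conj, ← Complex.exp_add]
      congr 1
      simp
      ring
    have e2 : ∫ θ in (0 : ℝ)..(2 * Real.pi), (starRingEnd ℂ)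
        (((1 : ℝ) : ℂ) * Complex.exp (Complex.I * (l * θ + k * g θ)))
          = (starRingEnd ℂ) (oscInt g l k fun _ => 1) := by
      simp only [oscInt, intervalIntegral, map_sub, ← integral_conj]
    rw [cfCoef, intervalIntegral.integral_congr fun θ _ => e θ, e2, norm_mul, RCLike.norm_conj]
    congr 1
    rw [one_div, norm_inv, norm_mul, Complex.norm_real, Real.norm_of_nonneg Real.pi_pos.le]
    simp
  rw [expNegClass, lp.coeFn_smul, Pi.smul_apply, posPart_apply, smul_eq_mul, norm_mul, norm_mul,
    norm_inv, Complex.norm_real, Complex.norm_real, Real.norm_of_nonneg (Real.sqrt_nonneg _),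
    Real.norm_of_nonneg (Real.sqrt_nonneg _), h1, mul_pow, mul_pow, mul_pow, inv_pow,
    Real.sq_sqrt (by positivity), Real.sq_sqrt (by positivity)]
  ring

/-- The antilinear part of the composition operator with a diffeomorphism of class `H²` is
Hilbert-Schmidt. -/
theorem summable_norm_sq_expNegClass {g : ℝ → ℝ} (hg : IsCircleLift g) {s : ℝ} (hs : 2 ≤ s)
    (hsob : MemSobolev s fun θ => g θ - θ) : Summable fun k => ‖expNegClass hg k‖ ^ 2 := by
  have h2 : Summable fun k : ℤ => (k : ℝ) ^ 4 * ‖cfCoef (fun θ => ((g θ - θ : ℝ) : ℂ)) k‖ ^ 2 := by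
    refine hsob.summable.of_nonneg_of_le (fun k => by positivity) fun k => ?_
    rw [fourierCoef_eq_cfCoef]
    refine mul_le_mul_of_nonneg_right ?_ (by positivity)
    have h3 : (1 + (k : ℝ) ^ 2) ^ (2 : ℝ) ≤ (1 + (k : ℝ) ^ 2) ^ s :=
      Real.rpow_le_rpow_of_exponent_le (by nlinarith [sq_nonneg (k : ℝ)]) hs
    rw [Real.rpow_two] at h3
    nlinarith [sq_nonneg (k : ℝ)]
  obtain ⟨C, hC⟩ := exists_sum_oscInt_le_of_summable hg h2
  refine summable_of_sum_le (c := ((2 * Real.pi)⁻¹) ^ 2 * C) (fun _ => by positivity) fun T => ?_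
  have h3 : HasSum (fun l => ∑ k ∈ T, ‖expNegClass hg k l‖ ^ 2) (∑ k ∈ T, ‖expNegClass hg k‖ ^ 2) :=
    hasSum_sum fun k _ => hasSum_norm_sq (expNegClass hg k)
  refine hasSum_le_of_sum_le h3 fun S => ?_
  simp only [norm_sq_expNegClass_apply, ← Finset.mul_sum]
  exact mul_le_mul_of_nonneg_left (hC S T) (by positivity)

end CircleFock

end

theorem proposition5p2 (s : ℝ) (hs : 2 < s) (γ : Circle ≃ₘ^1⟮𝓡 1, 𝓡 1⟯ Circle)
    (hγ : γ ∈ SobolevDiffeo s) :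
    ∃ V : OneParticle ≃L[ℝ] OneParticle,
      (∀ ξ η : OneParticle, (⟪V ξ, V η⟫_ℂ).im = (⟪ξ, η⟫_ℂ).im) ∧
      ∃ U ∈ unitary (FockSpace ℕ+ →L[ℂ] FockSpace ℕ+),
        (∀ ξ : OneParticle, U * weyl ξ * star U = weyl (V ξ)) ∧
        ∀ f : Circle → ℝ, ContMDiff (𝓡 1) 𝓘(ℝ, ℝ) ∞ f →
          ∃ (hf : MemSobolev (1 / 2) (angular f))
            (hfγ : MemSobolev (1 / 2) (angular (f ∘ γ.symm))),
            V (oneParticleClass f hf) = oneParticleClass (f ∘ γ.symm) hfγ ∧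
            U * weyl (oneParticleClass f hf) * star U
              = weyl (oneParticleClass (f ∘ γ.symm) hfγ) := by
  obtain ⟨g, hg, hpos, hper, hlift, hsob⟩ := hγ
  have hg' : IsCircleLift g := ⟨hg, hpos, hper⟩
  exact exists_implementer γ hg' hlift (summable_norm_sq_expNegClass hg' hs.le hsob)
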